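/- Let $d\ge 1$, $q>1$ real, and write $\Lambda_n=\{x\in\mathbb Z^d:|x|_\infty\le n\}$, $\partial\Lambda_n=\{x\in\mathbb Z^d:|x|_\infty=n\}$. Add to the nearest-neighbour graph $\mathbb Z^d$ a ghost vertex $\mathrm g$ joined to every vertex by an external edge. For $p\in[0,1]$, $h\ge 0$ and $p_h=1-\exp(-\frac{q}{q-1}h)$, let $\phi^1_{p,q,h,\Lambda_n}$ be the wired random cluster measure on the configurations $\omega$ of open and closed edges of $\Lambda_n\cup\{\mathrm g\}$, which gives $\omega$ a probability proportional to $$p^{o(\omega_{\mathrm{in}})}(1-p)^{c(\omega_{\mathrm{in}})}\,p_h^{o(\omega_{\mathrm g})}(1-p_h)^{c(\omega_{\mathrm g})}\,q^{\kappa(\omega)}.$$ Here $o$ and $c$ count open and closed edges, $\omega_{\mathrm{in}}$ and $\omega_{\mathrm g}$ are the restrictions of $\omega$ to the internal edges (those of $\mathbb Z^d$ with both endpoints in $\Lambda_n$) and to the external edges, and $\kappa(\omega)$ is the number of clusters when the vertices of $\partial\Lambda_n$ and the ghost are identified. Let $\phi^1_{p,q,h,\mathbb Z^d}$ be the weak limit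 of these measures as $n\to\infty$. There is no percolation at $(p,h)$ if this limit exists and, almost surely under it, there is no infinite cluster of open internal edges (connections through the ghost are not used). Let $p_c(q,0)$ be the supremum of the $p\in[0,1]$ for which there is no percolation at $(p,0)$, and let $h_c(p,q)\in[0,\infty]$ (the Kertész line) be the supremum of the $h\ge0$ for which there is no percolation at $(p,h)$. In the following, $A\leftrightarrow B$ means that some vertex of $A$ is connected to some vertex of $B$ by open internal edges. Let $0<p<p_c(q,0)$, $\mu=\frac{(2d+1)^{2d+1}}{(2d)^{2d}}$ and $\delta=\mu^{-4^d}$. Then there is a smallest natural number $k$ with $$\phi^1_{p,q,0,\Lambda_{3k}}[\Lambda_k\leftrightarrow\partial\Lambda_{3k}]<\frac{\delta}{2},$$ and for this $k$ there is no percolation at $(p,h)$ for every $h\ge0$ with $$p_h<1-\Bigl(1-\frac{\delta}{2}\Bigr)^{1/|\Lambda_{3k}|}.$$ In particular $$h_c(p,q)\ \ge\ -\frac{q-1}{q}\,\frac{\log(1-\delta/2)}{|\Lambda_{3k}|}.$$ -/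

import Mathlib

open MeasureTheory Filter Topology

noncomputable section

namespace RandomCluster

/-! ### Percolation configurations on a graph with a ghost vertex -/

/-- A percolation configuration on the graph `G` extended by a ghost vertex. The first component
gives the states (`true` = open) of the internal edges, i.e. the edges of `G`; the second
component gives the states of the external edges, where the edge from `v` to the ghost is
indexed by `v`. -/
abbrev Config {V : Type*} (G : SimpleGraph V) : Type _ := (G.edgeSet → Bool) × (V → Bool)

variable {V : Type*} {G : SimpleGraph V}

/-- The graph of open internal edges: connections in it do not use the ghost. -/
def internalGraph (ω : Config G) : SimpleGraph V where
  Adj x y := ∃ e : G.edgeSet, e.1 = s(x, y) ∧ ω.1 e = true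
  symm := ⟨fun _ _ ⟨e, he, ho⟩ => ⟨e, he.trans Sym2.eq_swap, ho⟩⟩
  loopless := ⟨fun x ⟨e, he, _⟩ => G.loopless.irrefl x (G.mem_edgeSet.1 (he ▸ e.2))⟩

/-- The graph on `V` together with the ghost `none` which consists of all open edges, internal
and external, and in which moreover every vertex of `W` is joined to the ghost. Its connected
components are those of the open subgraph after the vertices in `W` and the ghost are
identified. -/
def openGraph (W : Set V) (ω : Config G) : SimpleGraph (Option V) :=
  SimpleGraph.fromRel fun a b =>
    match a, b with
    | some x, some y => (internalGraph ω).Adj x y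
    | some x, none => ω.2 x = true ∨ x ∈ W
    | none, _ => False

/-- The number of clusters of `ω`, when `W` and the ghost are identified. -/
def clusterCount (W : Set V) (ω : Config G) : ℕ :=
  Nat.card (openGraph W ω).ConnectedComponent

/-- The parameter `p_h = 1 - exp (- q / (q - 1) * h)` of the external edges. -/
def extParam (q h : ℝ) : ℝ := 1 - Real.exp (-(q / (q - 1)) * h)

open Classical in
/-- The random cluster weight of a configuration on a finite graph:
`p ^ #open (1 - p) ^ #closed` over internal edges, `p_h ^ #open (1 - p_h) ^ #closed` over
external edges, and a factor `q` for each cluster. -/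
def weight [Fintype V] (p q h : ℝ) (W : Set V) (ω : Config G) : ℝ :=
  (∏ e : G.edgeSet, if ω.1 e = true then p else 1 - p) *
    (∏ v : V, if ω.2 v = true then extParam q h else 1 - extParam q h) *
    q ^ clusterCount W ω

open Classical in
/-- The random cluster probability of a single configuration on a finite graph. -/
def prob [Fintype V] (p q h : ℝ) (W : Set V) (ω : Config G) : ℝ :=
  weight p q h W ω / ∑ ω' : Config G, weight p q h W ω'

/-- Regard a configuration on the subgraph induced by `Λ` as a configuration on the whole graph,
all other edges being closed. -/
def extend (Λ : Finset V) (ω : Config (G.induce (Λ : Set V))) : Config G :=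
  open Classical in
  (fun e => decide (∃ f : (G.induce (Λ : Set V)).edgeSet,
      Sym2.map Subtype.val f.1 = e.1 ∧ ω.1 f = true),
    fun v => decide (∃ w : (Λ : Set V), w.1 = v ∧ ω.2 w = true))

/-! ### The hypercubic lattice -/

/-- The nearest neighbour graph on `ℤ ^ d`. -/
def lattice (d : ℕ) : SimpleGraph (Fin d → ℤ) where
  Adj x y := ∑ i, |x i - y i| = 1
  symm := ⟨fun x y hxy => by simpa only [abs_sub_comm] using hxy⟩
  loopless := ⟨fun x hx => by simp at hx⟩

/-- The box `Λ_n = {x ∈ ℤ ^ d : |x|_∞ ≤ n}`. -/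
def box (d n : ℕ) : Finset (Fin d → ℤ) := Finset.Icc (fun _ => -(n : ℤ)) (fun _ => (n : ℤ))

/-- The boundary `∂Λ_n = {x ∈ ℤ ^ d : |x|_∞ = n}` (for `d ≥ 1`). -/
def boxBoundary (d n : ℕ) : Set (Fin d → ℤ) := {x | x ∈ box d n ∧ ∃ i, |x i| = (n : ℤ)}

open Classical in
/-- The random cluster measure `φ¹_{p,q,h,Λ_n}` with wired boundary condition: the graph is the
subgraph of the lattice induced by `Λ_n`, and `∂Λ_n` and the ghost are identified. (For `h = 0`
the ghost is almost surely isolated, so identifying it with `∂Λ_n` or not gives the same law.)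
It is a law on configurations of the whole lattice which are closed outside the box. -/
def wiredMeasure (d : ℕ) (p q h : ℝ) (n : ℕ) : Measure (Config (lattice d)) :=
  ∑ ω : Config ((lattice d).induce (box d n : Set (Fin d → ℤ))),
    ENNReal.ofReal (prob p q h {x | x.1 ∈ boxBoundary d n} ω) • Measure.dirac (extend (box d n) ω)

/-- The event `{A ↔ B}` that some vertex of `A` is connected to some vertex of `B` by open
internal edges. -/
def connects (d : ℕ) (A B : Set (Fin d → ℤ)) : Set (Config (lattice d)) :=
  {ω | ∃ x ∈ A, ∃ y ∈ B, (internalGraph ω).Reachable x y}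

/-- Events which depend on the states of only finitely many edges. -/
def IsLocal {d : ℕ} (A : Set (Config (lattice d))) : Prop :=
  ∃ (E : Finset (lattice d).edgeSet) (S : Finset (Fin d → ℤ)), ∀ ω ω' : Config (lattice d),
    (∀ e ∈ E, ω.1 e = ω'.1 e) → (∀ v ∈ S, ω.2 v = ω'.2 v) → (ω ∈ A ↔ ω' ∈ A)

/-- `μ` is the infinite volume wired random cluster measure `φ¹_{p,q,h,ℤ^d}`: the weak limit of
the measures on the boxes `Λ_n`. It is unique, as local events determine a measure. -/
structure IsInfiniteVolume (d : ℕ) (p q h : ℝ) (μ : Measure (Config (lattice d))) : Prop where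
  isProbabilityMeasure : IsProbabilityMeasure μ
  tendsto : ∀ A : Set (Config (lattice d)), IsLocal A →
    Tendsto (fun n => wiredMeasure d p q h n A) atTop (𝓝 (μ A))

/-- The event that there is an infinite cluster of open internal edges, i.e. that there is
percolation without using the ghost. -/
def percolationEvent (d : ℕ) : Set (Config (lattice d)) :=
  {ω | ∃ x, {y | (internalGraph ω).Reachable x y}.Infinite}

/-- There is no percolation (without using the ghost) at `(p, q, h)`: the infinite volume
measure exists and gives probability zero to the existence of an infinite internal cluster. -/
def NoPercolation (d : ℕ) (p q h : ℝ) : Prop :=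
  ∃ μ : Measure (Config (lattice d)), IsInfiniteVolume d p q h μ ∧ μ (percolationEvent d) = 0

/-- The critical edge parameter `p_c(q, h)`. -/
def criticalP (d : ℕ) (q h : ℝ) : ℝ := sSup {p | p ∈ Set.Icc (0 : ℝ) 1 ∧ NoPercolation d p q h}

/-- The critical field `h_c(p, q) ∈ [0, ∞]`, i.e. the Kertész line. -/
def criticalH (d : ℕ) (p q : ℝ) : ENNReal :=
  ⨆ (h : ℝ) (_ : 0 ≤ h ∧ NoPercolation d p q h), ENNReal.ofReal h

/-- The constant `(2d+1)^(2d+1) / (2d)^(2d)`. -/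
def animalConst (d : ℕ) : ℝ := (2 * d + 1 : ℝ) ^ (2 * d + 1) / (2 * d : ℝ) ^ (2 * d)

/-- The threshold `δ = μ ^ (-4 ^ d)`, where `μ = (2d+1)^(2d+1) / (2d)^(2d)`. -/
def delta (d : ℕ) : ℝ := (animalConst d ^ (4 ^ d))⁻¹

end RandomCluster

end

open RandomCluster

/-! The proof combines a finite volume criterion, stable under a small field, with sharpness of the
phase transition at zero field. Both rest on one fact: the number of connected components is
supermodular in the graph (`card_connectedComponent_supermodular`). It gives random cluster weights
with `q ≥ 1` the lattice condition, hence the Holley and FKG inequalities, and shows that a wired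
box dominates, for increasing events inside it, any conditioning on the edges outside
(`fkMean_mul_le`, `boxMean_mul_le`).

Criterion (`noPercolation_of_crossing_lt`): let `a` be the probability, in the wired box `Λ_{3k}`,
that `Λ_k` is joined to `∂Λ_{3k}`. Cover the lattice by boxes of radius `k` centred at the multiples
of `2k`. A box visited by an infinite cluster is joined to the boundary of the concentric box of
radius `3k`, and the indices of visited boxes contain self-avoiding nearest neighbour paths of every
length. Among `4^d * m` boxes on such a path some `m` have indices congruent modulo 4; their boxes
of radius `3k` are disjoint, so they are all crossed with probability at most `a^m`. At most
`(2d)^(4^d * m)` paths compete, and `(2d)^(4^d) * a < 1` once `a < δ`, because `μ ≥ 2d`. Letting `m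
→ ∞` excludes an infinite cluster.

Field (`boxMean_field_le`): in `Λ_{3k}` all external edges are closed with probability at least `(1
- p_h)^|Λ_{3k}|`, and on that event the field is absent. So the field raises `a` by at most `1 - (1
- p_h)^|Λ_{3k}|`, which is below `δ/2` exactly when `p_h` satisfies the stated bound.

Existence of `k`: by a union bound the zero field crossing probability is at most `|Λ_k| θ_k`, where
`θ_k` is the arm probability `armProb`. For `p < p_c` it has to decay faster than `k^(-d)`. The OSSS
inequality for monotonic measures (`osss`) is applied to explorations of the clusters of `∂Λ_k`,
averaged over `1 ≤ k ≤ n`. With Russo's formula this gives `n θ_n (1 - θ_n) ≤ 2 (θ_0 + ... +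
θ_{n-1}) θ_n'`, and a family with this property which tends to zero at some parameter decays like
`exp(-c √n)` at every smaller one (`decay_of_differential_inequality`). -/

noncomputable section

namespace RandomCluster

/-! ### Correlation inequalities on a finite powerset -/

section Correlation

variable {ε : Type*} [DecidableEq ε]

/-- The **Holley inequality** on a finite powerset: if `w₁` and `w₂` satisfy the lattice condition,
then increasing functions have a larger mean under `w₂` than under `w₁`. -/
theorem holley_powerset (E : Finset ε) {w₁ w₂ f : Finset ε → ℝ} (h₁ : ∀ s ⊆ E, 0 ≤ w₁ s)
    (h₂ : ∀ s ⊆ E, 0 ≤ w₂ s) (hf : ∀ s ⊆ E, 0 ≤ f s)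
    (hm : ∀ s t, s ⊆ t → t ⊆ E → f s ≤ f t)
    (h : ∀ s ⊆ E, ∀ t ⊆ E, w₁ s * w₂ t ≤ w₁ (s ∩ t) * w₂ (s ∪ t)) :
    (∑ s ∈ E.powerset, w₁ s * f s) * ∑ s ∈ E.powerset, w₂ s ≤
      (∑ s ∈ E.powerset, w₁ s) * ∑ s ∈ E.powerset, w₂ s * f s := by
  -- The four functions are `w₁ f`, `w₂`, `w₁` and `w₂ f`, cut off to zero outside the subsets of
  -- `E` because the four functions theorem wants nonnegativity on all finite sets.
  have key := Finset.four_functions_theorem (β := ℝ) E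
    (f₁ := fun s => if s ⊆ E then w₁ s * f s else 0) (f₂ := fun s => if s ⊆ E then w₂ s else 0)
    (f₃ := fun s => if s ⊆ E then w₁ s else 0) (f₄ := fun s => if s ⊆ E then w₂ s * f s else 0)
    (fun s => by
      by_cases hs : s ⊆ E
      · simpa [hs] using mul_nonneg (h₁ s hs) (hf s hs)
      · simp [hs])
    (fun s => by
      by_cases hs : s ⊆ E
      · simpa [hs] using h₂ s hs
      · simp [hs])
    (fun s => by
      by_cases hs : s ⊆ E
      · simpa [hs] using h₁ s hs
      · simp [hs])
    (fun s => by
      by_cases hs : s ⊆ E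
      · simpa [hs] using mul_nonneg (h₂ s hs) (hf s hs)
      · simp [hs])
    (fun s hs t ht => by
      have hst : s ∩ t ⊆ E := Finset.inter_subset_left.trans hs
      have hst' : s ∪ t ⊆ E := Finset.union_subset hs ht
      simp only [hs, ht, hst, hst', if_true]
      calc w₁ s * f s * w₂ t = w₁ s * w₂ t * f s := by ring
        _ ≤ w₁ (s ∩ t) * w₂ (s ∪ t) * f (s ∪ t) :=
          mul_le_mul (h s hs t ht) (hm s _ Finset.subset_union_left hst') (hf s hs)
            (mul_nonneg (h₁ _ hst) (h₂ _ hst'))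
        _ = _ := by ring)
    (Finset.Subset.refl E.powerset) (Finset.Subset.refl E.powerset)
  rw [Finset.powerset_infs_powerset_self, Finset.powerset_sups_powerset_self] at key
  have conv : ∀ g : Finset ε → ℝ,
      ∑ s ∈ E.powerset, (if s ⊆ E then g s else 0) = ∑ s ∈ E.powerset, g s := fun g =>
    Finset.sum_congr rfl fun s hs => if_pos (Finset.mem_powerset.1 hs)
  simpa only [conv] using key

/-- A sum over the subsets of a disjoint union is an iterated sum. -/
theorem sum_powerset_union {A B : Finset ε} (hAB : Disjoint A B) (F : Finset ε → ℝ) :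
    ∑ s ∈ (A ∪ B).powerset, F s = ∑ s ∈ A.powerset, ∑ t ∈ B.powerset, F (s ∪ t) := by
  rw [← Finset.sum_product']
  refine Finset.sum_bij' (fun s _ => (s ∩ A, s ∩ B)) (fun x _ => x.1 ∪ x.2) ?_ ?_ ?_ ?_ ?_
  · intro s _
    simp [Finset.inter_subset_right]
  · rintro ⟨s, t⟩ h
    simp only [Finset.mem_product, Finset.mem_powerset] at h ⊢
    exact Finset.union_subset_union h.1 h.2
  · intro s hs
    rw [Finset.mem_powerset] at hs
    simp only [← Finset.inter_union_distrib_left]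
    exact Finset.inter_eq_left.2 hs
  · rintro ⟨s, t⟩ h
    simp only [Finset.mem_product, Finset.mem_powerset] at h
    have h1 : t ∩ A = ∅ := Finset.disjoint_iff_inter_eq_empty.1 (hAB.symm.mono_left h.2)
    have h2 : s ∩ B = ∅ := Finset.disjoint_iff_inter_eq_empty.1 (hAB.mono_left h.1)
    simp [Finset.union_inter_distrib_right, h1, h2, Finset.inter_eq_left.2 h.1,
      Finset.inter_eq_left.2 h.2]
  · intro s hs
    rw [Finset.mem_powerset] at hs
    simp only [← Finset.inter_union_distrib_left]
    rw [Finset.inter_eq_left.2 hs]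

/-! ### The OSSS inequality for monotonic measures -/

/-- The integral of `F` with weight `w` over the configurations `ω ⊆ E` which agree with `a`
on `S`. -/
def cylSum (E : Finset ε) (w : Finset ε → ℝ) (S a : Finset ε) (F : Finset ε → ℝ) : ℝ :=
  ∑ η ∈ (E \ S).powerset, w (a ∪ η) * F (a ∪ η)

/-- The conditional mean of `F` given that the configuration agrees with `a` on `S`. -/
def cylMean (E : Finset ε) (w : Finset ε → ℝ) (S a : Finset ε) (F : Finset ε → ℝ) : ℝ :=
  cylSum E w S a F / cylSum E w S a 1

/-- The indicator function that `e` is open. -/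
def openInd (e : ε) (ω : Finset ε) : ℝ := if e ∈ ω then 1 else 0

/-- The covariance of `F` and `G` under the probability measure with weight `w` on the subsets
of `E`. -/
def wCov (E : Finset ε) (w F G : Finset ε → ℝ) : ℝ :=
  cylMean E w ∅ ∅ (F * G) - cylMean E w ∅ ∅ F * cylMean E w ∅ ∅ G

variable {E : Finset ε} {w : Finset ε → ℝ}

theorem cylSum_empty (F : Finset ε → ℝ) :
    cylSum E w ∅ ∅ F = ∑ ω ∈ E.powerset, w ω * F ω := by
  simp [cylSum]

theorem cylSum_step {S a : Finset ε} {e : ε} (he : e ∈ E \ S) (F : Finset ε → ℝ) :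
    cylSum E w S a F = cylSum E w (insert e S) a F + cylSum E w (insert e S) (insert e a) F := by
  have h1 : E \ S = insert e (E \ insert e S) := by
    ext x
    simp only [Finset.mem_sdiff, Finset.mem_insert] at he ⊢
    by_cases hx : x = e
    · subst hx; simp [he]
    · simp [hx]
  rw [cylSum, h1, Finset.sum_powerset_insert (by simp)]
  simp [cylSum, Finset.insert_union]

theorem sum_cylSum {S : Finset ε} (hS : S ⊆ E) (F : Finset ε → ℝ) :
    ∑ y ∈ S.powerset, cylSum E w S y F = ∑ ω ∈ E.powerset, w ω * F ω := by
  have h := sum_powerset_union (A := S) (B := E \ S) Finset.disjoint_sdiff fun ω => w ω * F ω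
  rw [Finset.union_sdiff_of_subset hS] at h
  exact h.symm

theorem union_subset_of_cyl {S a η : Finset ε} (hS : S ⊆ E) (ha : a ⊆ S) (hη : η ⊆ E \ S) :
    a ∪ η ⊆ E :=
  Finset.union_subset (ha.trans hS) (hη.trans Finset.sdiff_subset)

theorem cylSum_one_pos (hw : ∀ ω ⊆ E, 0 < w ω) {S a : Finset ε} (hS : S ⊆ E) (ha : a ⊆ S) :
    0 < cylSum E w S a 1 := by
  refine Finset.sum_pos (fun η hη => ?_) (Finset.powerset_nonempty _)
  simpa using hw _ (union_subset_of_cyl hS ha (Finset.mem_powerset.1 hη))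

theorem cylSum_congr {S a : Finset ε} {F G : Finset ε → ℝ}
    (h : ∀ η ⊆ E \ S, F (a ∪ η) = G (a ∪ η)) : cylSum E w S a F = cylSum E w S a G :=
  Finset.sum_congr rfl fun η hη => by rw [h η (Finset.mem_powerset.1 hη)]

theorem cylMean_nonneg (hw : ∀ ω ⊆ E, 0 < w ω) {S a : Finset ε} (hS : S ⊆ E) (ha : a ⊆ S)
    {F : Finset ε → ℝ} (hF : ∀ ω ⊆ E, 0 ≤ F ω) : 0 ≤ cylMean E w S a F := by
  refine div_nonneg (Finset.sum_nonneg fun η hη => ?_) (cylSum_one_pos hw hS ha).le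
  have := union_subset_of_cyl hS ha (Finset.mem_powerset.1 hη)
  exact mul_nonneg (hw _ this).le (hF _ this)

theorem cylMean_const (hw : ∀ ω ⊆ E, 0 < w ω) {S a : Finset ε} (hS : S ⊆ E) (ha : a ⊆ S)
    {F : Finset ε → ℝ} {c : ℝ} (hF : ∀ η ⊆ E \ S, F (a ∪ η) = c) : cylMean E w S a F = c := by
  have h : cylSum E w S a F = c * cylSum E w S a 1 := by
    rw [cylSum, cylSum, Finset.mul_sum]
    refine Finset.sum_congr rfl fun η hη => ?_
    rw [hF η (Finset.mem_powerset.1 hη)]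
    simp [mul_comm]
  rw [cylMean, h, mul_div_assoc, div_self (cylSum_one_pos hw hS ha).ne', mul_one]

/-- Conditional means of increasing functions increase with the condition. -/
theorem cylMean_mono (hw : ∀ ω ⊆ E, 0 < w ω)
    (hl : ∀ s ⊆ E, ∀ t ⊆ E, w s * w t ≤ w (s ∩ t) * w (s ∪ t)) {F : Finset ε → ℝ}
    (hF : ∀ ω, 0 ≤ F ω) (hFm : Monotone F) {S y y' : Finset ε} (hS : S ⊆ E) (hy : y ⊆ y')
    (hy' : y' ⊆ S) : cylMean E w S y F ≤ cylMean E w S y' F := by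
  have hyS := hy.trans hy'
  rw [cylMean, cylMean, div_le_div_iff₀ (cylSum_one_pos hw hS hyS) (cylSum_one_pos hw hS hy')]
  -- Holley compares the two conditional laws on the edges outside `S`. It needs one test function
  -- for both, so `F` is first frozen at the larger condition `y'`, which `h0` pays for by
  -- monotonicity.
  have h := holley_powerset (E \ S) (w₁ := fun η => w (y ∪ η)) (w₂ := fun η => w (y' ∪ η))
    (f := fun η => F (y' ∪ η))
    (fun s hs => (hw _ (union_subset_of_cyl hS hyS hs)).le)
    (fun s hs => (hw _ (union_subset_of_cyl hS hy' hs)).le)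
    (fun s _ => hF _) (fun s t hst _ => hFm (Finset.union_subset_union_right hst))
    (fun s hs t ht => by
      have h := hl _ (union_subset_of_cyl hS hyS hs) _ (union_subset_of_cyl hS hy' ht)
      have h1 : (y ∪ s) ∩ (y' ∪ t) = y ∪ s ∩ t := by
        ext x
        have a1 : x ∈ y → x ∈ y' := fun h => hy h
        have a2 : x ∈ y' → x ∈ S := fun h => hy' h
        have a3 : x ∈ s → x ∈ E \ S := fun h => hs h
        have a4 : x ∈ t → x ∈ E \ S := fun h => ht h
        simp only [Finset.mem_sdiff, Finset.mem_inter, Finset.mem_union] at *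
        tauto
      have h2 : (y ∪ s) ∪ (y' ∪ t) = y' ∪ (s ∪ t) := by
        rw [Finset.union_union_union_comm, Finset.union_eq_right.2 hy]
      rwa [h1, h2] at h)
  have h0 : cylSum E w S y F ≤ ∑ η ∈ (E \ S).powerset, w (y ∪ η) * F (y' ∪ η) :=
    Finset.sum_le_sum fun η hη => mul_le_mul_of_nonneg_left
      (hFm (Finset.union_subset_union_left hy))
      (hw _ (union_subset_of_cyl hS hyS (Finset.mem_powerset.1 hη))).le
  have e1 : cylSum E w S y 1 = ∑ η ∈ (E \ S).powerset, w (y ∪ η) := by simp [cylSum]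
  have e2 : cylSum E w S y' 1 = ∑ η ∈ (E \ S).powerset, w (y' ∪ η) := by simp [cylSum]
  calc cylSum E w S y F * cylSum E w S y' 1
      ≤ (∑ η ∈ (E \ S).powerset, w (y ∪ η) * F (y' ∪ η)) * cylSum E w S y' 1 :=
        mul_le_mul_of_nonneg_right h0 (cylSum_one_pos hw hS hy').le
    _ ≤ _ := by rw [e1, e2, mul_comm (cylSum E w S y' F)]; exact h

theorem openInd_nonneg (e : ε) (ω : Finset ε) : 0 ≤ openInd e ω := by
  unfold openInd; split_ifs <;> norm_num

theorem openInd_mono (e : ε) : Monotone (openInd e) := fun s t h => by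
  unfold openInd
  by_cases hs : e ∈ s
  · simp [hs, h hs]
  · simp only [hs, if_false]; split_ifs <;> norm_num

/-- The **FKG inequality** on a finite powerset. -/
theorem fkg_powerset (hw : ∀ ω ⊆ E, 0 ≤ w ω)
    (hl : ∀ s ⊆ E, ∀ t ⊆ E, w s * w t ≤ w (s ∩ t) * w (s ∪ t)) {F G : Finset ε → ℝ}
    (hF : ∀ ω ⊆ E, 0 ≤ F ω) (hG : ∀ ω ⊆ E, 0 ≤ G ω) (hFm : ∀ s t, s ⊆ t → t ⊆ E → F s ≤ F t)
    (hGm : ∀ s t, s ⊆ t → t ⊆ E → G s ≤ G t) :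
    (∑ ω ∈ E.powerset, w ω * F ω) * (∑ ω ∈ E.powerset, w ω * G ω) ≤
      (∑ ω ∈ E.powerset, w ω) * ∑ ω ∈ E.powerset, w ω * G ω * F ω := by
  refine holley_powerset E hw (fun s hs => mul_nonneg (hw s hs) (hG s hs)) hF hFm ?_
  intro s hs t ht
  have hst : s ∪ t ⊆ E := Finset.union_subset hs ht
  have hst' : s ∩ t ⊆ E := Finset.inter_subset_left.trans hs
  calc w s * (w t * G t) = w s * w t * G t := by ring
    _ ≤ w (s ∩ t) * w (s ∪ t) * G (s ∪ t) :=
      mul_le_mul (hl s hs t ht) (hGm t _ Finset.subset_union_right hst) (hG t ht)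
        (mul_nonneg (hw _ hst') (hw _ hst))
    _ = _ := by ring

end Correlation

/-! ### Influences, covariances and the coupled exploration behind OSSS. -/

section OSSS
variable {ε : Type*} [DecidableEq ε] {E : Finset ε} {w : Finset ε → ℝ}

/-- Law of total probability: condition further on the state of `e`, which is open with conditional
probability `cylMean E w S a (openInd e)`. -/
theorem cylMean_step (hw : ∀ ω ⊆ E, 0 < w ω) {S a : Finset ε} {e : ε} (hS : S ⊆ E) (ha : a ⊆ S)
    (he : e ∈ E \ S) (F : Finset ε → ℝ) :
    cylMean E w S a F = cylMean E w S a (openInd e) * cylMean E w (insert e S) (insert e a) F +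
      (1 - cylMean E w S a (openInd e)) * cylMean E w (insert e S) a F := by
  have heE : e ∈ E := (Finset.mem_sdiff.1 he).1
  have heS : e ∉ S := (Finset.mem_sdiff.1 he).2
  have hS' : insert e S ⊆ E := Finset.insert_subset heE hS
  have p0 := cylSum_one_pos hw hS ha
  have p1 := cylSum_one_pos hw hS' (Finset.insert_subset_insert e ha)
  have p2 := cylSum_one_pos hw hS' (ha.trans (Finset.subset_insert e S))
  have h1 := cylSum_step (w := w) (a := a) he 1
  have h2 := cylSum_step (w := w) (a := a) he F
  have h3 : cylSum E w S a (openInd e) = cylSum E w (insert e S) (insert e a) 1 := by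
    rw [cylSum_step he]
    have z : cylSum E w (insert e S) a (openInd e) = 0 := by
      refine Finset.sum_eq_zero fun η hη => ?_
      have : e ∉ a ∪ η := by
        rw [Finset.mem_union]
        rintro (h | h)
        · exact heS (ha h)
        · have := Finset.mem_powerset.1 hη h
          simp at this
      simp [openInd, this]
    rw [z, zero_add]
    refine cylSum_congr fun η _ => ?_
    simp [openInd]
  simp only [cylMean]
  rw [h3]
  set A := cylSum E w (insert e S) (insert e a) 1
  set B := cylSum E w (insert e S) a 1
  rw [h2, h1]
  rw [h1] at p0
  field_simp
  ring

theorem openProb_mem_Icc (hw : ∀ ω ⊆ E, 0 < w ω) {S a : Finset ε} (hS : S ⊆ E) (ha : a ⊆ S)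
    (e : ε) : cylMean E w S a (openInd e) ∈ Set.Icc (0 : ℝ) 1 := by
  refine ⟨cylMean_nonneg hw hS ha fun ω _ => openInd_nonneg e ω, ?_⟩
  rw [cylMean, div_le_one (cylSum_one_pos hw hS ha)]
  refine Finset.sum_le_sum fun η hη => mul_le_mul_of_nonneg_left ?_
    (hw _ (union_subset_of_cyl hS ha (Finset.mem_powerset.1 hη))).le
  unfold openInd
  split_ifs <;> simp

/-- The average of conditional means over the condition. -/
theorem sum_cylSum_mul_cylMean (hw : ∀ ω ⊆ E, 0 < w ω) {S : Finset ε} (hS : S ⊆ E)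
    (F : Finset ε → ℝ) :
    ∑ y ∈ S.powerset, cylSum E w S y 1 * cylMean E w S y F = cylSum E w ∅ ∅ F := by
  rw [cylSum_empty, ← sum_cylSum hS]
  refine Finset.sum_congr rfl fun y hy => ?_
  rw [cylMean, mul_div_cancel₀ _ (cylSum_one_pos hw hS (Finset.mem_powerset.1 hy)).ne']

/-- The conditional expectations of `F` and `G` given the states in `S` are increasing functions of
the configuration by `cylMean_mono`, so FKG applies to them and their means are those of `F` and
`G`. In other words, their covariance is nonnegative. -/
theorem cylMean_empty_mul_le (hw : ∀ ω ⊆ E, 0 < w ω)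
    (hl : ∀ s ⊆ E, ∀ t ⊆ E, w s * w t ≤ w (s ∩ t) * w (s ∪ t)) {F G : Finset ε → ℝ}
    (hF : ∀ ω, 0 ≤ F ω) (hFm : Monotone F) (hG : ∀ ω, 0 ≤ G ω) (hGm : Monotone G)
    {S : Finset ε} (hS : S ⊆ E) :
    cylSum E w ∅ ∅ F * cylSum E w ∅ ∅ G ≤ cylSum E w ∅ ∅ 1 *
      ∑ y ∈ S.powerset, cylSum E w S y 1 * (cylMean E w S y F * cylMean E w S y G) := by
  have hcond : ∀ H : Finset ε → Finset ε → ℝ,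
      ∑ y ∈ S.powerset, cylSum E w S y 1 * H y y =
        ∑ ω ∈ E.powerset, w ω * H (ω ∩ S) (ω ∩ S) := by
    intro H
    rw [← sum_cylSum hS]
    refine Finset.sum_congr rfl fun y hy => ?_
    have hy' := Finset.mem_powerset.1 hy
    rw [cylSum, cylSum, Finset.sum_mul]
    refine Finset.sum_congr rfl fun η hη => ?_
    have : (y ∪ η) ∩ S = y := by
      have h1 := Finset.mem_powerset.1 hη
      ext x
      have a2 : x ∈ y → x ∈ S := fun h => hy' h
      have a3 : x ∈ η → x ∈ E \ S := fun h => h1 h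
      simp only [Finset.mem_sdiff, Finset.mem_inter, Finset.mem_union] at *
      tauto
    rw [this]
    simp
  have h := fkg_powerset (E := E) (w := w) (F := fun ω => cylMean E w S (ω ∩ S) F)
    (G := fun ω => cylMean E w S (ω ∩ S) G) (fun ω h => (hw ω h).le) hl
    (fun ω _ => cylMean_nonneg hw hS Finset.inter_subset_right fun ω _ => hF ω)
    (fun ω _ => cylMean_nonneg hw hS Finset.inter_subset_right fun ω _ => hG ω)
    (fun s t hst _ => cylMean_mono hw hl hF hFm hS (Finset.inter_subset_inter_right hst)
      Finset.inter_subset_right)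
    (fun s t hst _ => cylMean_mono hw hl hG hGm hS (Finset.inter_subset_inter_right hst)
      Finset.inter_subset_right)
  rw [← hcond fun y _ => cylMean E w S y F, ← hcond fun y _ => cylMean E w S y G,
    sum_cylSum_mul_cylMean hw hS, sum_cylSum_mul_cylMean hw hS] at h
  refine h.trans_eq ?_
  rw [cylSum_empty, hcond fun y z => cylMean E w S y F * cylMean E w S z G]
  simp only [Pi.one_apply, mul_one]
  congr 1
  exact Finset.sum_congr rfl fun ω _ => by ring

/-- The variance of the state of an edge, weighted with its influence, averages to at most the
covariance. -/
theorem sum_influence_le_wCov (hw : ∀ ω ⊆ E, 0 < w ω)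
    (hl : ∀ s ⊆ E, ∀ t ⊆ E, w s * w t ≤ w (s ∩ t) * w (s ∪ t)) {F : Finset ε → ℝ}
    (hF : ∀ ω, 0 ≤ F ω) (hFm : Monotone F) {S : Finset ε} {e : ε} (hS : S ⊆ E)
    (he : e ∈ E \ S) :
    ∑ y ∈ S.powerset, cylSum E w S y 1 *
        (cylMean E w S y (openInd e) * (1 - cylMean E w S y (openInd e)) *
          (cylMean E w (insert e S) (insert e y) F - cylMean E w (insert e S) y F)) ≤
      cylSum E w ∅ ∅ 1 * wCov E w F (openInd e) := by
  have heE : e ∈ E := (Finset.mem_sdiff.1 he).1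
  have hZ := cylSum_one_pos hw (Finset.empty_subset E) (Finset.Subset.refl ∅)
  have h := cylMean_empty_mul_le hw hl hF hFm (openInd_nonneg e) (openInd_mono e) hS
  -- Given the states `y` on `S`, variance of the edge times influence is the conditional covariance
  -- of `F` and `openInd e`. By the law of total covariance its average is the full covariance minus
  -- the covariance of the conditional means, and the latter is nonnegative.
  have h1 : ∀ y ∈ S.powerset, cylSum E w S y 1 *
        (cylMean E w S y (openInd e) * (1 - cylMean E w S y (openInd e)) *
          (cylMean E w (insert e S) (insert e y) F - cylMean E w (insert e S) y F)) =
      cylSum E w S y 1 * cylMean E w S y (F * openInd e) -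
        cylSum E w S y 1 * (cylMean E w S y F * cylMean E w S y (openInd e)) := by
    intro y hy
    have hy' := Finset.mem_powerset.1 hy
    have hprod : cylMean E w S y (F * openInd e) = cylMean E w S y (openInd e) *
        cylMean E w (insert e S) (insert e y) F := by
      rw [cylMean_step hw hS hy' he (F * openInd e)]
      have e1 : cylMean E w (insert e S) (insert e y) (F * openInd e) =
          cylMean E w (insert e S) (insert e y) F := by
        unfold cylMean
        congr 1
        exact cylSum_congr fun η _ => by simp [openInd]
      have e2 : cylMean E w (insert e S) y (F * openInd e) = 0 := by
        refine cylMean_const hw (Finset.insert_subset heE hS)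
          (hy'.trans (Finset.subset_insert e S)) fun η hη => ?_
        have : e ∉ y ∪ η := by
          rw [Finset.mem_union]
          rintro (h | h)
          · exact (Finset.mem_sdiff.1 he).2 (hy' h)
          · have := hη h
            simp at this
        simp [openInd, this]
      rw [e1, e2]; ring
    rw [hprod, cylMean_step hw hS hy' he F]
    ring
  rw [Finset.sum_congr rfl h1, Finset.sum_sub_distrib, sum_cylSum_mul_cylMean hw hS]
  have h2 : cylSum E w ∅ ∅ 1 * wCov E w F (openInd e) = cylSum E w ∅ ∅ (F * openInd e) -
      cylSum E w ∅ ∅ F * cylSum E w ∅ ∅ (openInd e) / cylSum E w ∅ ∅ 1 := by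
    unfold wCov cylMean
    field_simp
  rw [h2]
  have h3 : cylSum E w ∅ ∅ F * cylSum E w ∅ ∅ (openInd e) / cylSum E w ∅ ∅ 1 ≤
      ∑ y ∈ S.powerset, cylSum E w S y 1 * (cylMean E w S y F * cylMean E w S y (openInd e)) := by
    rw [div_le_iff₀' hZ]
    exact h
  linarith

/-- The case `S = ∅` of the influence bound, whose left side is nonnegative by monotonicity. -/
theorem wCov_openInd_nonneg (hw : ∀ ω ⊆ E, 0 < w ω)
    (hl : ∀ s ⊆ E, ∀ t ⊆ E, w s * w t ≤ w (s ∩ t) * w (s ∪ t)) {F : Finset ε → ℝ}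
    (hF : ∀ ω, 0 ≤ F ω) (hFm : Monotone F) {e : ε} (he : e ∈ E) :
    0 ≤ wCov E w F (openInd e) := by
  have hZ := cylSum_one_pos hw (Finset.empty_subset E) (Finset.Subset.refl ∅)
  have h := sum_influence_le_wCov hw hl hF hFm (S := ∅) (e := e) (by simp) (by simpa using he)
  refine le_of_mul_le_mul_left (le_trans ?_ h) hZ
  rw [mul_zero]
  refine Finset.sum_nonneg fun y hy => ?_
  have hy' := Finset.mem_powerset.1 hy
  have hb := openProb_mem_Icc hw (Finset.empty_subset E) hy' e
  have hm := cylMean_mono hw hl hF hFm (S := insert e ∅) (y := y) (y' := insert e y)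
    (by simpa using he) (Finset.subset_insert e y) (Finset.insert_subset_insert e hy')
  exact mul_nonneg (cylSum_one_pos hw (Finset.empty_subset E) hy').le
    (mul_nonneg (mul_nonneg hb.1 (sub_nonneg.2 hb.2)) (sub_nonneg.2 hm))

/-- Both sides are mixtures of total mass `T`. Going from left to right increases both values and
moves the mass `c' - c` from `B'` to the larger `A'`. -/
theorem mix_le_mix {c c' T A A' B B' : ℝ} (hc : 0 ≤ c) (hcc : c ≤ c') (hT : c' ≤ T)
    (hA : A ≤ A') (hB : B ≤ B') (hBA : B' ≤ A') :
    c * A + (T - c) * B ≤ c' * A' + (T - c') * B' := by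
  nlinarith [mul_nonneg hc (sub_nonneg.2 hA), mul_nonneg (by linarith : 0 ≤ T - c)
    (sub_nonneg.2 hB), mul_nonneg (sub_nonneg.2 hcc) (sub_nonneg.2 hBA)]

/-- The conclusion of the induction behind the OSSS inequality: `g y` is the mean of `f X * f Y`,
where `X` and `Y` start from the partial configurations `a` and `y` on `S` and are explored with a
monotone coupling. -/
def HasCoupling (E : Finset ε) (w f : Finset ε → ℝ) (D : ε → Finset ε → Prop)
    (S a : Finset ε) : Prop :=
  open Classical in
  ∃ g : Finset ε → ℝ,
    (∀ y y', y ⊆ y' → y' ⊆ S → g y ≤ g y') ∧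
    (∀ y y', y ⊆ y' → y' ⊆ S → cylMean E w S y f - g y ≤ cylMean E w S y' f - g y') ∧
    g a = cylMean E w S a f ∧
    ∑ y ∈ S.powerset, cylSum E w S y 1 * g y ≤ cylSum E w ∅ ∅ 1 *
      (cylMean E w S a f * cylMean E w ∅ ∅ f +
        ∑ e ∈ E \ S, cylMean E w S a (fun ω => if D e ω then 1 else 0) * wCov E w f (openInd e))

/-- Once `f X` is known to be `f a`, the mean of `f X * f Y` is `f a` times the conditional mean of
`f Y`. For `y = a` this is consistent since `f a` is 0 or 1. The covariance sum only helps, being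
nonnegative. -/
theorem HasCoupling.of_determined (hw : ∀ ω ⊆ E, 0 < w ω)
    (hl : ∀ s ⊆ E, ∀ t ⊆ E, w s * w t ≤ w (s ∩ t) * w (s ∪ t)) {f : Finset ε → ℝ}
    (hf : ∀ ω, f ω = 0 ∨ f ω = 1) (hfm : Monotone f) {D : ε → Finset ε → Prop}
    {S a : Finset ε} (hS : S ⊆ E) (ha : a ⊆ S) (h : ∀ η ⊆ E \ S, f (a ∪ η) = f a) :
    HasCoupling E w f D S a := by
  classical
  have hf0 : ∀ ω, 0 ≤ f ω := fun ω => by rcases hf ω with h | h <;> simp [h]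
  have hf1 : f a ≤ 1 := by rcases hf a with h | h <;> simp [h]
  have hM := cylMean_const hw hS ha h
  have hZ := cylSum_one_pos hw (Finset.empty_subset E) (Finset.Subset.refl ∅)
  refine ⟨fun y => f a * cylMean E w S y f, fun y y' h1 h2 => ?_, fun y y' h1 h2 => ?_, ?_, ?_⟩
  · exact mul_le_mul_of_nonneg_left (cylMean_mono hw hl hf0 hfm hS h1 h2) (hf0 a)
  · have := cylMean_mono hw hl hf0 hfm hS h1 h2
    nlinarith
  · simp only [hM]
    rcases hf a with h | h <;> simp [h]
  · rw [Finset.sum_congr rfl fun y _ => mul_left_comm _ _ _, ← Finset.mul_sum,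
      sum_cylSum_mul_cylMean hw hS, hM, mul_add]
    have h1 : 0 ≤ ∑ e ∈ E \ S, cylMean E w S a (fun ω => if D e ω then 1 else 0) *
        wCov E w f (openInd e) :=
      Finset.sum_nonneg fun e he => mul_nonneg
        (cylMean_nonneg hw hS ha fun ω _ => by split_ifs <;> norm_num)
        (wCov_openInd_nonneg hw hl hf0 hfm (Finset.mem_sdiff.1 he).1)
    have h2 : cylSum E w ∅ ∅ 1 * (f a * cylMean E w ∅ ∅ f) = f a * cylSum E w ∅ ∅ f := by
      unfold cylMean; field_simp
    rw [h2]
    exact le_add_of_nonneg_right (mul_nonneg hZ.le h1)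

/-- Reveal `e` in both configurations by comparing one uniform variable with the conditional
probabilities `π a` and `π y` of being open. Then `e` is open in both with probability `min (π a) (π
y)`. If `y = a` the two configurations stay equal. Compared with revealing `e` independently, the
loss is at most variance times influence, which averages to at most the covariance of `f` with `e`;
this is charged to `e`, whose event `D e` is already certain. -/
theorem HasCoupling.of_insert (hw : ∀ ω ⊆ E, 0 < w ω)
    (hl : ∀ s ⊆ E, ∀ t ⊆ E, w s * w t ≤ w (s ∩ t) * w (s ∪ t)) {f : Finset ε → ℝ}
    (hf0 : ∀ ω, 0 ≤ f ω) (hfm : Monotone f) {D : ε → Finset ε → Prop}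
    {S a : Finset ε} (hS : S ⊆ E) (ha : a ⊆ S) {e : ε} (he : e ∈ E \ S)
    (hD : ∀ η ⊆ E \ S, D e (a ∪ η)) (h1 : HasCoupling E w f D (insert e S) (insert e a))
    (h0 : HasCoupling E w f D (insert e S) a) : HasCoupling E w f D S a := by
  classical
  obtain ⟨g1, m1, n1, d1, r1⟩ := h1
  obtain ⟨g0, m0, n0, d0, r0⟩ := h0
  have heE : e ∈ E := (Finset.mem_sdiff.1 he).1
  have heS : e ∉ S := (Finset.mem_sdiff.1 he).2
  have hS' : insert e S ⊆ E := Finset.insert_subset heE hS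
  have hZ := cylSum_one_pos hw (Finset.empty_subset E) (Finset.Subset.refl ∅)
  set π : Finset ε → ℝ := fun y => cylMean E w S y (openInd e) with hπ
  have hπm : ∀ y y', y ⊆ y' → y' ⊆ S → π y ≤ π y' := fun y y' h h' =>
    cylMean_mono hw hl (openInd_nonneg e) (openInd_mono e) hS h h'
  have hπ01 : ∀ y ⊆ S, 0 ≤ π y ∧ π y ≤ 1 := fun y h => openProb_mem_Icc hw hS h e
  have ha01 := hπ01 a ha
  have ins : ∀ {y y'}, y ⊆ y' → y' ⊆ S → y' ⊆ insert e S := fun _ h =>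
    h.trans (Finset.subset_insert e S)
  have ins' : ∀ {y y' : Finset ε}, y ⊆ y' → insert e y ⊆ insert e y' := fun h =>
    Finset.insert_subset_insert e h
  -- The four terms are the joint states of `e` in the pair; `k1` belongs to `e` open in `X`, `k0`
  -- to `e` closed in `X`. Raising `y` shifts mass towards `e` open in `Y`. This is used for `g`
  -- itself and for the conditional mean of `f` minus `g`.
  have mixm : ∀ (k1 k0 : Finset ε → ℝ),
      (∀ y y', y ⊆ y' → y' ⊆ insert e S → k1 y ≤ k1 y') →
      (∀ y y', y ⊆ y' → y' ⊆ insert e S → k0 y ≤ k0 y') → ∀ y y', y ⊆ y' → y' ⊆ S →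
      (min (π a) (π y) * k1 (insert e y) + (π a - min (π a) (π y)) * k1 y) +
        ((π y - min (π a) (π y)) * k0 (insert e y) +
          (1 - π a - (π y - min (π a) (π y))) * k0 y) ≤
      (min (π a) (π y') * k1 (insert e y') + (π a - min (π a) (π y')) * k1 y') +
        ((π y' - min (π a) (π y')) * k0 (insert e y') +
          (1 - π a - (π y' - min (π a) (π y'))) * k0 y') := by
    intro k1 k0 hk1 hk0 y y' hy hy'
    have hp := hπm y y' hy hy'
    have b := hπ01 y (hy.trans hy')
    have b' := hπ01 y' hy'
    refine add_le_add (mix_le_mix (le_min ha01.1 b.1) (min_le_min_left _ hp) (min_le_left _ _)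
      (hk1 _ _ (ins' hy) (ins' hy')) (hk1 _ _ hy (ins hy hy'))
      (hk1 _ _ (Finset.subset_insert _ _) (ins' hy')))
      (mix_le_mix (sub_nonneg.2 (min_le_right _ _)) ?_ ?_
      (hk0 _ _ (ins' hy) (ins' hy')) (hk0 _ _ hy (ins hy hy'))
      (hk0 _ _ (Finset.subset_insert _ _) (ins' hy')))
    · rcases min_cases (π a) (π y) with h | h <;> rcases min_cases (π a) (π y') with h' | h' <;>
        linarith
    · rcases min_cases (π a) (π y') with h' | h' <;> linarith
  refine ⟨fun y => (min (π a) (π y) * g1 (insert e y) + (π a - min (π a) (π y)) * g1 y) +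
        ((π y - min (π a) (π y)) * g0 (insert e y) +
          (1 - π a - (π y - min (π a) (π y))) * g0 y), ?_, ?_, ?_, ?_⟩
  · exact mixm g1 g0 m1 m0
  · intro y y' hy hy'
    have h := mixm (fun y => cylMean E w (insert e S) y f - g1 y)
      (fun y => cylMean E w (insert e S) y f - g0 y) n1 n0 y y' hy hy'
    have s1 := cylMean_step hw hS (hy.trans hy') he f
    have s2 := cylMean_step hw hS hy' he f
    rw [s1, s2]
    change π y * _ + (1 - π y) * _ - _ ≤ π y' * _ + (1 - π y') * _ - _
    refine (le_of_eq ?_).trans (h.trans (le_of_eq ?_)) <;> ring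
  · simp only [min_self, sub_self, zero_mul, add_zero, zero_add, sub_zero]
    rw [d1, d0, cylMean_step hw hS ha he f]
  -- The error is `min (π a) (π y) - π a * π y`, the covariance of the coupled states and at most `π
  -- y * (1 - π y)`, times a difference of increments. The increment of `g1` is at most that of the
  -- conditional mean of `f`, and the increment of `g0` is nonnegative.
  · have key : ∀ y ∈ S.powerset, cylSum E w S y 1 *
        ((min (π a) (π y) * g1 (insert e y) + (π a - min (π a) (π y)) * g1 y) +
        ((π y - min (π a) (π y)) * g0 (insert e y) +
          (1 - π a - (π y - min (π a) (π y))) * g0 y)) ≤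
        π a * (cylSum E w (insert e S) y 1 * g1 y +
            cylSum E w (insert e S) (insert e y) 1 * g1 (insert e y)) +
          (1 - π a) * (cylSum E w (insert e S) y 1 * g0 y +
            cylSum E w (insert e S) (insert e y) 1 * g0 (insert e y)) +
          cylSum E w S y 1 *
        (cylMean E w S y (openInd e) * (1 - cylMean E w S y (openInd e)) *
          (cylMean E w (insert e S) (insert e y) f - cylMean E w (insert e S) y f)) := by
      intro y hy
      have hy' := Finset.mem_powerset.1 hy
      have hp := cylSum_one_pos hw hS hy'
      have z := cylSum_step (w := w) (a := y) he 1
      have z1 : cylSum E w (insert e S) (insert e y) 1 = cylSum E w S y 1 * π y := by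
        have : cylSum E w S y 1 * π y = cylSum E w S y (openInd e) := by
          simp only [hπ, cylMean]; field_simp
        rw [this, cylSum_step he]
        have z : cylSum E w (insert e S) y (openInd e) = 0 := by
          refine Finset.sum_eq_zero fun η hη => ?_
          have : e ∉ y ∪ η := by
            rw [Finset.mem_union]
            rintro (h | h)
            · exact heS (hy' h)
            · have := Finset.mem_powerset.1 hη h
              simp at this
          simp [openInd, this]
        rw [z, zero_add]
        exact cylSum_congr fun η _ => by simp [openInd]
      have z0 : cylSum E w (insert e S) y 1 = cylSum E w S y 1 * (1 - π y) := by
        linarith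
      rw [z1, z0]
      change _ ≤ _ + cylSum E w S y 1 * (π y * (1 - π y) * _)
      have q1 := m1 y (insert e y) (Finset.subset_insert _ _) (ins' hy')
      have q0 := m0 y (insert e y) (Finset.subset_insert _ _) (ins' hy')
      have qn := n1 y (insert e y) (Finset.subset_insert _ _) (ins' hy')
      set A := cylMean E w (insert e S) (insert e y) f
      set B := cylMean E w (insert e S) y f
      have b := hπ01 y hy'
      have c0 : 0 ≤ min (π a) (π y) - π a * π y := by
        rcases min_cases (π a) (π y) with h | h <;> nlinarith
      have c1 : min (π a) (π y) - π a * π y ≤ π y * (1 - π y) := by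
        rcases min_cases (π a) (π y) with h | h <;> nlinarith
      have c2 : (min (π a) (π y) - π a * π y) *
          ((g1 (insert e y) - g1 y) - (g0 (insert e y) - g0 y)) ≤ π y * (1 - π y) * (A - B) :=
        calc _ ≤ (min (π a) (π y) - π a * π y) * (A - B) :=
              mul_le_mul_of_nonneg_left (by linarith) c0
          _ ≤ _ := mul_le_mul_of_nonneg_right c1 (by linarith)
      have c3 := mul_le_mul_of_nonneg_left c2 hp.le
      linarith
    refine (Finset.sum_le_sum key).trans ?_
    rw [Finset.sum_add_distrib, Finset.sum_add_distrib, ← Finset.mul_sum, ← Finset.mul_sum]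
    have infl := sum_influence_le_wCov hw hl hf0 hfm hS he
    rw [Finset.sum_powerset_insert heS, ← Finset.sum_add_distrib] at r1 r0
    have hED : E \ S = insert e (E \ insert e S) := by
      ext x
      simp only [Finset.mem_sdiff, Finset.mem_insert]
      by_cases hx : x = e
      · subst hx; simp [heE, heS]
      · simp [hx]
    have hMD : cylMean E w S a (fun ω => if D e ω then 1 else 0) = 1 :=
      cylMean_const hw hS ha fun η hη => if_pos (hD η hη)
    have hsum : ∑ e' ∈ E \ S, cylMean E w S a (fun ω => if D e' ω then 1 else 0) *
        wCov E w f (openInd e') = wCov E w f (openInd e) +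
        (π a * ∑ e' ∈ E \ insert e S, cylMean E w (insert e S) (insert e a)
            (fun ω => if D e' ω then 1 else 0) * wCov E w f (openInd e') +
          (1 - π a) * ∑ e' ∈ E \ insert e S, cylMean E w (insert e S) a
            (fun ω => if D e' ω then 1 else 0) * wCov E w f (openInd e')) := by
      rw [hED, Finset.sum_insert (by simp), hMD, one_mul, Finset.mul_sum, Finset.mul_sum,
        ← Finset.sum_add_distrib]
      congr 1
      refine Finset.sum_congr rfl fun e' _ => ?_
      rw [cylMean_step hw hS ha he fun ω => if D e' ω then 1 else 0]
      ring
    rw [hsum, cylMean_step hw hS ha he f]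
    have t1 := mul_le_mul_of_nonneg_left r1 ha01.1
    have t0 := mul_le_mul_of_nonneg_left r0 (sub_nonneg.2 ha01.2)
    refine (add_le_add (add_le_add t1 t0) infl).trans (le_of_eq ?_)
    simp only [hπ]
    ring

/-- The **OSSS inequality** for monotonic measures. The hypothesis `hD` says that from any partial
configuration `a` on `S` which does not determine `f` an exploration can proceed with an edge `e`
for which the event `D e` is already known to occur. -/
theorem osss (hw : ∀ ω ⊆ E, 0 < w ω)
    (hl : ∀ s ⊆ E, ∀ t ⊆ E, w s * w t ≤ w (s ∩ t) * w (s ∪ t)) {f : Finset ε → ℝ}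
    (hf : ∀ ω, f ω = 0 ∨ f ω = 1) (hfm : Monotone f) {D : ε → Finset ε → Prop}
    [∀ e ω, Decidable (D e ω)]
    (hD : ∀ S ⊆ E, ∀ a ⊆ S, (∀ η ⊆ E \ S, f (a ∪ η) = f a) ∨
      ∃ e ∈ E \ S, ∀ η ⊆ E \ S, D e (a ∪ η)) :
    cylMean E w ∅ ∅ f * (1 - cylMean E w ∅ ∅ f) ≤
      ∑ e ∈ E, cylMean E w ∅ ∅ (fun ω => if D e ω then 1 else 0) * wCov E w f (openInd e) := by
  have hf0 : ∀ ω, 0 ≤ f ω := fun ω => by rcases hf ω with h | h <;> simp [h]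
  have main : ∀ (n : ℕ) (S a : Finset ε), S ⊆ E → a ⊆ S → (E \ S).card = n →
      HasCoupling E w f D S a := by
    intro n
    induction n with
    | zero =>
      intro S a hS ha hn
      refine HasCoupling.of_determined hw hl hf hfm hS ha fun η hη => ?_
      rw [Finset.card_eq_zero.1 hn] at hη
      rw [Finset.subset_empty.1 hη, Finset.union_empty]
    | succ n ih =>
      intro S a hS ha hn
      rcases hD S hS a ha with h | ⟨e, he, h⟩
      · exact HasCoupling.of_determined hw hl hf hfm hS ha h
      · have hS' : insert e S ⊆ E := Finset.insert_subset (Finset.mem_sdiff.1 he).1 hS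
        have hc : (E \ insert e S).card = n := by
          rw [Finset.sdiff_insert, Finset.card_erase_of_mem he, hn, Nat.add_sub_cancel]
        exact HasCoupling.of_insert hw hl hf0 hfm hS ha he h
          (ih _ _ hS' (Finset.insert_subset_insert e ha) hc)
          (ih _ _ hS' (ha.trans (Finset.subset_insert e S)) hc)
  obtain ⟨g, -, -, hg, hr⟩ := main _ ∅ ∅ (Finset.empty_subset E) (Finset.Subset.refl _) rfl
  have hZ := cylSum_one_pos hw (Finset.empty_subset E) (Finset.Subset.refl ∅)
  simp only [Finset.powerset_empty, Finset.sum_singleton, hg, Finset.sdiff_empty] at hr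
  have h := le_of_mul_le_mul_left hr hZ
  -- Only the decidability instances of the two sums differ.
  have h2 : ∑ e ∈ E, cylMean E w ∅ ∅ (fun ω => @ite _ (D e ω) (Classical.propDecidable _) 1 0) *
      wCov E w f (openInd e) = ∑ e ∈ E, cylMean E w ∅ ∅ (fun ω => if D e ω then 1 else 0) *
      wCov E w f (openInd e) := by
    refine Finset.sum_congr rfl fun e _ => ?_
    congr 2
    funext ω
    congr
  rw [h2] at h
  linarith
end OSSS

/-! ### Supermodularity of the number of connected components -/

section Components

variable {U : Type*}

/-- The functions which are constant on the connected components of `H`. -/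
def locConst (H : SimpleGraph U) : Submodule ℝ (U → ℝ) where
  carrier := {f | ∀ x y, H.Adj x y → f x = f y}
  add_mem' hf hg x y h := by simp [hf x y h, hg x y h]
  zero_mem' _ _ _ := rfl
  smul_mem' c f hf x y h := by simp [hf x y h]

theorem locConst_reachable {H : SimpleGraph U} {f : U → ℝ} (hf : f ∈ locConst H) {x y : U}
    (h : H.Reachable x y) : f x = f y := by
  obtain ⟨p⟩ := h
  induction p with
  | nil => rfl
  | cons h _ ih => exact (hf _ _ h).trans ih

/-- A function which is constant on components is a function of the component. -/
def locConstEquiv (H : SimpleGraph U) : (H.ConnectedComponent → ℝ) ≃ₗ[ℝ] locConst H where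
  toFun g := ⟨fun x => g (H.connectedComponentMk x), fun _ _ h =>
    congrArg g (SimpleGraph.ConnectedComponent.sound h.reachable)⟩
  invFun f := SimpleGraph.ConnectedComponent.lift f.1 fun _ _ p _ =>
    locConst_reachable f.2 ⟨p⟩
  map_add' _ _ := rfl
  map_smul' _ _ := rfl
  left_inv g := by
    funext c
    induction c using SimpleGraph.ConnectedComponent.ind
    rfl
  right_inv f := rfl

theorem finrank_locConst (H : SimpleGraph U) [Finite H.ConnectedComponent] :
    Module.finrank ℝ (locConst H) = Nat.card H.ConnectedComponent := by
  have := Fintype.ofFinite H.ConnectedComponent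
  rw [← (locConstEquiv H).finrank_eq, Module.finrank_fintype_fun_eq_card, Nat.card_eq_fintype_card]

theorem finite_connectedComponent_of_le {K H : SimpleGraph U} (h : K ≤ H)
    [Finite K.ConnectedComponent] : Finite H.ConnectedComponent :=
  Finite.of_surjective (SimpleGraph.ConnectedComponent.map (SimpleGraph.Hom.ofLE h)) fun c => by
    induction c using SimpleGraph.ConnectedComponent.ind with
    | h v => exact ⟨K.connectedComponentMk v, rfl⟩

theorem card_connectedComponent_le {K H : SimpleGraph U} (h : K ≤ H)
    [Finite K.ConnectedComponent] :
    Nat.card H.ConnectedComponent ≤ Nat.card K.ConnectedComponent :=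
  Nat.card_le_card_of_surjective (SimpleGraph.ConnectedComponent.map (SimpleGraph.Hom.ofLE h))
    fun c => by
      induction c using SimpleGraph.ConnectedComponent.ind with
      | h v => exact ⟨K.connectedComponentMk v, rfl⟩

/-- The number of connected components is supermodular. -/
theorem card_connectedComponent_supermodular (H₁ H₂ : SimpleGraph U)
    [Finite (H₁ ⊓ H₂).ConnectedComponent] :
    Nat.card H₁.ConnectedComponent + Nat.card H₂.ConnectedComponent ≤
      Nat.card (H₁ ⊓ H₂).ConnectedComponent + Nat.card (H₁ ⊔ H₂).ConnectedComponent := by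
  have f1 : Finite H₁.ConnectedComponent :=
    finite_connectedComponent_of_le (inf_le_left : H₁ ⊓ H₂ ≤ H₁)
  have f2 : Finite H₂.ConnectedComponent :=
    finite_connectedComponent_of_le (inf_le_right : H₁ ⊓ H₂ ≤ H₂)
  have f3 : Finite (H₁ ⊔ H₂).ConnectedComponent :=
    finite_connectedComponent_of_le (inf_le_sup : H₁ ⊓ H₂ ≤ H₁ ⊔ H₂)
  have fd1 : FiniteDimensional ℝ (locConst H₁) := (locConstEquiv H₁).finiteDimensional
  have fd2 : FiniteDimensional ℝ (locConst H₂) := (locConstEquiv H₂).finiteDimensional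
  have fd : FiniteDimensional ℝ (locConst (H₁ ⊓ H₂)) := (locConstEquiv _).finiteDimensional
  -- Component numbers become dimensions of spaces of locally constant functions. The claim is the
  -- dimension formula: the intersection of the two spaces belongs to `H₁ ⊔ H₂`, and their sum lies
  -- in the space of `H₁ ⊓ H₂`.
  rw [← finrank_locConst, ← finrank_locConst, ← finrank_locConst, ← finrank_locConst,
    ← Submodule.finrank_sup_add_finrank_inf_eq]
  have h1 : locConst H₁ ⊓ locConst H₂ = locConst (H₁ ⊔ H₂) := by
    ext f
    constructor
    · rintro ⟨h1, h2⟩ x y (h | h)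
      · exact h1 x y h
      · exact h2 x y h
    · intro h
      exact ⟨fun x y hxy => h x y (Or.inl hxy), fun x y hxy => h x y (Or.inr hxy)⟩
  have h2 : locConst H₁ ⊔ locConst H₂ ≤ locConst (H₁ ⊓ H₂) :=
    sup_le (fun f hf x y h => hf x y h.1) fun f hf x y h => hf x y h.2
  rw [h1]
  exact Nat.add_le_add_right (Submodule.finrank_mono h2) _

/-- A pair of maps between graphs which are inverse to each other up to connection gives a
bijection of connected components. -/
theorem card_connectedComponent_congr {U' : Type*} {H : SimpleGraph U} {H' : SimpleGraph U'}
    (φ : U → U') (ψ : U' → U) (hφ : ∀ x y, H.Adj x y → H'.Reachable (φ x) (φ y))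
    (hψ : ∀ x y, H'.Adj x y → H.Reachable (ψ x) (ψ y)) (hψφ : ∀ x, H.Reachable (ψ (φ x)) x)
    (hφψ : ∀ x, H'.Reachable (φ (ψ x)) x) :
    Nat.card H.ConnectedComponent = Nat.card H'.ConnectedComponent := by
  have hφ' : ∀ x y, H.Reachable x y → H'.Reachable (φ x) (φ y) := by
    rintro x y ⟨p⟩
    induction p with
    | nil => rfl
    | cons h _ ih => exact (hφ _ _ h).trans ih
  have hψ' : ∀ x y, H'.Reachable x y → H.Reachable (ψ x) (ψ y) := by
    rintro x y ⟨p⟩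
    induction p with
    | nil => rfl
    | cons h _ ih => exact (hψ _ _ h).trans ih
  refine Nat.card_congr ⟨SimpleGraph.ConnectedComponent.lift
      (fun x => H'.connectedComponentMk (φ x))
      fun x y p _ => SimpleGraph.ConnectedComponent.sound (hφ' x y ⟨p⟩),
    SimpleGraph.ConnectedComponent.lift (fun x => H.connectedComponentMk (ψ x))
      fun x y p _ => SimpleGraph.ConnectedComponent.sound (hψ' x y ⟨p⟩), ?_, ?_⟩
  · intro c
    induction c using SimpleGraph.ConnectedComponent.ind with
    | h v => exact SimpleGraph.ConnectedComponent.sound (hψφ v)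
  · intro c
    induction c using SimpleGraph.ConnectedComponent.ind with
    | h v => exact SimpleGraph.ConnectedComponent.sound (hφψ v)

end Components

/-! ### Random cluster measures with a wired exterior -/

section Bernoulli

variable {ε : Type*} [DecidableEq ε] {P : ε → ℝ}

/-- The product weight of the configuration `ω` on `E`. -/
def bernWeight (P : ε → ℝ) (E ω : Finset ε) : ℝ := ∏ e ∈ E, if e ∈ ω then P e else 1 - P e

theorem bernWeight_nonneg (hP : ∀ e, P e ∈ Set.Icc (0 : ℝ) 1) (E ω : Finset ε) :
    0 ≤ bernWeight P E ω :=
  Finset.prod_nonneg fun e _ => by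
    split_ifs
    · exact (hP e).1
    · exact sub_nonneg.2 (hP e).2

theorem bernWeight_mul (E s t : Finset ε) :
    bernWeight P E s * bernWeight P E t = bernWeight P E (s ∩ t) * bernWeight P E (s ∪ t) := by
  simp only [bernWeight, ← Finset.prod_mul_distrib]
  refine Finset.prod_congr rfl fun e _ => ?_
  by_cases h1 : e ∈ s <;> by_cases h2 : e ∈ t <;> simp [h1, h2, mul_comm]

theorem bernWeight_union {A B ξ η : Finset ε} (h : Disjoint A B) (hξ : ξ ⊆ A) (hη : η ⊆ B) :
    bernWeight P (A ∪ B) (ξ ∪ η) = bernWeight P A ξ * bernWeight P B η := by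
  rw [bernWeight, Finset.prod_union h]
  congr 1
  · refine Finset.prod_congr rfl fun e he => ?_
    have : e ∉ η := fun h' => Finset.disjoint_left.1 h he (hη h')
    simp [this]
  · refine Finset.prod_congr rfl fun e he => ?_
    have : e ∉ ξ := fun h' => Finset.disjoint_left.1 h (hξ h') he
    simp [this]

theorem sum_bernWeight (E : Finset ε) : ∑ ω ∈ E.powerset, bernWeight P E ω = 1 := by
  have h := Finset.prod_add (fun e => P e) (fun e => 1 - P e) E
  simp only [add_sub_cancel, Finset.prod_const_one] at h
  rw [h]
  refine Finset.sum_congr rfl fun ω hω => ?_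
  have hω' := Finset.mem_powerset.1 hω
  have : E = ω ∪ (E \ ω) := (Finset.union_sdiff_of_subset hω').symm
  conv_lhs => rw [this]
  rw [bernWeight, Finset.prod_union Finset.disjoint_sdiff]
  congr 1
  · exact Finset.prod_congr rfl fun e he => by simp [he]
  · exact Finset.prod_congr rfl fun e he => by simp [(Finset.mem_sdiff.1 he).2]

end Bernoulli

/-! ### Random cluster weights, domination by wired boundary conditions, and removal of edges. -/

section FK

variable {V : Type*} [DecidableEq V]

/-- The complete graph on the ghost and the vertices outside `D`. -/
def outside (D : Finset V) : SimpleGraph (Option V) where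
  Adj a b := a ≠ b ∧ (∀ v ∈ D, a ≠ some v) ∧ ∀ v ∈ D, b ≠ some v
  symm := ⟨fun _ _ h => ⟨h.1.symm, h.2.2, h.2.1⟩⟩
  loopless := ⟨fun _ h => h.1 rfl⟩

/-- The open graph of `ω`, where all vertices outside `D` and the ghost are identified. -/
def wiredGraph (D : Finset V) (ω : Finset (Sym2 (Option V))) : SimpleGraph (Option V) :=
  outside D ⊔ SimpleGraph.fromEdgeSet (ω : Set (Sym2 (Option V)))

/-- The number of clusters of `ω`, when all vertices outside `D` and the ghost are identified. -/
def clusters (D : Finset V) (ω : Finset (Sym2 (Option V))) : ℕ :=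
  Nat.card (wiredGraph D ω).ConnectedComponent

/-- All vertices outside `D` lie in the component of the ghost, so the ghost and the finite set `D`
meet every component. Cluster counts are therefore genuine even for infinite `V`. -/
instance finite_outside (D : Finset V) : Finite (outside D).ConnectedComponent := by
  refine Finite.of_surjective (fun x : Option D =>
    (outside D).connectedComponentMk (x.map Subtype.val)) fun c => ?_
  induction c using SimpleGraph.ConnectedComponent.ind with
  | h a =>
    by_cases h : ∃ v ∈ D, a = some v
    · obtain ⟨v, hv, rfl⟩ := h
      exact ⟨some ⟨v, hv⟩, rfl⟩
    · push Not at h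
      refine ⟨none, SimpleGraph.ConnectedComponent.sound ?_⟩
      by_cases ha : a = none
      · rw [ha]; rfl
      · exact SimpleGraph.Adj.reachable ⟨fun h => ha h.symm, fun v _ => by simp, h⟩

omit [DecidableEq V] in
theorem outside_anti {D D' : Finset V} (h : D' ⊆ D) : outside D ≤ outside D' :=
  fun _ _ hab => ⟨hab.1, fun v hv => hab.2.1 v (h hv), fun v hv => hab.2.2 v (h hv)⟩

instance finite_wiredGraph (D : Finset V) (ω : Finset (Sym2 (Option V))) :
    Finite (wiredGraph D ω).ConnectedComponent :=
  finite_connectedComponent_of_le (le_sup_left : outside D ≤ wiredGraph D ω)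

theorem clusters_anti {D : Finset V} {ω ω' : Finset (Sym2 (Option V))} (h : ω ⊆ ω') :
    clusters D ω' ≤ clusters D ω :=
  card_connectedComponent_le (sup_le_sup_left (SimpleGraph.fromEdgeSet_mono (by exact_mod_cast h)) _)

/-- The gain in clusters from removing edges increases under wiring of the edges in `ξ`. -/
theorem clusters_supermodular {D D' : Finset V} (hD : D' ⊆ D)
    {ξ s t : Finset (Sym2 (Option V))} (hξ : ∀ e ∈ ξ, ∀ v ∈ D', some v ∉ e) :
    clusters D (ξ ∪ s) + clusters D' t ≤ clusters D (ξ ∪ s ∩ t) + clusters D' (s ∪ t) := by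
  -- The edges of `ξ` avoid `D'`, so they join vertices which are already wired when everything
  -- outside `D'` is. Hence `ξ` disappears from the terms with `D'`.
  have hξ' : SimpleGraph.fromEdgeSet (ξ : Set (Sym2 (Option V))) ≤ outside D' := by
    intro a b h
    rw [SimpleGraph.fromEdgeSet_adj] at h
    exact ⟨h.2, fun v hv hav => hξ _ h.1 v hv (by simp [hav]),
      fun v hv hbv => hξ _ h.1 v hv (by simp [hbv])⟩
  have h1 : wiredGraph D (ξ ∪ s ∩ t) ≤ wiredGraph D (ξ ∪ s) ⊓ wiredGraph D' t := by
    refine le_inf (sup_le_sup_left (SimpleGraph.fromEdgeSet_mono ?_) _) (sup_le ?_ ?_)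
    · exact_mod_cast Finset.union_subset_union_right Finset.inter_subset_left
    · exact (outside_anti hD).trans le_sup_left
    · intro a b h
      rw [SimpleGraph.fromEdgeSet_adj] at h
      rcases Finset.mem_union.1 (Finset.mem_coe.1 h.1) with h' | h'
      · exact Or.inl (hξ' ((SimpleGraph.fromEdgeSet_adj _).2 ⟨h', h.2⟩))
      · exact Or.inr ((SimpleGraph.fromEdgeSet_adj _).2
          ⟨Finset.mem_coe.2 (Finset.mem_inter.1 h').2, h.2⟩)
  have h2 : wiredGraph D (ξ ∪ s) ⊔ wiredGraph D' t ≤ wiredGraph D' (s ∪ t) := by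
    refine sup_le (sup_le ((outside_anti hD).trans le_sup_left) ?_)
      (sup_le_sup_left (SimpleGraph.fromEdgeSet_mono ?_) _)
    · intro a b h
      rw [SimpleGraph.fromEdgeSet_adj] at h
      rcases Finset.mem_union.1 (Finset.mem_coe.1 h.1) with h' | h'
      · exact Or.inl (hξ' ((SimpleGraph.fromEdgeSet_adj _).2 ⟨h', h.2⟩))
      · exact Or.inr ((SimpleGraph.fromEdgeSet_adj _).2
          ⟨Finset.mem_coe.2 (Finset.mem_union_left _ h'), h.2⟩)
    · exact_mod_cast Finset.subset_union_right
  have hfin : Finite (wiredGraph D (ξ ∪ s) ⊓ wiredGraph D' t).ConnectedComponent :=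
    finite_connectedComponent_of_le h1
  have h3 : wiredGraph D' (s ∪ t) ≤ wiredGraph D (ξ ∪ s) ⊔ wiredGraph D' t := by
    refine sup_le (le_sup_left.trans le_sup_right) ?_
    intro a b h
    rw [SimpleGraph.fromEdgeSet_adj] at h
    rcases Finset.mem_union.1 (Finset.mem_coe.1 h.1) with h' | h'
    · exact Or.inl (Or.inr ((SimpleGraph.fromEdgeSet_adj _).2
        ⟨Finset.mem_coe.2 (Finset.mem_union_right _ h'), h.2⟩))
    · exact Or.inr (Or.inr ((SimpleGraph.fromEdgeSet_adj _).2 ⟨Finset.mem_coe.2 h', h.2⟩))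
  have key := card_connectedComponent_supermodular (wiredGraph D (ξ ∪ s)) (wiredGraph D' t)
  rw [le_antisymm h2 h3] at key
  have h4 := card_connectedComponent_le h1
  unfold clusters
  omega

/-- The weight of a configuration under the random cluster measure with edges `E`, edge parameters
`P` and all vertices outside `D` wired to the ghost. -/
def fkWeight (P : Sym2 (Option V) → ℝ) (q : ℝ) (D : Finset V) (E ω : Finset (Sym2 (Option V))) :
    ℝ := bernWeight P E ω * q ^ clusters D ω

/-- The partition function of the random cluster measure. -/
def fkZ (P : Sym2 (Option V) → ℝ) (q : ℝ) (D : Finset V) (E : Finset (Sym2 (Option V))) : ℝ :=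
  ∑ ω ∈ E.powerset, fkWeight P q D E ω

/-- The mean of `F` under the random cluster measure. -/
def fkMean (P : Sym2 (Option V) → ℝ) (q : ℝ) (D : Finset V) (E : Finset (Sym2 (Option V)))
    (F : Finset (Sym2 (Option V)) → ℝ) : ℝ :=
  (∑ ω ∈ E.powerset, fkWeight P q D E ω * F ω) / fkZ P q D E

variable {P : Sym2 (Option V) → ℝ} {q : ℝ} {D D' : Finset V} {E E' : Finset (Sym2 (Option V))}

theorem fkWeight_nonneg (hP : ∀ e, P e ∈ Set.Icc (0 : ℝ) 1) (hq : 1 ≤ q)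
    (ω : Finset (Sym2 (Option V))) : 0 ≤ fkWeight P q D E ω :=
  mul_nonneg (bernWeight_nonneg hP _ _) (by positivity)

/-- The product weights sum to 1 and each factor `q ^ clusters` is at least 1, so the partition
function is at least 1, even for edge parameters 0 and 1. -/
theorem fkZ_pos (hP : ∀ e, P e ∈ Set.Icc (0 : ℝ) 1) (hq : 1 ≤ q) : 0 < fkZ P q D E := by
  have h : (1 : ℝ) ≤ fkZ P q D E := by
    rw [← sum_bernWeight (P := P) E]
    exact Finset.sum_le_sum fun ω _ =>
      le_mul_of_one_le_right (bernWeight_nonneg hP _ _) (one_le_pow₀ hq)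
  linarith

theorem fkMean_mono (hP : ∀ e, P e ∈ Set.Icc (0 : ℝ) 1) (hq : 1 ≤ q)
    {F G : Finset (Sym2 (Option V)) → ℝ} (h : ∀ ω ⊆ E, F ω ≤ G ω) :
    fkMean P q D E F ≤ fkMean P q D E G :=
  div_le_div_of_nonneg_right (Finset.sum_le_sum fun ω hω => mul_le_mul_of_nonneg_left
    (h ω (Finset.mem_powerset.1 hω)) (fkWeight_nonneg hP hq ω)) (fkZ_pos hP hq).le

theorem fkMean_congr {F G : Finset (Sym2 (Option V)) → ℝ} (h : ∀ ω ⊆ E, F ω = G ω) :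
    fkMean P q D E F = fkMean P q D E G := by
  unfold fkMean
  congr 1
  exact Finset.sum_congr rfl fun ω hω => by rw [h ω (Finset.mem_powerset.1 hω)]

theorem fkMean_const (hP : ∀ e, P e ∈ Set.Icc (0 : ℝ) 1) (hq : 1 ≤ q) (c : ℝ) :
    fkMean P q D E (fun _ => c) = c := by
  rw [fkMean, ← Finset.sum_mul, ← fkZ, mul_comm, mul_div_assoc, div_self (fkZ_pos hP hq).ne',
    mul_one]

theorem fkMean_sum {ι : Type*} (s : Finset ι) (F : ι → Finset (Sym2 (Option V)) → ℝ) :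
    fkMean P q D E (fun ω => ∑ i ∈ s, F i ω) = ∑ i ∈ s, fkMean P q D E (F i) := by
  simp only [fkMean, Finset.mul_sum, ← Finset.sum_div]
  rw [Finset.sum_comm]

theorem fkMean_sub (F G : Finset (Sym2 (Option V)) → ℝ) :
    fkMean P q D E (fun ω => F ω - G ω) = fkMean P q D E F - fkMean P q D E G := by
  simp only [fkMean, mul_sub, Finset.sum_sub_distrib, sub_div]

theorem fkMean_nonneg (hP : ∀ e, P e ∈ Set.Icc (0 : ℝ) 1) (hq : 1 ≤ q)
    {F : Finset (Sym2 (Option V)) → ℝ} (h : ∀ ω ⊆ E, 0 ≤ F ω) : 0 ≤ fkMean P q D E F := by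
  rw [← fkMean_const (D := D) (E := E) hP hq 0]
  exact fkMean_mono hP hq h

theorem fkMean_le_one (hP : ∀ e, P e ∈ Set.Icc (0 : ℝ) 1) (hq : 1 ≤ q)
    {F : Finset (Sym2 (Option V)) → ℝ} (h : ∀ ω ⊆ E, F ω ≤ 1) : fkMean P q D E F ≤ 1 := by
  rw [← fkMean_const (D := D) (E := E) hP hq 1]
  exact fkMean_mono hP hq h

/-- The lattice condition between the law on `E` with the exterior frozen at `ξ` and the law with
everything outside `D'` wired. Product weights give equality; the cluster factors are handled by
`clusters_supermodular`. -/
theorem pow_clusters_holley (hP : ∀ e, P e ∈ Set.Icc (0 : ℝ) 1) (hq : 1 ≤ q) (hD : D' ⊆ D)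
    {ξ : Finset (Sym2 (Option V))} (hξ : ∀ e ∈ ξ, ∀ v ∈ D', some v ∉ e)
    (s t : Finset (Sym2 (Option V))) :
    bernWeight P E s * q ^ clusters D (ξ ∪ s) * fkWeight P q D' E t ≤
      bernWeight P E (s ∩ t) * q ^ clusters D (ξ ∪ s ∩ t) * fkWeight P q D' E (s ∪ t) := by
  have h := pow_le_pow_right₀ hq (clusters_supermodular hD (s := s) (t := t) hξ)
  rw [pow_add, pow_add] at h
  calc _ = (bernWeight P E s * bernWeight P E t) *
        (q ^ clusters D (ξ ∪ s) * q ^ clusters D' t) := by unfold fkWeight; ring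
    _ ≤ (bernWeight P E s * bernWeight P E t) *
        (q ^ clusters D (ξ ∪ s ∩ t) * q ^ clusters D' (s ∪ t)) :=
      mul_le_mul_of_nonneg_left h
        (mul_nonneg (bernWeight_nonneg hP _ _) (bernWeight_nonneg hP _ _))
    _ = _ := by rw [bernWeight_mul]; unfold fkWeight; ring

theorem fkWeight_lattice (hP : ∀ e, P e ∈ Set.Icc (0 : ℝ) 1) (hq : 1 ≤ q)
    (s t : Finset (Sym2 (Option V))) :
    fkWeight P q D E s * fkWeight P q D E t ≤
      fkWeight P q D E (s ∩ t) * fkWeight P q D E (s ∪ t) := by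
  have h := pow_clusters_holley (E := E) hP hq (Finset.Subset.refl D) (ξ := ∅) (by simp) s t
  simp only [Finset.empty_union] at h
  exact h

/-- **Domain Markov property and comparison of boundary conditions**: an increasing function of
the edges in `E'` and a function of the other edges are decoupled, if `E'` gets wired boundary
conditions. -/
theorem fkMean_mul_le (hP : ∀ e, P e ∈ Set.Icc (0 : ℝ) 1) (hq : 1 ≤ q) (hD : D' ⊆ D)
    (hE : E' ⊆ E) (hout : ∀ e ∈ E \ E', ∀ v ∈ D', some v ∉ e)
    {f g : Finset (Sym2 (Option V)) → ℝ} (hf : ∀ ω, 0 ≤ f ω) (hfm : Monotone f)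
    (hfE : ∀ ω, f ω = f (ω ∩ E')) (hg : ∀ ω, 0 ≤ g ω) (hgE : ∀ ω, g ω = g (ω \ E')) :
    fkMean P q D E (fun ω => f ω * g ω) ≤ fkMean P q D' E' f * fkMean P q D E g := by
  have hdisj : Disjoint (E \ E') E' := Finset.sdiff_disjoint
  have hsplit : ∀ F : Finset (Sym2 (Option V)) → ℝ, ∑ ω ∈ E.powerset, F ω =
      ∑ ξ ∈ (E \ E').powerset, ∑ η ∈ E'.powerset, F (ξ ∪ η) := by
    intro F
    rw [← sum_powerset_union hdisj, Finset.sdiff_union_of_subset hE]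
  have hEE : E = (E \ E') ∪ E' := (Finset.sdiff_union_of_subset hE).symm
  have hZ : 0 < fkZ P q D E := fkZ_pos hP hq
  have hZ' : 0 < fkZ P q D' E' := fkZ_pos hP hq
  have hw : ∀ ξ ⊆ E \ E', ∀ η ⊆ E', fkWeight P q D E (ξ ∪ η) =
      bernWeight P (E \ E') ξ * (bernWeight P E' η * q ^ clusters D (ξ ∪ η)) := by
    intro ξ hξ η hη
    rw [fkWeight]
    conv_lhs => rw [hEE, bernWeight_union hdisj hξ hη]
    ring
  have hff : ∀ ξ ⊆ E \ E', ∀ η ⊆ E', f (ξ ∪ η) = f η := by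
    intro ξ hξ η hη
    rw [hfE, Finset.union_inter_distrib_right, Finset.inter_eq_left.2 hη,
      Finset.disjoint_iff_inter_eq_empty.1 (hdisj.mono_left hξ), Finset.empty_union]
  have hgg : ∀ ξ ⊆ E \ E', ∀ η ⊆ E', g (ξ ∪ η) = g ξ := by
    intro ξ hξ η hη
    rw [hgE, Finset.union_sdiff_distrib, Finset.sdiff_eq_empty_iff_subset.2 hη,
      Finset.union_empty, Finset.sdiff_eq_self_of_disjoint (hdisj.mono_left hξ)]
  -- For each fixed exterior configuration the conditional law on `E'` is dominated by the wired
  -- law. Since `g` depends on `ξ` only, summing over `ξ` gives the product bound.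
  have hinner : ∀ ξ ⊆ E \ E',
      (∑ η ∈ E'.powerset, bernWeight P E' η * q ^ clusters D (ξ ∪ η) * f η) * fkZ P q D' E' ≤
        (∑ η ∈ E'.powerset, bernWeight P E' η * q ^ clusters D (ξ ∪ η)) *
          ∑ η ∈ E'.powerset, fkWeight P q D' E' η * f η := by
    intro ξ hξ
    exact holley_powerset E' (w₁ := fun η => bernWeight P E' η * q ^ clusters D (ξ ∪ η))
      (fun s _ => mul_nonneg (bernWeight_nonneg hP _ _) (by positivity))
      (fun s _ => fkWeight_nonneg hP hq s) (fun s _ => hf s) (fun s t h _ => hfm h)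
      fun s _ t _ => pow_clusters_holley hP hq hD (fun e he => hout e (hξ he)) s t
  have hmain : (∑ ω ∈ E.powerset, fkWeight P q D E ω * (f ω * g ω)) * fkZ P q D' E' ≤
      (∑ η ∈ E'.powerset, fkWeight P q D' E' η * f η) *
        ∑ ω ∈ E.powerset, fkWeight P q D E ω * g ω := by
    rw [hsplit, hsplit fun ω => fkWeight P q D E ω * g ω, Finset.sum_mul, Finset.mul_sum]
    refine Finset.sum_le_sum fun ξ hξ => ?_
    have hξ' := Finset.mem_powerset.1 hξ
    have h1 : ∑ η ∈ E'.powerset, fkWeight P q D E (ξ ∪ η) * (f (ξ ∪ η) * g (ξ ∪ η)) =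
        bernWeight P (E \ E') ξ * g ξ *
          ∑ η ∈ E'.powerset, bernWeight P E' η * q ^ clusters D (ξ ∪ η) * f η := by
      rw [Finset.mul_sum]
      refine Finset.sum_congr rfl fun η hη => ?_
      have hη' := Finset.mem_powerset.1 hη
      rw [hw ξ hξ' η hη', hff ξ hξ' η hη', hgg ξ hξ' η hη']
      ring
    have h2 : ∑ η ∈ E'.powerset, fkWeight P q D E (ξ ∪ η) * g (ξ ∪ η) =
        bernWeight P (E \ E') ξ * g ξ *
          ∑ η ∈ E'.powerset, bernWeight P E' η * q ^ clusters D (ξ ∪ η) := by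
      rw [Finset.mul_sum]
      refine Finset.sum_congr rfl fun η hη => ?_
      have hη' := Finset.mem_powerset.1 hη
      rw [hw ξ hξ' η hη', hgg ξ hξ' η hη']
      ring
    rw [h1, h2, mul_assoc]
    calc _ ≤ bernWeight P (E \ E') ξ * g ξ *
        ((∑ η ∈ E'.powerset, bernWeight P E' η * q ^ clusters D (ξ ∪ η)) *
          ∑ η ∈ E'.powerset, fkWeight P q D' E' η * f η) :=
          mul_le_mul_of_nonneg_left (hinner ξ hξ') (mul_nonneg (bernWeight_nonneg hP _ _) (hg ξ))
      _ = _ := by ring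
  rw [fkMean, fkMean, fkMean, div_mul_div_comm, div_le_div_iff₀ hZ (mul_pos hZ' hZ)]
  calc _ = ((∑ ω ∈ E.powerset, fkWeight P q D E ω * (f ω * g ω)) * fkZ P q D' E') *
        fkZ P q D E := by ring
    _ ≤ _ := mul_le_mul_of_nonneg_right hmain hZ.le

/-- Edges with parameter zero can be removed. -/
theorem fkMean_of_param_zero {I X : Finset (Sym2 (Option V))} (hdisj : Disjoint X I)
    {P₀ : Sym2 (Option V) → ℝ} (hX : ∀ e ∈ X, P₀ e = 0) (hI : ∀ e ∈ I, P₀ e = P e)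
    (F : Finset (Sym2 (Option V)) → ℝ) :
    fkMean P₀ q D (X ∪ I) F = fkMean P q D I F := by
  have key : ∀ G : Finset (Sym2 (Option V)) → ℝ,
      ∑ ω ∈ (X ∪ I).powerset, fkWeight P₀ q D (X ∪ I) ω * G ω =
        ∑ ω ∈ I.powerset, fkWeight P q D I ω * G ω := by
    intro G
    rw [sum_powerset_union hdisj, Finset.sum_eq_single ∅]
    · refine Finset.sum_congr rfl fun η hη => ?_
      rw [fkWeight, bernWeight_union hdisj (Finset.empty_subset X) (Finset.mem_powerset.1 hη),
        Finset.empty_union, fkWeight]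
      have h1 : bernWeight P₀ X ∅ = 1 :=
        Finset.prod_eq_one fun e he => by simp [hX e he]
      have h2 : bernWeight P₀ I η = bernWeight P I η :=
        Finset.prod_congr rfl fun e he => by rw [hI e he]
      rw [h1, h2, one_mul]
    · intro ξ hξ hne
      obtain ⟨e, he⟩ := Finset.nonempty_iff_ne_empty.2 hne
      have hξ' := Finset.mem_powerset.1 hξ
      refine Finset.sum_eq_zero fun η hη => ?_
      rw [fkWeight, bernWeight_union hdisj hξ' (Finset.mem_powerset.1 hη)]
      have : bernWeight P₀ X ξ = 0 :=
        Finset.prod_eq_zero (hξ' he) (by simp [he, hX e (hξ' he)])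
      simp [this]
    · simp
  have hZ := key fun _ => 1
  simp only [mul_one] at hZ
  rw [fkMean, fkMean, key, fkZ, fkZ, hZ]

/-- The effect of additional edges `X` on probabilities is at most the probability that one of
them is open in independent percolation. -/
theorem fkMean_union_le (hP : ∀ e, P e ∈ Set.Icc (0 : ℝ) 1) (hq : 1 ≤ q)
    {I X : Finset (Sym2 (Option V))} (hdisj : Disjoint X I)
    {F : Finset (Sym2 (Option V)) → ℝ} (hF : ∀ ω, 0 ≤ F ω) (hF1 : ∀ ω, F ω ≤ 1) :
    fkMean P q D (X ∪ I) F ≤ fkMean P q D I F + (1 - ∏ e ∈ X, (1 - P e)) := by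
  set c := ∏ e ∈ X, (1 - P e) with hc
  have hb : bernWeight P X ∅ = c := Finset.prod_congr rfl fun e _ => by simp
  have hc0 : 0 ≤ c := hb ▸ bernWeight_nonneg hP _ _
  have hZ : 0 < fkZ P q D (X ∪ I) := fkZ_pos hP hq
  have hZI : 0 < fkZ P q D I := fkZ_pos hP hq
  have hempty : ∀ G : Finset (Sym2 (Option V)) → ℝ,
      ∑ η ∈ I.powerset, fkWeight P q D (X ∪ I) (∅ ∪ η) * G (∅ ∪ η) =
        c * ∑ η ∈ I.powerset, fkWeight P q D I η * G η := by
    intro G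
    rw [Finset.mul_sum]
    refine Finset.sum_congr rfl fun η hη => ?_
    rw [fkWeight, bernWeight_union hdisj (Finset.empty_subset X) (Finset.mem_powerset.1 hη),
      Finset.empty_union, fkWeight, hb]
    ring
  -- Opening edges of `X` never creates clusters and the weights on `X` sum to 1. Thus all of `X` is
  -- closed with probability `c * Z_I / Z ≥ c`.
  have hle : fkZ P q D (X ∪ I) ≤ fkZ P q D I := by
    rw [fkZ, sum_powerset_union hdisj, ← one_mul (fkZ P q D I), ← sum_bernWeight (P := P) X,
      Finset.sum_mul]
    refine Finset.sum_le_sum fun ξ hξ => ?_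
    rw [fkZ, Finset.mul_sum]
    refine Finset.sum_le_sum fun η hη => ?_
    rw [fkWeight, bernWeight_union hdisj (Finset.mem_powerset.1 hξ) (Finset.mem_powerset.1 hη),
      fkWeight, mul_assoc]
    exact mul_le_mul_of_nonneg_left (mul_le_mul_of_nonneg_left
      (pow_le_pow_right₀ hq (clusters_anti Finset.subset_union_right)) (bernWeight_nonneg hP _ _))
      (bernWeight_nonneg hP _ _)
  have hsplit : ∀ G : Finset (Sym2 (Option V)) → ℝ,
      ∑ ω ∈ (X ∪ I).powerset, fkWeight P q D (X ∪ I) ω * G ω =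
        c * ∑ η ∈ I.powerset, fkWeight P q D I η * G η +
        ∑ ξ ∈ X.powerset.erase ∅, ∑ η ∈ I.powerset,
          fkWeight P q D (X ∪ I) (ξ ∪ η) * G (ξ ∪ η) := by
    intro G
    rw [sum_powerset_union hdisj, ← Finset.add_sum_erase _ _ (Finset.empty_mem_powerset X),
      hempty]
  have h1 := hsplit F
  have h2 := hsplit fun _ => 1
  simp only [mul_one] at h2
  have h3 : ∑ ξ ∈ X.powerset.erase ∅, ∑ η ∈ I.powerset,
      fkWeight P q D (X ∪ I) (ξ ∪ η) * F (ξ ∪ η) ≤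
      ∑ ξ ∈ X.powerset.erase ∅, ∑ η ∈ I.powerset, fkWeight P q D (X ∪ I) (ξ ∪ η) :=
    Finset.sum_le_sum fun ξ _ => Finset.sum_le_sum fun η _ =>
      mul_le_of_le_one_right (fkWeight_nonneg hP hq _) (hF1 _)
  have h4 : 0 ≤ ∑ ξ ∈ X.powerset.erase ∅, ∑ η ∈ I.powerset, fkWeight P q D (X ∪ I) (ξ ∪ η) :=
    Finset.sum_nonneg fun ξ _ => Finset.sum_nonneg fun η _ => fkWeight_nonneg hP hq _
  have h5 : 0 ≤ ∑ η ∈ I.powerset, fkWeight P q D I η * F η :=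
    Finset.sum_nonneg fun η _ => mul_nonneg (fkWeight_nonneg hP hq _) (hF _)
  rw [← fkZ, ← fkZ] at h2
  rw [fkMean, fkMean, h1, div_le_iff₀ hZ]
  set N := ∑ η ∈ I.powerset, fkWeight P q D I η * F η
  set R := ∑ ξ ∈ X.powerset.erase ∅, ∑ η ∈ I.powerset, fkWeight P q D (X ∪ I) (ξ ∪ η)
  have h6 : c * N ≤ N / fkZ P q D I * fkZ P q D (X ∪ I) := by
    rw [div_mul_eq_mul_div, le_div_iff₀ hZI, mul_comm c, mul_assoc]
    exact mul_le_mul_of_nonneg_left (by linarith) h5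
  -- `R` is the mass of configurations with some edge of `X` open: `Z = c * Z_I + R` together with
  -- `Z ≤ Z_I`.
  have h7 : R ≤ (1 - c) * fkZ P q D (X ∪ I) := by
    nlinarith
  nlinarith

/-! ### Invariance under bijections of the vertices -/

/-- The action of a bijection of the vertices on edges. -/
def edgeEmb (σ : V ≃ V) : Sym2 (Option V) ↪ Sym2 (Option V) :=
  ⟨Sym2.map (Option.map σ), Sym2.map.injective (Option.map_injective σ.injective)⟩

theorem sum_powerset_map {ε : Type*} [DecidableEq ε] (ρ : ε ↪ ε) (E : Finset ε)
    (F : Finset ε → ℝ) :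
    ∑ ω ∈ (E.map ρ).powerset, F ω = ∑ ω ∈ E.powerset, F (ω.map ρ) := by
  symm
  refine Finset.sum_bij (fun ω _ => ω.map ρ) ?_ ?_ ?_ fun _ _ => rfl
  · intro ω hω
    exact Finset.mem_powerset.2 (Finset.map_subset_map.2 (Finset.mem_powerset.1 hω))
  · intro a _ b _ h
    exact Finset.map_injective ρ h
  · intro b hb
    obtain ⟨t, ht, rfl⟩ := Finset.subset_map_iff.1 (Finset.mem_powerset.1 hb)
    exact ⟨t, Finset.mem_powerset.2 ht, rfl⟩

omit [DecidableEq V] in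
theorem clusters_map (σ : V ≃ V) (D : Finset V) (ω : Finset (Sym2 (Option V))) :
    clusters (D.map σ.toEmbedding) (ω.map (edgeEmb σ)) = clusters D ω := by
  have hinv : ∀ a : Option V, Option.map σ.symm (Option.map σ a) = a := fun a => by
    cases a <;> simp
  have hinv' : ∀ a : Option V, Option.map σ (Option.map σ.symm a) = a := fun a => by
    cases a <;> simp
  symm
  refine card_connectedComponent_congr (Option.map σ) (Option.map σ.symm) ?_ ?_
    (fun x => by rw [hinv]) (fun x => by rw [hinv'])
  · rintro x y (h | h)
    · refine SimpleGraph.Adj.reachable (Or.inl ⟨fun h' => h.1 (Option.map_injective σ.injective h'),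
        fun v hv h' => ?_, fun v hv h' => ?_⟩)
      · obtain ⟨u, hu, rfl⟩ := Finset.mem_map.1 hv
        exact h.2.1 u hu (Option.map_injective σ.injective h')
      · obtain ⟨u, hu, rfl⟩ := Finset.mem_map.1 hv
        exact h.2.2 u hu (Option.map_injective σ.injective h')
    · rw [SimpleGraph.fromEdgeSet_adj] at h
      refine SimpleGraph.Adj.reachable (Or.inr ((SimpleGraph.fromEdgeSet_adj _).2
        ⟨Finset.mem_coe.2 (Finset.mem_map.2 ⟨_, h.1, rfl⟩),
          fun h' => h.2 (Option.map_injective σ.injective h')⟩))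
  · rintro x y (h | h)
    · refine SimpleGraph.Adj.reachable (Or.inl
        ⟨fun h' => h.1 (Option.map_injective σ.symm.injective h'),
        fun v hv h' => ?_, fun v hv h' => ?_⟩)
      · exact h.2.1 (σ v) (Finset.mem_map_of_mem _ hv) (by rw [← hinv' x, h']; rfl)
      · exact h.2.2 (σ v) (Finset.mem_map_of_mem _ hv) (by rw [← hinv' y, h']; rfl)
    · rw [SimpleGraph.fromEdgeSet_adj] at h
      obtain ⟨e, he, hxy⟩ := Finset.mem_map.1 (Finset.mem_coe.1 h.1)
      have : e = s(Option.map σ.symm x, Option.map σ.symm y) := by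
        apply (edgeEmb σ).injective
        rw [hxy]
        simp only [edgeEmb, Function.Embedding.coeFn_mk, Sym2.map_mk, hinv']
      refine SimpleGraph.Adj.reachable (Or.inr ((SimpleGraph.fromEdgeSet_adj _).2
        ⟨Finset.mem_coe.2 (this ▸ he),
          fun h' => h.2 (Option.map_injective σ.symm.injective h')⟩))

theorem fkWeight_map (σ : V ≃ V) (ω : Finset (Sym2 (Option V))) :
    fkWeight P q (D.map σ.toEmbedding) (E.map (edgeEmb σ)) (ω.map (edgeEmb σ)) =
      fkWeight (fun e => P (edgeEmb σ e)) q D E ω := by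
  rw [fkWeight, fkWeight, clusters_map]
  simp [bernWeight, Finset.prod_map]

/-- Invariance of random cluster measures under bijections of the vertices. -/
theorem fkMean_map (σ : V ≃ V) (F : Finset (Sym2 (Option V)) → ℝ) :
    fkMean P q (D.map σ.toEmbedding) (E.map (edgeEmb σ)) F =
      fkMean (fun e => P (edgeEmb σ e)) q D E fun ω => F (ω.map (edgeEmb σ)) := by
  simp only [fkMean, fkZ, sum_powerset_map, fkWeight_map]

end FK

/-! ### Configurations as finite sets of edges -/

section Translation

variable {V : Type*} [DecidableEq V] {G : SimpleGraph V}

/-- The configuration in which exactly the edges in `ω` are open. -/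
def toConfig (G : SimpleGraph V) (ω : Finset (Sym2 (Option V))) : Config G :=
  (fun e => decide (e.1.map some ∈ ω), fun v => decide (s(some v, none) ∈ ω))

/-- The edge of the graph with ghost which corresponds to an edge of the induced graph. -/
def inducedEdge (Λ : Finset V) (e : (G.induce (Λ : Set V)).edgeSet) : Sym2 (Option V) :=
  e.1.map fun x => some x.1

open Classical in
/-- The internal edges with both endpoints in `Λ`. -/
def intEdges (G : SimpleGraph V) (Λ : Finset V) : Finset (Sym2 (Option V)) :=
  (Finset.univ : Finset (G.induce (Λ : Set V)).edgeSet).image (inducedEdge Λ)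

/-- The external edges at the vertices in `Λ`. -/
def extEdges (Λ : Finset V) : Finset (Sym2 (Option V)) := Λ.image fun v => s(some v, none)

/-- All edges of the subgraph induced by `Λ` and the ghost. -/
def allEdges (G : SimpleGraph V) (Λ : Finset V) : Finset (Sym2 (Option V)) :=
  extEdges Λ ∪ intEdges G Λ

/-- The edge parameters: `r` for edges to the ghost and `p` for all others. -/
def edgeParam (p r : ℝ) (e : Sym2 (Option V)) : ℝ := if none ∈ e then r else p

theorem mem_intEdges {Λ : Finset V} {e : Sym2 (Option V)} :
    e ∈ intEdges G Λ ↔ ∃ x ∈ Λ, ∃ y ∈ Λ, G.Adj x y ∧ e = s(some x, some y) := by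
  classical
  simp only [intEdges, Finset.mem_image, Finset.mem_univ, true_and]
  constructor
  · rintro ⟨⟨f, hf⟩, rfl⟩
    induction f using Sym2.ind with
    | h x y => exact ⟨x.1, x.2, y.1, y.2, hf, rfl⟩
  · rintro ⟨x, hx, y, hy, h, rfl⟩
    exact ⟨⟨s(⟨x, hx⟩, ⟨y, hy⟩), h⟩, rfl⟩

theorem mem_extEdges {Λ : Finset V} {e : Sym2 (Option V)} :
    e ∈ extEdges Λ ↔ ∃ x ∈ Λ, s(some x, none) = e := by
  simp [extEdges]

theorem disjoint_extEdges_intEdges (G : SimpleGraph V) (Λ Λ' : Finset V) :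
    Disjoint (extEdges Λ) (intEdges G Λ') := by
  rw [Finset.disjoint_left]
  intro e h h'
  obtain ⟨x, -, rfl⟩ := mem_extEdges.1 h
  obtain ⟨y, -, z, -, -, h⟩ := mem_intEdges.1 h'
  simp at h

theorem mk_some_none_mem_allEdges {Λ : Finset V} {x : V} :
    s(some x, none) ∈ allEdges G Λ ↔ x ∈ Λ := by
  rw [allEdges, Finset.mem_union]
  constructor
  · rintro (h | h)
    · obtain ⟨y, hy, h⟩ := mem_extEdges.1 h
      simp at h
      exact h ▸ hy
    · obtain ⟨y, -, z, -, -, h⟩ := mem_intEdges.1 h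
      simp at h
  · exact fun h => Or.inl (mem_extEdges.2 ⟨x, h, rfl⟩)

theorem mk_some_some_mem_intEdges {Λ : Finset V} {x y : V} :
    s(some x, some y) ∈ intEdges G Λ ↔ x ∈ Λ ∧ y ∈ Λ ∧ G.Adj x y := by
  rw [mem_intEdges]
  constructor
  · rintro ⟨a, ha, b, hb, hab, h⟩
    simp only [Sym2.eq_iff, Option.some.injEq] at h
    rcases h with ⟨rfl, rfl⟩ | ⟨rfl, rfl⟩
    · exact ⟨ha, hb, hab⟩
    · exact ⟨hb, ha, hab.symm⟩
  · rintro ⟨hx, hy, h⟩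
    exact ⟨x, hx, y, hy, h, rfl⟩

theorem mk_some_some_mem_allEdges {Λ : Finset V} {x y : V} :
    s(some x, some y) ∈ allEdges G Λ ↔ x ∈ Λ ∧ y ∈ Λ ∧ G.Adj x y := by
  rw [allEdges, Finset.mem_union, mk_some_some_mem_intEdges, or_iff_right]
  intro h
  obtain ⟨z, -, h⟩ := mem_extEdges.1 h
  simp at h

theorem edgeParam_mem_Icc {p r : ℝ} (hp : p ∈ Set.Icc (0 : ℝ) 1) (hr : r ∈ Set.Icc (0 : ℝ) 1)
    (e : Sym2 (Option V)) : edgeParam p r e ∈ Set.Icc (0 : ℝ) 1 := by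
  unfold edgeParam; split_ifs <;> assumption

theorem internalGraph_toConfig_adj {ω : Finset (Sym2 (Option V))} {x y : V} :
    (internalGraph (toConfig G ω)).Adj x y ↔ G.Adj x y ∧ s(some x, some y) ∈ ω := by
  constructor
  · rintro ⟨⟨e, he⟩, h1, h2⟩
    simp only at h1
    subst h1
    exact ⟨he, of_decide_eq_true h2⟩
  · rintro ⟨h1, h2⟩
    exact ⟨⟨s(x, y), h1⟩, rfl, decide_eq_true h2⟩

variable {Λ : Finset V}

open Classical in
/-- The set of open edges of a configuration on the subgraph induced by `Λ`. -/
def openEdges (ω : Config (G.induce (Λ : Set V))) : Finset (Sym2 (Option V)) :=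
  (Finset.univ.filter fun v : (Λ : Set V) => ω.2 v = true).image (fun v => s(some v.1, none)) ∪
    (Finset.univ.filter fun e : (G.induce (Λ : Set V)).edgeSet => ω.1 e = true).image
      (inducedEdge Λ)

omit [DecidableEq V] in
theorem inducedEdge_injective :
    Function.Injective (inducedEdge Λ : (G.induce (Λ : Set V)).edgeSet → _) := fun _ _ h =>
  Subtype.ext (Sym2.map.injective ((Option.some_injective V).comp Subtype.val_injective) h)

omit [DecidableEq V] in
theorem inducedEdge_ne (e : (G.induce (Λ : Set V)).edgeSet) (v : V) :
    inducedEdge Λ e ≠ s(some v, none) := by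
  obtain ⟨f, hf⟩ := e
  induction f using Sym2.ind with
  | h x y => simp [inducedEdge]

theorem ext_mem_openEdges {ω : Config (G.induce (Λ : Set V))} {v : (Λ : Set V)} :
    s(some v.1, none) ∈ openEdges ω ↔ ω.2 v = true := by
  classical
  simp only [openEdges, Finset.mem_union, Finset.mem_image, Finset.mem_filter, Finset.mem_univ,
    true_and]
  constructor
  · rintro (⟨u, hu, h⟩ | ⟨e, -, h⟩)
    · have h' : u.1 = v.1 := by simpa using h
      exact Subtype.ext h' ▸ hu
    · exact absurd h (inducedEdge_ne e v)
  · exact fun h => Or.inl ⟨v, h, rfl⟩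

theorem int_mem_openEdges {ω : Config (G.induce (Λ : Set V))}
    {e : (G.induce (Λ : Set V)).edgeSet} : inducedEdge Λ e ∈ openEdges ω ↔ ω.1 e = true := by
  classical
  simp only [openEdges, Finset.mem_union, Finset.mem_image, Finset.mem_filter, Finset.mem_univ,
    true_and]
  constructor
  · rintro (⟨u, hu, h⟩ | ⟨f, hf, h⟩)
    · exact absurd h.symm (inducedEdge_ne e u)
    · exact inducedEdge_injective h ▸ hf
  · exact fun h => Or.inr ⟨e, h, rfl⟩

theorem openEdges_subset (ω : Config (G.induce (Λ : Set V))) : openEdges ω ⊆ allEdges G Λ := by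
  classical
  refine Finset.union_subset_union ?_ (Finset.image_subset_image (Finset.filter_subset _ _))
  intro e he
  obtain ⟨v, -, rfl⟩ := Finset.mem_image.1 he
  exact mem_extEdges.2 ⟨v.1, v.2, rfl⟩

theorem openEdges_injective :
    Function.Injective (openEdges : Config (G.induce (Λ : Set V)) → _) := by
  intro ω ω' h
  refine Prod.ext (funext fun e => ?_) (funext fun v => ?_)
  · rw [Bool.eq_iff_iff, ← int_mem_openEdges, h, int_mem_openEdges]
  · rw [Bool.eq_iff_iff, ← ext_mem_openEdges, h, ext_mem_openEdges]

theorem exists_openEdges_eq {s : Finset (Sym2 (Option V))} (hs : s ⊆ allEdges G Λ) :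
    ∃ ω : Config (G.induce (Λ : Set V)), openEdges ω = s := by
  classical
  refine ⟨(fun e => decide (inducedEdge Λ e ∈ s), fun v => decide (s(some v.1, none) ∈ s)), ?_⟩
  set ω : Config (G.induce (Λ : Set V)) :=
    (fun e => decide (inducedEdge Λ e ∈ s), fun v => decide (s(some v.1, none) ∈ s))
  have key : ∀ e ∈ allEdges G Λ, (e ∈ openEdges ω ↔ e ∈ s) := by
    intro e he
    rcases Finset.mem_union.1 he with h | h
    · obtain ⟨v, hv, rfl⟩ := mem_extEdges.1 h
      exact (ext_mem_openEdges (ω := ω) (v := ⟨v, hv⟩)).trans decide_eq_true_iff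
    · obtain ⟨f, -, rfl⟩ := Finset.mem_image.1 h
      exact (int_mem_openEdges (ω := ω) (e := f)).trans decide_eq_true_iff
  ext e
  exact ⟨fun h => (key e (openEdges_subset ω h)).1 h, fun h => (key e (hs h)).2 h⟩

theorem toConfig_openEdges (ω : Config (G.induce (Λ : Set V))) :
    toConfig G (openEdges ω) = extend Λ ω := by
  classical
  refine Prod.ext (funext fun e => ?_) (funext fun v => ?_)
  · rw [Bool.eq_iff_iff]
    simp only [toConfig, extend, decide_eq_true_eq]
    constructor
    · intro h
      have h' := openEdges_subset ω h
      rcases Finset.mem_union.1 h' with h1 | h1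
      · obtain ⟨v, hv, h2⟩ := mem_extEdges.1 h1
        obtain ⟨f, hf⟩ := e
        induction f using Sym2.ind with
        | h x y => simp at h2
      · obtain ⟨f, -, h2⟩ := Finset.mem_image.1 h1
        refine ⟨f, ?_, int_mem_openEdges.1 (h2 ▸ h)⟩
        apply Sym2.map.injective (Option.some_injective V)
        rw [← h2, Sym2.map_map]
        rfl
    · rintro ⟨f, hf, h⟩
      rw [← hf, Sym2.map_map]
      exact int_mem_openEdges.2 h
  · rw [Bool.eq_iff_iff]
    simp only [toConfig, extend, decide_eq_true_eq]
    constructor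
    · intro h
      have hv := mk_some_none_mem_allEdges.1 (openEdges_subset ω h)
      exact ⟨⟨v, hv⟩, rfl, ext_mem_openEdges.1 h⟩
    · rintro ⟨w, rfl, h⟩
      exact ext_mem_openEdges.2 h

/-- The two graphs have different vertex sets. Inclusion, and the map collapsing everything outside
`D` to the ghost, are inverse up to connection: vertices of `Λ` in `W` are wired to the ghost in
both graphs, and vertices outside `Λ` add no component. -/
theorem clusterCount_eq_clusters (W : Set V) [DecidablePred (· ∈ W)]
    (ω : Config (G.induce (Λ : Set V))) :
    clusterCount {x | x.1 ∈ W} ω = clusters (Λ.filter (· ∉ W)) (openEdges ω) := by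
  classical
  set D := Λ.filter (· ∉ W)
  have hD : ∀ {v}, v ∈ D → v ∈ Λ := fun h => (Finset.mem_filter.1 h).1
  set H := openGraph {x : (Λ : Set V) | x.1 ∈ W} ω
  set φ : Option (Λ : Set V) → Option V := Option.map Subtype.val
  set ψ : Option V → Option (Λ : Set V) := fun a => a.bind fun v =>
    if h : v ∈ D then some ⟨v, hD h⟩ else none with hψ
  have hψD : ∀ {v} (h : v ∈ D), ψ (some v) = some ⟨v, hD h⟩ := fun h => by simp [hψ, h]
  have hψD' : ∀ {v}, v ∉ D → ψ (some v) = none := fun h => by simp [hψ, h]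
  have hext : ∀ x : (Λ : Set V), ω.2 x = true ∨ x.1 ∈ W → H.Adj (some x) none := fun x h => by
    rw [show H = SimpleGraph.fromRel _ from rfl, SimpleGraph.fromRel_adj]
    exact ⟨by simp, Or.inl h⟩
  have hint : ∀ x y : (Λ : Set V), (internalGraph ω).Adj x y → H.Adj (some x) (some y) :=
    fun x y h => by
      rw [show H = SimpleGraph.fromRel _ from rfl, SimpleGraph.fromRel_adj]
      exact ⟨fun h' => h.ne (Option.some_injective _ h'), Or.inl h⟩
  have hback : ∀ x : (Λ : Set V), H.Reachable (ψ (some x.1)) (some x) := by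
    intro x
    by_cases h : x.1 ∈ D
    · rw [hψD h]
    · rw [hψD' h]
      refine (hext x (Or.inr ?_)).reachable.symm
      by_contra h'
      exact h (Finset.mem_filter.2 ⟨x.2, h'⟩)
  have hedge : ∀ {x y : (Λ : Set V)}, (internalGraph ω).Adj x y →
      (wiredGraph D (openEdges ω)).Reachable (some x.1) (some y.1) := by
    rintro x y ⟨e, he, ho⟩
    refine SimpleGraph.Adj.reachable (Or.inr ((SimpleGraph.fromEdgeSet_adj _).2 ⟨?_, ?_⟩))
    · have := int_mem_openEdges.2 ho
      rwa [inducedEdge, he] at this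
    · have hne : x ≠ y := fun h => by
        have h2 := e.2
        rw [he, h] at h2
        exact (G.induce (Λ : Set V)).loopless.irrefl y h2
      exact fun h => hne (Subtype.ext (Option.some_injective _ h))
  have hghost : ∀ {x : (Λ : Set V)}, ω.2 x = true ∨ x.1 ∈ W →
      (wiredGraph D (openEdges ω)).Reachable (some x.1) none := by
    rintro x (h | h)
    · exact SimpleGraph.Adj.reachable (Or.inr ((SimpleGraph.fromEdgeSet_adj _).2
        ⟨ext_mem_openEdges.2 h, by simp⟩))
    · refine SimpleGraph.Adj.reachable (Or.inl ⟨by simp, fun v hv hx => ?_, by simp⟩)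
      rw [← Option.some_injective _ hx] at hv
      exact (Finset.mem_filter.1 hv).2 h
  refine card_connectedComponent_congr φ ψ ?_ ?_ ?_ ?_
  · intro a b hab
    have h := (SimpleGraph.fromRel_adj _ _ _).1 hab
    match a, b, h with
    | some x, some y, h =>
      rcases h.2 with h | h
      · exact hedge h
      · exact (hedge h).symm
    | some x, none, h =>
      rcases h.2 with h | h
      · exact hghost h
      · exact h.elim
    | none, some x, h =>
      rcases h.2 with h | h
      · exact h.elim
      · exact (hghost h).symm
    | none, none, h => exact absurd rfl h.1
  · rintro a b (h | h)
    · have hn : ∀ a : Option V, (∀ v ∈ D, a ≠ some v) → ψ a = none := by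
        intro a ha
        cases a with
        | none => rfl
        | some v => exact hψD' fun hv => ha v hv rfl
      rw [hn a h.2.1, hn b h.2.2]
    · rw [SimpleGraph.fromEdgeSet_adj] at h
      have he := Finset.mem_coe.1 h.1
      rcases Finset.mem_union.1 (openEdges_subset ω he) with h1 | h1
      · obtain ⟨v, hv, h2⟩ := mem_extEdges.1 h1
        have ho : ω.2 ⟨v, hv⟩ = true := ext_mem_openEdges.1 (h2 ▸ he)
        have key : H.Reachable (ψ (some v)) (ψ none) :=
          (hback ⟨v, hv⟩).trans (hext ⟨v, hv⟩ (Or.inl ho)).reachable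
        rcases Sym2.eq_iff.1 h2 with ⟨rfl, rfl⟩ | ⟨rfl, rfl⟩
        · exact key
        · exact key.symm
      · obtain ⟨f, -, h2⟩ := Finset.mem_image.1 h1
        have ho : ω.1 f = true := int_mem_openEdges.1 (h2 ▸ he)
        obtain ⟨f, hf⟩ := f
        induction f using Sym2.ind with
        | h x y =>
          have key : H.Reachable (ψ (some x.1)) (ψ (some y.1)) :=
            (hback x).trans ((hint x y ⟨_, rfl, ho⟩).reachable.trans (hback y).symm)
          rcases Sym2.eq_iff.1 h2 with ⟨rfl, rfl⟩ | ⟨rfl, rfl⟩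
          · exact key
          · exact key.symm
  · intro a
    cases a with
    | none => rfl
    | some x => exact hback x
  · intro a
    cases a with
    | none => rfl
    | some v =>
      by_cases h : v ∈ D
      · rw [hψD h]; rfl
      · rw [hψD' h]
        refine SimpleGraph.Adj.reachable (Or.inl ⟨by simp [φ], fun v _ => by simp [φ], ?_⟩)
        intro u hu hvu
        exact h (Option.some_injective _ hvu ▸ hu)

theorem weight_eq_fkWeight (p q h : ℝ) (W : Set V) [DecidablePred (· ∈ W)]
    (ω : Config (G.induce (Λ : Set V))) :
    weight p q h {x | x.1 ∈ W} ω = fkWeight (edgeParam p (extParam q h)) q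
      (Λ.filter (· ∉ W)) (allEdges G Λ) (openEdges ω) := by
  classical
  have hX : extEdges Λ = (Finset.univ : Finset (Λ : Set V)).image fun v => s(some v.1, none) := by
    ext e
    simp [mem_extEdges]
  rw [weight, fkWeight, clusterCount_eq_clusters]
  congr 1
  rw [bernWeight, allEdges, Finset.prod_union (disjoint_extEdges_intEdges G Λ Λ), mul_comm]
  congr 1
  · rw [hX, Finset.prod_image fun u _ v _ h => Subtype.ext (by simpa using h)]
    refine Finset.prod_congr rfl fun v _ => ?_
    simp only [ext_mem_openEdges]
    simp [edgeParam]
  · rw [intEdges, Finset.prod_image inducedEdge_injective.injOn]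
    refine Finset.prod_congr rfl fun e _ => ?_
    simp only [int_mem_openEdges]
    have : none ∉ inducedEdge Λ e := by
      obtain ⟨f, hf⟩ := e
      induction f using Sym2.ind with
      | h x y => simp [inducedEdge]
    simp [edgeParam, this]

/-- The law of a configuration on the induced subgraph as a random cluster measure on sets of
edges. -/
theorem sum_prob_mul (p q h : ℝ) (W : Set V) [DecidablePred (· ∈ W)]
    [Fintype (Config (G.induce (Λ : Set V)))] (F : Config G → ℝ) :
    ∑ ω : Config (G.induce (Λ : Set V)), prob p q h {x | x.1 ∈ W} ω * F (extend Λ ω) =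
      fkMean (edgeParam p (extParam q h)) q (Λ.filter (· ∉ W)) (allEdges G Λ)
        fun ω => F (toConfig G ω) := by
  classical
  have key : ∀ K : Finset (Sym2 (Option V)) → ℝ,
      ∑ ω : Config (G.induce (Λ : Set V)), K (openEdges ω) = ∑ s ∈ (allEdges G Λ).powerset, K s := by
    intro K
    refine Finset.sum_bij (fun ω _ => openEdges ω)
      (fun ω _ => Finset.mem_powerset.2 (openEdges_subset ω))
      (fun _ _ _ _ h => openEdges_injective h) (fun s hs => ?_) fun _ _ => rfl
    obtain ⟨ω, hω⟩ := exists_openEdges_eq (Finset.mem_powerset.1 hs)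
    exact ⟨ω, Finset.mem_univ _, hω⟩
  have hZ : ∑ ω : Config (G.induce (Λ : Set V)), weight p q h {x | x.1 ∈ W} ω =
      fkZ (edgeParam p (extParam q h)) q (Λ.filter (· ∉ W)) (allEdges G Λ) := by
    rw [fkZ, ← key]
    exact Finset.sum_congr rfl fun ω _ => weight_eq_fkWeight p q h W ω
  rw [fkMean, ← key, ← hZ, Finset.sum_div]
  refine Finset.sum_congr rfl fun ω _ => ?_
  rw [toConfig_openEdges, prob, weight_eq_fkWeight]
  rw [div_mul_eq_mul_div]
  -- What is left is that two `Fintype` instances on the configurations have the same `univ`.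
  congr 2
  ext
  simp only [Finset.mem_univ]

omit [DecidableEq V] in
theorem prob_nonneg [Fintype V] {p q h : ℝ} (hp : p ∈ Set.Icc (0 : ℝ) 1)
    (hr : extParam q h ∈ Set.Icc (0 : ℝ) 1) (hq : 0 ≤ q) (W : Set V) (ω : Config G) :
    0 ≤ prob p q h W ω := by
  have hw : ∀ ω : Config G, 0 ≤ weight p q h W ω := by
    intro ω
    refine mul_nonneg (mul_nonneg ?_ ?_) (pow_nonneg hq _) <;>
      refine Finset.prod_nonneg fun e _ => ?_ <;> split_ifs
    · exact hp.1
    · exact sub_nonneg.2 hp.2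
    · exact hr.1
    · exact sub_nonneg.2 hr.2
  exact div_nonneg (hw ω) (Finset.sum_nonneg fun ω _ => hw ω)

end Translation

/-! ### The wired measure on a box as a random cluster mean. -/

section Lattice

variable {d : ℕ} {p q h : ℝ}

theorem extParam_mem_Icc (hq : 1 < q) (hh : 0 ≤ h) : extParam q h ∈ Set.Icc (0 : ℝ) 1 := by
  have : -(q / (q - 1)) * h ≤ 0 := by
    have : 0 ≤ q / (q - 1) := div_nonneg (by linarith) (by linarith)
    nlinarith
  have h1 := Real.exp_le_one_iff.2 this
  have h2 := Real.exp_pos (-(q / (q - 1)) * h)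
  exact ⟨by unfold extParam; linarith, by unfold extParam; linarith⟩

open Classical in
/-- The interior of the box `Λ_n`. -/
def boxInterior (d n : ℕ) : Finset (Fin d → ℤ) := (box d n).filter (· ∉ boxBoundary d n)

/-- The mean of a function of the configuration under the wired measure on `Λ_n`. -/
def boxMean (d : ℕ) (p q r : ℝ) (n : ℕ) (F : Finset (Sym2 (Option (Fin d → ℤ))) → ℝ) : ℝ :=
  fkMean (edgeParam p r) q (boxInterior d n) (allEdges (lattice d) (box d n)) F

open Classical in
/-- The indicator function of an event as a function of sets of edges. -/
def eventInd (A : Set (Config (lattice d))) (ω : Finset (Sym2 (Option (Fin d → ℤ)))) : ℝ :=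
  if toConfig (lattice d) ω ∈ A then 1 else 0

/-- No measurability of `A` is needed, because the measure is a finite sum of Dirac masses at
measurable points. -/
theorem wiredMeasure_apply (hp : p ∈ Set.Icc (0 : ℝ) 1) (hq : 1 < q) (hh : 0 ≤ h) (n : ℕ)
    (A : Set (Config (lattice d))) :
    wiredMeasure d p q h n A = ENNReal.ofReal (boxMean d p q (extParam q h) n (eventInd A)) := by
  classical
  rw [wiredMeasure, Measure.finsetSum_apply]
  simp only [Measure.smul_apply, Measure.dirac_apply, smul_eq_mul]
  have h1 := sum_prob_mul (G := lattice d) (Λ := box d n) p q h (boxBoundary d n)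
    fun ω => if ω ∈ A then 1 else 0
  rw [boxMean, boxInterior]
  unfold eventInd
  rw [show fkMean _ _ _ _ _ = _ from h1.symm, ENNReal.ofReal_sum_of_nonneg]
  · refine Finset.sum_congr rfl fun ω _ => ?_
    by_cases hA : extend (box d n) ω ∈ A <;> simp [hA]
  · intro ω _
    refine mul_nonneg (prob_nonneg hp (extParam_mem_Icc hq hh) (by linarith) _ _) ?_
    split_ifs <;> norm_num

end Lattice

/-! ### Boxes in the lattice -/

section Boxes

variable {d : ℕ}

/-- The box of radius `n` around `c`. -/
def ball (c : Fin d → ℤ) (n : ℕ) : Finset (Fin d → ℤ) :=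
  (box d n).map (Equiv.addRight c).toEmbedding

/-- The boundary of the box of radius `n` around `c`. -/
def sphere (c : Fin d → ℤ) (n : ℕ) : Set (Fin d → ℤ) := {x | x - c ∈ boxBoundary d n}

theorem mem_box {n : ℕ} {x : Fin d → ℤ} : x ∈ box d n ↔ ∀ i, |x i| ≤ n := by
  simp only [box, Finset.mem_Icc, Pi.le_def, abs_le, forall_and]

theorem mem_boxInterior {n : ℕ} {x : Fin d → ℤ} : x ∈ boxInterior d n ↔ ∀ i, |x i| < n := by
  classical
  simp only [boxInterior, Finset.mem_filter, boxBoundary, Set.mem_ofPred_eq, not_and, not_exists,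
    mem_box]
  exact ⟨fun h i => lt_of_le_of_ne (h.1 i) (h.2 h.1 i),
    fun h => ⟨fun i => (h i).le, fun _ i => (h i).ne⟩⟩

theorem mem_ball {c : Fin d → ℤ} {n : ℕ} {x : Fin d → ℤ} :
    x ∈ ball c n ↔ ∀ i, |x i - c i| ≤ n := by
  rw [ball, Finset.mem_map_equiv, mem_box]
  simp [← sub_eq_add_neg]

theorem mem_sphere {c : Fin d → ℤ} {n : ℕ} {x : Fin d → ℤ} :
    x ∈ sphere c n ↔ x ∈ ball c n ∧ ∃ i, |x i - c i| = n := by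
  simp [sphere, boxBoundary, mem_ball, mem_box]

theorem ball_zero (n : ℕ) : ball (0 : Fin d → ℤ) n = box d n := by
  ext x; simp [mem_ball, mem_box]

theorem sphere_zero (n : ℕ) : sphere (0 : Fin d → ℤ) n = boxBoundary d n := by
  ext x; simp [sphere]

theorem lattice_adj_coord {x y : Fin d → ℤ} (h : (lattice d).Adj x y) (i : Fin d) :
    |x i - y i| ≤ 1 := by
  have h1 : ∑ j, |x j - y j| = 1 := h
  rw [← h1]
  exact Finset.single_le_sum (f := fun j => |x j - y j|) (fun j _ => abs_nonneg _)
    (Finset.mem_univ i)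

theorem lattice_adj_add {x y : Fin d → ℤ} (c : Fin d → ℤ) :
    (lattice d).Adj (x + c) (y + c) ↔ (lattice d).Adj x y := by
  simp [lattice]

theorem card_box (n : ℕ) : (box d n).card = (2 * n + 1) ^ d := by
  rw [box, Pi.card_Icc]
  simp only [Int.card_Icc, Finset.prod_const, Finset.card_univ, Fintype.card_fin]
  congr 1
  omega

theorem allEdges_ball (c : Fin d → ℤ) (n : ℕ) :
    allEdges (lattice d) (ball c n) =
      (allEdges (lattice d) (box d n)).map (edgeEmb (Equiv.addRight c)) := by
  ext e
  simp only [Finset.mem_map, edgeEmb, Function.Embedding.coeFn_mk]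
  simp only [allEdges, Finset.mem_union, mem_extEdges, mem_intEdges, ball, Finset.mem_map_equiv]
  constructor
  · rintro (⟨x, hx, rfl⟩ | ⟨x, hx, y, hy, hxy, rfl⟩)
    · exact ⟨_, Or.inl ⟨_, hx, rfl⟩, by simp⟩
    · refine ⟨_, Or.inr ⟨_, hx, _, hy, ?_, rfl⟩, by simp⟩
      rw [← lattice_adj_add c]
      simpa using hxy
  · rintro ⟨f, ⟨x, hx, rfl⟩ | ⟨x, hx, y, hy, hxy, rfl⟩, rfl⟩
    · exact Or.inl ⟨x + c, by simpa using hx, by simp⟩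
    · exact Or.inr ⟨x + c, by simpa using hx, y + c, by simpa using hy,
        (lattice_adj_add c).2 hxy, by simp⟩

theorem allEdges_mono {V : Type*} [DecidableEq V] {G : SimpleGraph V} {Λ Λ' : Finset V}
    (h : Λ ⊆ Λ') : allEdges G Λ ⊆ allEdges G Λ' := by
  intro e he
  rcases Finset.mem_union.1 he with h1 | h1
  · obtain ⟨x, hx, rfl⟩ := mem_extEdges.1 h1
    exact mk_some_none_mem_allEdges.2 (h hx)
  · obtain ⟨x, hx, y, hy, hxy, rfl⟩ := mem_intEdges.1 h1
    exact mk_some_some_mem_allEdges.2 ⟨h hx, h hy, hxy⟩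

theorem ball_subset_box {c : Fin d → ℤ} {m n : ℕ} (h : ∀ i, |c i| + m ≤ n) :
    ball c m ⊆ box d n := by
  intro x hx
  rw [mem_ball] at hx
  rw [mem_box]
  intro i
  have h1 := hx i
  have h2 := h i
  have h3 := abs_sub_abs_le_abs_sub (x i) (c i)
  linarith

variable {p q r : ℝ}

/-- `fkMean_mul_le` for the edges of a translated box, combined with translation invariance. The
interior of the small box lies in that of the large one, and every edge of the large box touching
the small interior is an edge of the small box. -/
theorem boxMean_mul_le (hp : p ∈ Set.Icc (0 : ℝ) 1) (hr : r ∈ Set.Icc (0 : ℝ) 1) (hq : 1 ≤ q)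
    {c : Fin d → ℤ} {m n : ℕ} (h : ∀ i, |c i| + m ≤ n)
    {f g : Finset (Sym2 (Option (Fin d → ℤ))) → ℝ} (hf : ∀ ω, 0 ≤ f ω) (hfm : Monotone f)
    (hfE : ∀ ω, f ω = f (ω ∩ allEdges (lattice d) (ball c m))) (hg : ∀ ω, 0 ≤ g ω)
    (hgE : ∀ ω, g ω = g (ω \ allEdges (lattice d) (ball c m))) :
    boxMean d p q r n (fun ω => f ω * g ω) ≤
      boxMean d p q r m (fun ω => f (ω.map (edgeEmb (Equiv.addRight c)))) *
        boxMean d p q r n g := by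
  have hinv : (fun e => edgeParam p r (edgeEmb (Equiv.addRight c) e)) =
      (edgeParam p r : Sym2 (Option (Fin d → ℤ)) → ℝ) := by
    funext e
    induction e using Sym2.ind with
    | h a b => cases a <;> cases b <;> simp [edgeParam, edgeEmb]
  have hm : boxMean d p q r m (fun ω => f (ω.map (edgeEmb (Equiv.addRight c)))) =
      fkMean (edgeParam p r) q ((boxInterior d m).map (Equiv.addRight c).toEmbedding)
        (allEdges (lattice d) (ball c m)) f := by
    rw [allEdges_ball, fkMean_map, hinv, boxMean]
  rw [hm]
  refine fkMean_mul_le (edgeParam_mem_Icc hp hr) hq ?_ (allEdges_mono (ball_subset_box h)) ?_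
    hf hfm hfE hg hgE
  · intro x hx
    rw [Finset.mem_map_equiv, mem_boxInterior] at hx
    rw [mem_boxInterior]
    intro i
    have h1 := hx i
    have h2 := h i
    simp only [Equiv.addRight_symm, Equiv.coe_addRight, Pi.add_apply, Pi.neg_apply,
      ← sub_eq_add_neg] at h1
    have h3 := abs_sub_abs_le_abs_sub (x i) (c i)
    linarith
  · intro e he v hv hve
    obtain ⟨he1, he2⟩ := Finset.mem_sdiff.1 he
    rw [Finset.mem_map_equiv, mem_boxInterior] at hv
    have hv' : ∀ i, |v i - c i| < m := fun i => by
      have := hv i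
      simpa [← sub_eq_add_neg] using this
    have hvb : v ∈ ball c m := mem_ball.2 fun i => (hv' i).le
    have hnb : ∀ u, (lattice d).Adj v u → u ∈ ball c m := fun u hu => mem_ball.2 fun i => by
      have h1 := lattice_adj_coord hu.symm i
      have h2 := hv' i
      have h3 := abs_sub_le (u i) (v i) (c i)
      omega
    rcases Finset.mem_union.1 he1 with h1 | h1
    · obtain ⟨x, hx, rfl⟩ := mem_extEdges.1 h1
      simp only [Sym2.mem_iff, Option.some.injEq, reduceCtorEq, or_false] at hve
      subst hve
      exact he2 (mk_some_none_mem_allEdges.2 hvb)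
    · obtain ⟨x, hx, y, hy, hxy, rfl⟩ := mem_intEdges.1 h1
      simp only [Sym2.mem_iff, Option.some.injEq] at hve
      rcases hve with rfl | rfl
      · exact he2 (mk_some_some_mem_allEdges.2 ⟨hvb, hnb _ hxy, hxy⟩)
      · exact he2 (mk_some_some_mem_allEdges.2 ⟨hnb _ hxy.symm, hvb, hxy⟩)

theorem boxMean_le_ball (hp : p ∈ Set.Icc (0 : ℝ) 1) (hr : r ∈ Set.Icc (0 : ℝ) 1) (hq : 1 ≤ q)
    {c : Fin d → ℤ} {m n : ℕ} (h : ∀ i, |c i| + m ≤ n)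
    {f : Finset (Sym2 (Option (Fin d → ℤ))) → ℝ} (hf : ∀ ω, 0 ≤ f ω) (hfm : Monotone f)
    (hfE : ∀ ω, f ω = f (ω ∩ allEdges (lattice d) (ball c m))) :
    boxMean d p q r n f ≤
      boxMean d p q r m (fun ω => f (ω.map (edgeEmb (Equiv.addRight c)))) := by
  have h' := boxMean_mul_le hp hr hq h hf hfm hfE (g := fun _ => 1) (fun _ => zero_le_one)
    fun _ => rfl
  simpa only [mul_one, boxMean, fkMean_const (edgeParam_mem_Icc hp hr) hq] using h'

/-- Wired boundary conditions on a smaller box favour increasing events. This monotonicity yields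
the infinite volume limit. -/
theorem boxMean_anti (hp : p ∈ Set.Icc (0 : ℝ) 1) (hr : r ∈ Set.Icc (0 : ℝ) 1) (hq : 1 ≤ q)
    {m n : ℕ} (h : m ≤ n) {f : Finset (Sym2 (Option (Fin d → ℤ))) → ℝ} (hf : ∀ ω, 0 ≤ f ω)
    (hfm : Monotone f) (hfE : ∀ ω, f ω = f (ω ∩ allEdges (lattice d) (box d m))) :
    boxMean d p q r n f ≤ boxMean d p q r m f := by
  have h' := boxMean_le_ball hp hr hq (c := 0) (m := m) (n := n) (by intro i; simpa using h) hf hfm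
    (by rwa [ball_zero])
  have hid : edgeEmb (Equiv.addRight (0 : Fin d → ℤ)) = Function.Embedding.refl _ := by
    ext e : 1
    induction e using Sym2.ind with
    | h a b => cases a <;> cases b <;> simp [edgeEmb]
  simpa only [hid, Finset.map_refl] using h'

/-! ### Existence of the infinite volume measure -/

-- With no edge required to be closed, the event is increasing and its probabilities are eventually
-- nonincreasing in `n`. Closed edges are then imposed one at a time by subtraction.
open Classical in
theorem tendsto_boxMean_cylinder (hp : p ∈ Set.Icc (0 : ℝ) 1) (hr : r ∈ Set.Icc (0 : ℝ) 1)
    (hq : 1 ≤ q) (S T : Finset (Sym2 (Option (Fin d → ℤ)))) :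
    ∃ L, Tendsto (fun n => boxMean d p q r n
      fun ω => if S ⊆ ω ∧ Disjoint ω T then 1 else 0) atTop (𝓝 L) := by
  induction T using Finset.induction_on generalizing S with
  | empty =>
    simp only [Finset.disjoint_empty_right, and_true]
    by_cases hS : ∃ N, S ⊆ allEdges (lattice d) (box d N)
    · obtain ⟨N, hN⟩ := hS
      have hbox : ∀ {m n : ℕ}, m ≤ n → box d m ⊆ box d n := fun h x hx => by
        rw [mem_box] at hx ⊢
        exact fun i => (hx i).trans (by exact_mod_cast h)
      have hanti : Antitone fun n => boxMean d p q r (n + N)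
          fun ω => if S ⊆ ω then (1 : ℝ) else 0 := by
        intro m n hmn
        refine boxMean_anti hp hr hq (by omega) (fun ω => by split_ifs <;> norm_num) ?_ ?_
        · intro s t hst
          by_cases h : S ⊆ s
          · simp [h, h.trans hst]
          · simp only [h, if_false]; split_ifs <;> norm_num
        · intro ω
          have h1 : S ⊆ allEdges (lattice d) (box d (m + N)) :=
            hN.trans (allEdges_mono (hbox (by omega)))
          simp [Finset.subset_inter_iff, h1]
      have hbdd : BddBelow (Set.range fun n => boxMean d p q r (n + N)
          fun ω => if S ⊆ ω then (1 : ℝ) else 0) := by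
        refine ⟨0, ?_⟩
        rintro _ ⟨n, rfl⟩
        exact fkMean_nonneg (edgeParam_mem_Icc hp hr) hq fun ω _ => by split_ifs <;> norm_num
      exact ⟨_, (tendsto_add_atTop_iff_nat (f := fun n => boxMean d p q r n
        fun ω => if S ⊆ ω then (1 : ℝ) else 0) N).1 (tendsto_atTop_ciInf hanti hbdd)⟩
    -- If `S` fits in no box, for instance because it contains a pair which is not an edge, all
    -- probabilities vanish.
    · push Not at hS
      refine ⟨0, ?_⟩
      have : (fun n => boxMean d p q r n fun ω => if S ⊆ ω then (1 : ℝ) else 0) = fun _ => 0 := by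
        funext n
        rw [boxMean, fkMean_congr (G := fun _ => 0),
          fkMean_const (edgeParam_mem_Icc hp hr) hq]
        intro ω hω
        exact if_neg fun h => hS n (h.trans hω)
      rw [this]
      exact tendsto_const_nhds
  | insert e T heT ih =>
    obtain ⟨L₁, h₁⟩ := ih S
    obtain ⟨L₂, h₂⟩ := ih (insert e S)
    refine ⟨L₁ - L₂, (h₁.sub h₂).congr fun n => ?_⟩
    rw [boxMean, boxMean, ← fkMean_sub, boxMean]
    refine fkMean_congr fun ω _ => ?_
    by_cases h1 : S ⊆ ω <;> by_cases h2 : Disjoint ω T <;> by_cases h3 : e ∈ ω <;>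
      simp [h1, h2, h3, Finset.insert_subset_iff, Finset.disjoint_insert_right]

theorem IsLocal.exists_finset {A : Set (Config (lattice d))} (hA : IsLocal A) :
    ∃ T : Finset (Sym2 (Option (Fin d → ℤ))), ∀ ω, eventInd A ω = eventInd A (ω ∩ T) := by
  classical
  obtain ⟨E, S, h⟩ := hA
  refine ⟨E.image (fun e => e.1.map some) ∪ S.image fun v => s(some v, none), fun ω => ?_⟩
  unfold eventInd
  congr 1
  refine propext (h _ _ (fun e he => ?_) fun v hv => ?_)
  · have : e.1.map some ∈ E.image (fun e => e.1.map some) ∪ S.image fun v => s(some v, none) :=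
      Finset.mem_union_left _ (Finset.mem_image_of_mem (fun e : (lattice d).edgeSet =>
        e.1.map some) he)
    simp only [toConfig, Finset.mem_inter, this, and_true]
  · have : s(some v, none) ∈ E.image (fun e => e.1.map some) ∪ S.image fun v => s(some v, none) :=
      Finset.mem_union_right _ (Finset.mem_image_of_mem (fun v => s(some v, none)) hv)
    simp only [toConfig, Finset.mem_inter, this, and_true]

/-- A local event is a finite disjoint union of cylinders, one for each possible trace `R` of the
open edges on `T`. -/
theorem tendsto_boxMean_local (hp : p ∈ Set.Icc (0 : ℝ) 1) (hr : r ∈ Set.Icc (0 : ℝ) 1)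
    (hq : 1 ≤ q) {A : Set (Config (lattice d))} (hA : IsLocal A) :
    ∃ L, Tendsto (fun n => boxMean d p q r n (eventInd A)) atTop (𝓝 L) := by
  classical
  obtain ⟨T, hT⟩ := hA.exists_finset
  choose L hL using fun R : Finset (Sym2 (Option (Fin d → ℤ))) =>
    tendsto_boxMean_cylinder (d := d) hp hr hq R (T \ R)
  refine ⟨∑ R ∈ T.powerset, eventInd A R * L R,
    (tendsto_finsetSum _ fun R _ => (hL R).const_mul (eventInd A R)).congr fun n => ?_⟩
  have : ∀ ω, eventInd A ω = ∑ R ∈ T.powerset, eventInd A R *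
      (if R ⊆ ω ∧ Disjoint ω (T \ R) then 1 else 0) := by
    intro ω
    rw [hT, Finset.sum_eq_single (ω ∩ T)]
    · have h1 : Disjoint ω (T \ (ω ∩ T)) := by
        rw [Finset.disjoint_left]
        intro e h h'
        simp only [Finset.mem_sdiff, Finset.mem_inter] at h'
        tauto
      rw [if_pos ⟨Finset.inter_subset_left, h1⟩, mul_one]
    · intro R hR hne
      rw [if_neg, mul_zero]
      rintro ⟨h1, h2⟩
      refine hne (Finset.Subset.antisymm (Finset.subset_inter h1 (Finset.mem_powerset.1 hR)) ?_)
      intro e he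
      by_contra h
      exact Finset.disjoint_left.1 h2 (Finset.mem_inter.1 he).1
        (Finset.mem_sdiff.2 ⟨(Finset.mem_inter.1 he).2, h⟩)
    · intro h
      exact absurd (Finset.mem_powerset.2 Finset.inter_subset_right) h
  have h2 : eventInd A = fun ω => ∑ R ∈ T.powerset, eventInd A R *
      (if R ⊆ ω ∧ Disjoint ω (T \ R) then 1 else 0) := funext this
  conv_rhs => rw [h2]
  rw [boxMean, fkMean_sum]
  refine Finset.sum_congr rfl fun R _ => ?_
  simp only [boxMean, fkMean, Finset.mul_sum, ← mul_div_assoc]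
  congr 1
  exact Finset.sum_congr rfl fun ω _ => by ring

/-- A local event is the preimage of a set in a finite discrete space. Its frontier is empty, so
weak convergence gives convergence of its probability. -/
theorem IsLocal.isClopen {A : Set (Config (lattice d))} (hA : IsLocal A) : IsClopen A := by
  obtain ⟨E, S, h⟩ := hA
  let ρ : Config (lattice d) → (E → Bool) × (S → Bool) := fun ω => (fun e => ω.1 e, fun v => ω.2 v)
  have hρ : Continuous ρ := by fun_prop
  have hA' : A = ρ ⁻¹' (ρ '' A) := by
    refine Set.Subset.antisymm (Set.subset_preimage_image ρ A) ?_
    rintro ω ⟨ω', hω', he⟩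
    refine (h ω' ω (fun e he' => ?_) fun v hv => ?_).1 hω'
    · exact congrFun (congrArg Prod.fst he) ⟨e, he'⟩
    · exact congrFun (congrArg Prod.snd he) ⟨v, hv⟩
  rw [hA']
  exact (isClopen_discrete _).preimage hρ

theorem isProbabilityMeasure_wiredMeasure {h : ℝ} (hp : p ∈ Set.Icc (0 : ℝ) 1) (hq : 1 < q)
    (hh : 0 ≤ h) (n : ℕ) : IsProbabilityMeasure (wiredMeasure d p q h n) := by
  constructor
  rw [wiredMeasure_apply hp hq hh]
  have : eventInd (Set.univ : Set (Config (lattice d))) = fun _ => 1 := by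
    funext ω; simp [eventInd]
  rw [this, boxMean, fkMean_const (edgeParam_mem_Icc hp (extParam_mem_Icc hq hh)) hq.le]
  simp

/-- The infinite volume wired random cluster measure exists. -/
theorem exists_isInfiniteVolume {h : ℝ} (hp : p ∈ Set.Icc (0 : ℝ) 1) (hq : 1 < q)
    (hh : 0 ≤ h) : ∃ μ : Measure (Config (lattice d)), IsInfiniteVolume d p q h μ := by
  let ν : ℕ → ProbabilityMeasure (Config (lattice d)) := fun n =>
    ⟨wiredMeasure d p q h n, isProbabilityMeasure_wiredMeasure hp hq hh n⟩
  let U : Ultrafilter ℕ := hyperfilter ℕ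
  have hU : (U : Filter ℕ) ≤ atTop := Nat.hyperfilter_le_atTop
  -- The configuration space is compact, so its probability measures form a compact space and the
  -- sequence converges along an ultrafilter. On local events the full limit exists and must agree
  -- with this one.
  have hμ : Tendsto ν U (𝓝 (U.map ν).lim) := (U.map ν).le_nhds_lim
  set μ := (U.map ν).lim
  refine ⟨μ, μ.2, fun A hA => ?_⟩
  obtain ⟨L, hL⟩ := tendsto_boxMean_local (d := d) hp (extParam_mem_Icc hq hh) hq.le hA
  have h1 : Tendsto (fun n => wiredMeasure d p q h n A) atTop (𝓝 (ENNReal.ofReal L)) := by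
    simp only [wiredMeasure_apply hp hq hh]
    exact ENNReal.tendsto_ofReal hL
  have h2 : Tendsto (fun n => wiredMeasure d p q h n A) U (𝓝 ((μ : Measure _) A)) :=
    ProbabilityMeasure.tendsto_measure_of_null_frontier_of_tendsto' hμ
      (by simp [hA.isClopen.frontier_eq])
  rwa [tendsto_nhds_unique h2 (h1.mono_left hU)]

end Boxes

/-! ### Crossing events -/

section Crossing

variable {d : ℕ}

/-- The subgraph of the edges with both endpoints in `Λ`. -/
def within {V : Type*} (H : SimpleGraph V) (Λ : Finset V) : SimpleGraph V where
  Adj x y := H.Adj x y ∧ x ∈ Λ ∧ y ∈ Λ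
  symm := ⟨fun _ _ h => ⟨h.1.symm, h.2.2, h.2.1⟩⟩
  loopless := ⟨fun _ h => h.1.ne rfl⟩

/-- The event that `A` is connected to `B` by open internal edges in `Λ`. -/
def crossing (Λ : Finset (Fin d → ℤ)) (A B : Set (Fin d → ℤ)) : Set (Config (lattice d)) :=
  {ω | ∃ x ∈ A, ∃ y ∈ B, (within (internalGraph ω) Λ).Reachable x y}

theorem within_le {V : Type*} (H : SimpleGraph V) (Λ : Finset V) : within H Λ ≤ H :=
  fun _ _ h => h.1

theorem internalGraph_le {V : Type*} {G : SimpleGraph V} (ω : Config G) : internalGraph ω ≤ G := by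
  rintro x y ⟨e, he, -⟩
  have := e.2
  rwa [he] at this

theorem within_toConfig_adj {Λ : Finset (Fin d → ℤ)} {ω : Finset (Sym2 (Option (Fin d → ℤ)))}
    {x y : Fin d → ℤ} : (within (internalGraph (toConfig (lattice d) ω)) Λ).Adj x y ↔
      s(some x, some y) ∈ intEdges (lattice d) Λ ∧ s(some x, some y) ∈ ω := by
  rw [mk_some_some_mem_intEdges]
  change (internalGraph _).Adj x y ∧ _ ↔ _
  rw [internalGraph_toConfig_adj]
  tauto

theorem eventInd_nonneg (A : Set (Config (lattice d))) (ω : Finset (Sym2 (Option (Fin d → ℤ)))) :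
    0 ≤ eventInd A ω := by unfold eventInd; split_ifs <;> norm_num

theorem eventInd_le_one (A : Set (Config (lattice d))) (ω : Finset (Sym2 (Option (Fin d → ℤ)))) :
    eventInd A ω ≤ 1 := by unfold eventInd; split_ifs <;> norm_num

theorem eventInd_le {A B : Set (Config (lattice d))} {ω ω' : Finset (Sym2 (Option (Fin d → ℤ)))}
    (h : toConfig (lattice d) ω ∈ A → toConfig (lattice d) ω' ∈ B) :
    eventInd A ω ≤ eventInd B ω' := by
  unfold eventInd
  by_cases hA : toConfig (lattice d) ω ∈ A
  · simp [hA, h hA]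
  · simp only [hA, if_false]; split_ifs <;> norm_num

theorem eventInd_crossing_le {Λ : Finset (Fin d → ℤ)} {A B : Set (Fin d → ℤ)}
    {ω ω' : Finset (Sym2 (Option (Fin d → ℤ)))}
    (h : ∀ e ∈ intEdges (lattice d) Λ, e ∈ ω → e ∈ ω') :
    eventInd (crossing Λ A B) ω ≤ eventInd (crossing Λ A B) ω' := by
  refine eventInd_le ?_
  rintro ⟨x, hx, y, hy, hxy⟩
  refine ⟨x, hx, y, hy, hxy.mono ?_⟩
  intro a b hab
  rw [within_toConfig_adj] at hab ⊢
  exact ⟨hab.1, h _ hab.1 hab.2⟩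

theorem eventInd_crossing_congr {Λ : Finset (Fin d → ℤ)} {A B : Set (Fin d → ℤ)}
    {ω ω' : Finset (Sym2 (Option (Fin d → ℤ)))}
    (h : ∀ e ∈ intEdges (lattice d) Λ, (e ∈ ω ↔ e ∈ ω')) :
    eventInd (crossing Λ A B) ω = eventInd (crossing Λ A B) ω' :=
  le_antisymm (eventInd_crossing_le fun e he => (h e he).1)
    (eventInd_crossing_le fun e he => (h e he).2)

theorem eventInd_crossing_mono (Λ : Finset (Fin d → ℤ)) (A B : Set (Fin d → ℤ)) :
    Monotone (eventInd (crossing Λ A B)) := fun _ _ h =>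
  eventInd_crossing_le fun _ _ he => h he

theorem eventInd_crossing_inter {Λ : Finset (Fin d → ℤ)} {A B : Set (Fin d → ℤ)}
    {E : Finset (Sym2 (Option (Fin d → ℤ)))} (h : intEdges (lattice d) Λ ⊆ E)
    (ω : Finset (Sym2 (Option (Fin d → ℤ)))) :
    eventInd (crossing Λ A B) ω = eventInd (crossing Λ A B) (ω ∩ E) :=
  eventInd_crossing_congr fun e he => by simp [h he]

theorem intEdges_subset_allEdges {V : Type*} [DecidableEq V] {G : SimpleGraph V} (Λ : Finset V) :
    intEdges G Λ ⊆ allEdges G Λ := Finset.subset_union_right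

theorem eventInd_crossing_map (c : Fin d → ℤ) (n : ℕ) (A B : Set (Fin d → ℤ))
    (ω : Finset (Sym2 (Option (Fin d → ℤ)))) :
    eventInd (crossing (ball c n) A B) (ω.map (edgeEmb (Equiv.addRight c))) =
      eventInd (crossing (box d n) {x | x + c ∈ A} {x | x + c ∈ B}) ω := by
  have hadj : ∀ x y : Fin d → ℤ,
      (within (internalGraph (toConfig (lattice d) (ω.map (edgeEmb (Equiv.addRight c)))))
        (ball c n)).Adj (x + c) (y + c) ↔
      (within (internalGraph (toConfig (lattice d) ω)) (box d n)).Adj x y := by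
    intro x y
    rw [within_toConfig_adj, within_toConfig_adj, mk_some_some_mem_intEdges,
      mk_some_some_mem_intEdges, lattice_adj_add]
    have h1 : ∀ x : Fin d → ℤ, x + c ∈ ball c n ↔ x ∈ box d n := fun x => by
      rw [ball, Finset.mem_map_equiv]; simp
    have h2 : s(some (x + c), some (y + c)) = edgeEmb (Equiv.addRight c) s(some x, some y) := by
      simp [edgeEmb]
    rw [h1, h1, h2, Finset.mem_map']
  have hmap : ∀ x y : Fin d → ℤ,
      (within (internalGraph (toConfig (lattice d) (ω.map (edgeEmb (Equiv.addRight c)))))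
        (ball c n)).Reachable (x + c) (y + c) ↔
      (within (internalGraph (toConfig (lattice d) ω)) (box d n)).Reachable x y := by
    intro x y
    exact SimpleGraph.Iso.reachable_iff
      (φ := (⟨Equiv.addRight c, fun {a b} => hadj a b⟩ :
        within (internalGraph (toConfig (lattice d) ω)) (box d n) ≃g
        within (internalGraph (toConfig (lattice d) (ω.map (edgeEmb (Equiv.addRight c)))))
          (ball c n)))
  refine le_antisymm (eventInd_le ?_) (eventInd_le ?_)
  · rintro ⟨x, hx, y, hy, h⟩
    refine ⟨x - c, by simpa using hx, y - c, by simpa using hy, ?_⟩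
    rw [← hmap]
    simpa using h
  · rintro ⟨x, hx, y, hy, h⟩
    exact ⟨x + c, hx, y + c, hy, (hmap x y).2 h⟩

theorem isLocal_crossing (Λ : Finset (Fin d → ℤ)) (A B : Set (Fin d → ℤ)) :
    IsLocal (crossing Λ A B) := by
  classical
  have key : ∀ ω ω' : Config (lattice d),
      (∀ e : (lattice d).edgeSet, (∀ x ∈ e.1, x ∈ Λ) → ω.1 e = ω'.1 e) →
      ω ∈ crossing Λ A B → ω' ∈ crossing Λ A B := by
    rintro ω ω' h ⟨x, hx, y, hy, hxy⟩
    refine ⟨x, hx, y, hy, hxy.mono ?_⟩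
    rintro a b ⟨⟨e, he, ho⟩, ha, hb⟩
    refine ⟨⟨e, he, ?_⟩, ha, hb⟩
    rw [← h e fun x hx => ?_]
    · exact ho
    · rw [he, Sym2.mem_iff] at hx
      rcases hx with rfl | rfl <;> assumption
  have hfin : {e : (lattice d).edgeSet | ∀ x ∈ e.1, x ∈ Λ}.Finite := by
    refine Set.Finite.of_finite_image (f := Subtype.val) ?_ Subtype.val_injective.injOn
    refine (Finset.finite_toSet Λ.sym2).subset ?_
    rintro _ ⟨e, he, rfl⟩
    exact Finset.mem_coe.2 (Finset.mem_sym2_iff.2 he)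
  refine ⟨hfin.toFinset, ∅, fun ω ω' h _ => ⟨key ω ω' fun e he => h e ?_,
    key ω' ω fun e he => (h e ?_).symm⟩⟩ <;> simpa using he

theorem IsLocal.inter {A B : Set (Config (lattice d))} (hA : IsLocal A) (hB : IsLocal B) :
    IsLocal (A ∩ B) := by
  classical
  obtain ⟨E, S, h⟩ := hA
  obtain ⟨E', S', h'⟩ := hB
  refine ⟨E ∪ E', S ∪ S', fun ω ω' h1 h2 => and_congr
    (h ω ω' (fun e he => h1 e (Finset.mem_union_left _ he)) fun v hv =>
      h2 v (Finset.mem_union_left _ hv))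
    (h' ω ω' (fun e he => h1 e (Finset.mem_union_right _ he)) fun v hv =>
      h2 v (Finset.mem_union_right _ hv))⟩

theorem isLocal_biInter {ι : Type*} (I : Finset ι) {A : ι → Set (Config (lattice d))}
    (hA : ∀ i, IsLocal (A i)) : IsLocal (⋂ i ∈ I, A i) := by
  classical
  induction I using Finset.induction_on with
  | empty => exact ⟨∅, ∅, by simp⟩
  | insert i I hi ih =>
    rw [Finset.set_biInter_insert]
    exact (hA i).inter ih

theorem eventInd_biInter {ι : Type*} (I : Finset ι) (A : ι → Set (Config (lattice d)))
    (ω : Finset (Sym2 (Option (Fin d → ℤ)))) :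
    eventInd (⋂ i ∈ I, A i) ω = ∏ i ∈ I, eventInd (A i) ω := by
  classical
  unfold eventInd
  rw [Finset.prod_ite_zero]
  simp

/-- A connection from a box to a point which is not in its interior yields a connection to the
boundary in the box. -/
theorem exists_exit {H : SimpleGraph (Fin d → ℤ)} (hH : H ≤ lattice d) {c : Fin d → ℤ} {n : ℕ}
    {x y : Fin d → ℤ} (hx : x ∈ ball c n) (hy : ∃ i, (n : ℤ) ≤ |y i - c i|)
    (h : H.Reachable x y) : ∃ z ∈ sphere c n, (within H (ball c n)).Reachable x z := by
  obtain ⟨p⟩ := h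
  induction p with
  | nil =>
    obtain ⟨i, hi⟩ := hy
    exact ⟨_, mem_sphere.2 ⟨hx, i, le_antisymm (mem_ball.1 hx i) hi⟩, SimpleGraph.Reachable.refl _⟩
  | @cons u v w huv p ih =>
    by_cases hu : ∃ i, |u i - c i| = n
    · exact ⟨u, mem_sphere.2 ⟨hx, hu⟩, SimpleGraph.Reachable.refl _⟩
    · push Not at hu
      have hv : v ∈ ball c n := mem_ball.2 fun i => by
        have h1 := lattice_adj_coord (hH huv).symm i
        have h2 := lt_of_le_of_ne (mem_ball.1 hx i) (hu i)
        have h3 := abs_sub_le (v i) (u i) (c i)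
        omega
      obtain ⟨z, hz, hvz⟩ := ih hv hy
      have hadj : (within H (ball c n)).Adj u v := ⟨huv, hx, hv⟩
      exact ⟨z, hz, hadj.reachable.trans hvz⟩

variable {p q r : ℝ}

/-- Crossings of disjoint boxes are dominated by independent crossings. -/
theorem boxMean_biInter_crossing_le (hp : p ∈ Set.Icc (0 : ℝ) 1) (hr : r ∈ Set.Icc (0 : ℝ) 1)
    (hq : 1 ≤ q) {k m n : ℕ} (I : Finset (Fin d → ℤ)) (hI : ∀ c ∈ I, ∀ i, |c i| + m ≤ n)
    (hdisj : ∀ c ∈ I, ∀ c' ∈ I, c ≠ c' → Disjoint (ball c m) (ball c' m)) :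
    boxMean d p q r n (eventInd (⋂ c ∈ I, crossing (ball c m) (ball c k) (sphere c m))) ≤
      boxMean d p q r m (eventInd (crossing (box d m) (box d k) (boxBoundary d m))) ^ I.card := by
  induction I using Finset.induction_on with
  | empty =>
    simp only [Finset.card_empty, pow_zero]
    exact fkMean_le_one (edgeParam_mem_Icc hp hr) hq fun ω _ => eventInd_le_one _ _
  | insert c I hc ih =>
    have ih' := ih (fun c' hc' => hI c' (Finset.mem_insert_of_mem hc'))
      fun a ha b hb => hdisj a (Finset.mem_insert_of_mem ha) b (Finset.mem_insert_of_mem hb)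
    have hprod : eventInd (⋂ a ∈ insert c I, crossing (ball a m) (ball a k) (sphere a m)) =
        fun ω => eventInd (crossing (ball c m) (ball c k) (sphere c m)) ω *
          eventInd (⋂ c ∈ I, crossing (ball c m) (ball c k) (sphere c m)) ω := by
      funext ω
      rw [eventInd_biInter, eventInd_biInter, Finset.prod_insert hc]
    rw [hprod, Finset.card_insert_of_notMem hc, pow_succ']
    -- Peel off one ball: its crossing is increasing in its own edges, and the remaining crossings
    -- do not use them.
    refine (boxMean_mul_le hp hr hq (hI c (Finset.mem_insert_self c I)) (eventInd_nonneg _)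
      (eventInd_crossing_mono _ _ _) (eventInd_crossing_inter (intEdges_subset_allEdges _))
      (eventInd_nonneg _) ?_).trans ?_
    · intro ω
      rw [eventInd_biInter, eventInd_biInter]
      refine Finset.prod_congr rfl fun c' hc' => eventInd_crossing_congr fun e he => ?_
      have hd := hdisj c (Finset.mem_insert_self c I) c' (Finset.mem_insert_of_mem hc')
        (fun h => hc (h ▸ hc'))
      have : e ∉ allEdges (lattice d) (ball c m) := by
        obtain ⟨x, hx, y, hy, hxy, rfl⟩ := mem_intEdges.1 he
        rw [mk_some_some_mem_allEdges]
        exact fun h => Finset.disjoint_left.1 hd h.1 hx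
      simp [this]
    · have hmap : (fun ω : Finset (Sym2 (Option (Fin d → ℤ))) =>
          eventInd (crossing (ball c m) (ball c k) (sphere c m))
          (ω.map (edgeEmb (Equiv.addRight c)))) =
          eventInd (crossing (box d m) (box d k) (boxBoundary d m)) := by
        funext ω
        rw [eventInd_crossing_map]
        congr 2
        · ext x
          simp [ball]
        · ext x
          simp [sphere]
      rw [hmap]
      exact mul_le_mul_of_nonneg_left ih'
        (fkMean_nonneg (edgeParam_mem_Icc hp hr) hq fun ω _ => eventInd_nonneg _ _)

/-- Configurations of the box have no open edges elsewhere, so every connection stays in the box. -/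
theorem eventInd_connects {n : ℕ} {A B : Set (Fin d → ℤ)}
    {ω : Finset (Sym2 (Option (Fin d → ℤ)))} (hω : ω ⊆ allEdges (lattice d) (box d n)) :
    eventInd (connects d A B) ω = eventInd (crossing (box d n) A B) ω := by
  have : within (internalGraph (toConfig (lattice d) ω)) (box d n) =
      internalGraph (toConfig (lattice d) ω) := by
    refine le_antisymm (within_le _ _) fun x y h => ?_
    have h' := internalGraph_toConfig_adj.1 h
    have h2 := mk_some_some_mem_allEdges.1 (hω h'.2)
    exact ⟨h, h2.1, h2.2.1⟩
  refine le_antisymm (eventInd_le ?_) (eventInd_le ?_)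
  · rintro ⟨x, hx, y, hy, h⟩
    exact ⟨x, hx, y, hy, this.symm ▸ h⟩
  · rintro ⟨x, hx, y, hy, h⟩
    exact ⟨x, hx, y, hy, this ▸ h⟩

end Crossing

/-! ### A finite volume criterion for the absence of percolation -/

section Renormalization

variable {d : ℕ}

/-- The index of a box of radius `k` which contains `x`; the centers of these boxes are the
multiples of `2 * k`. -/
def boxIndex (k : ℕ) (x : Fin d → ℤ) : Fin d → ℤ := fun i => (x i + k) / (2 * k)

/-- The center of the box with index `z`. -/
def boxCenter (k : ℕ) (z : Fin d → ℤ) : Fin d → ℤ := fun i => 2 * k * z i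

theorem mem_ball_boxCenter {k : ℕ} (hk : 1 ≤ k) (x : Fin d → ℤ) :
    x ∈ ball (boxCenter k (boxIndex k x)) k := by
  rw [mem_ball]
  intro i
  have hk' : (0 : ℤ) < 2 * k := by omega
  have h1 := Int.emod_add_mul_ediv (x i + k) (2 * k)
  have h2 := Int.emod_nonneg (x i + k) hk'.ne'
  have h3 := Int.emod_lt_of_pos (x i + k) hk'
  simp only [boxCenter, boxIndex]
  rw [abs_le]
  constructor <;> linarith

/-- Rounding each coordinate is monotone and moves by at most 1 under a unit step. Neighbours differ
in a single coordinate, so the index changes by at most one lattice step. -/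
theorem boxIndex_adj {k : ℕ} (hk : 1 ≤ k) {x y : Fin d → ℤ} (h : (lattice d).Adj x y) :
    boxIndex k x = boxIndex k y ∨ (lattice d).Adj (boxIndex k x) (boxIndex k y) := by
  have hk' : (0 : ℤ) < 2 * k := by omega
  have hmono : ∀ a b : ℤ, |a - b| ≤ 1 → |(a + k) / (2 * k) - (b + k) / (2 * k)| ≤ |a - b| := by
    have key : ∀ a b : ℤ, a ≤ b → b ≤ a + 1 →
        |(a + k) / (2 * k) - (b + k) / (2 * k)| ≤ |a - b| := by
      intro a b hab hba
      rcases eq_or_lt_of_le hab with rfl | hlt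
      · simp
      · have hb : b = a + 1 := by omega
        subst hb
        have h1 : (a + k) / (2 * k) ≤ (a + 1 + k) / (2 * k) :=
          Int.ediv_le_ediv hk' (by linarith)
        have h2 : (a + 1 + k) / (2 * k) ≤ (a + k) / (2 * k) + 1 := by
          rw [← Int.add_mul_ediv_right (a + k) 1 hk'.ne']
          exact Int.ediv_le_ediv hk' (by omega)
        rw [abs_le]
        have h3 : |a - (a + 1)| = 1 := by simp
        rw [h3]
        omega
    intro a b hab
    rw [abs_le] at hab
    rcases le_total a b with h | h
    · exact key a b h (by linarith)
    · rw [abs_sub_comm, abs_sub_comm a b]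
      exact key b a h (by linarith)
  have hsum : ∑ i, |boxIndex k x i - boxIndex k y i| ≤ 1 := by
    have h1 : ∑ i, |x i - y i| = 1 := h
    rw [← h1]
    exact Finset.sum_le_sum fun i _ => hmono _ _ (lattice_adj_coord h i)
  by_cases h0 : ∑ i, |boxIndex k x i - boxIndex k y i| = 0
  · left
    rw [Finset.sum_eq_zero_iff_of_nonneg fun i _ => abs_nonneg _] at h0
    funext i
    have := h0 i (Finset.mem_univ i)
    rw [abs_eq_zero] at this
    omega
  · right
    have h1 : 0 ≤ ∑ i, |boxIndex k x i - boxIndex k y i| :=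
      Finset.sum_nonneg fun i _ => abs_nonneg _
    change ∑ i, |boxIndex k x i - boxIndex k y i| = 1
    omega

/-- Distinct indices congruent modulo 4 differ by at least 4 in some coordinate. The centres are
then at distance at least `8k`, whereas a common point would force at most `6k`. -/
theorem disjoint_ball_boxCenter {k : ℕ} (hk : 1 ≤ k) {z z' : Fin d → ℤ} (hne : z ≠ z')
    (h : ∀ i, (z i : ZMod 4) = z' i) :
    Disjoint (ball (boxCenter k z) (3 * k)) (ball (boxCenter k z') (3 * k)) := by
  obtain ⟨i, hi⟩ := Function.ne_iff.1 hne
  rw [Finset.disjoint_left]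
  intro x hx hx'
  have h1 := mem_ball.1 hx i
  have h2 := mem_ball.1 hx' i
  simp only [boxCenter, Nat.cast_mul, Nat.cast_ofNat] at h1 h2
  have h3 : (4 : ℤ) ∣ z' i - z i :=
    (ZMod.intCast_eq_intCast_iff_dvd_sub (z i) (z' i) 4).1 (h i)
  have h4 : (4 : ℤ) ≤ |z' i - z i| :=
    Int.le_of_dvd (abs_pos.2 (by omega)) ((dvd_abs _ _).2 h3)
  have h5 : |2 * (k : ℤ) * z' i - 2 * k * z i| ≤ 6 * k := by
    have := abs_sub_le (2 * (k : ℤ) * z' i) (x i) (2 * k * z i)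
    rw [abs_sub_comm (2 * (k : ℤ) * z' i) (x i)] at this
    linarith
  rw [← mul_sub, abs_mul, abs_of_nonneg (by positivity)] at h5
  have hk' : (1 : ℤ) ≤ k := by exact_mod_cast hk
  nlinarith

/-- The unit vectors in direction `s.1` and with sign `s.2`. -/
def unitStep (s : Fin d × Bool) : Fin d → ℤ := Pi.single s.1 (if s.2 then 1 else -1)

theorem exists_unitStep {x y : Fin d → ℤ} (h : (lattice d).Adj x y) :
    ∃ s, unitStep s = y - x := by
  have h1 : ∑ i, |x i - y i| = 1 := h
  have hex : ∃ i, |x i - y i| ≠ 0 := by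
    by_contra hcon
    push Not at hcon
    simp [hcon] at h1
  obtain ⟨i, hi⟩ := hex
  have h2 := Finset.add_sum_erase Finset.univ (fun j => |x j - y j|) (Finset.mem_univ i)
  have h3 : 0 ≤ ∑ j ∈ Finset.univ.erase i, |x j - y j| :=
    Finset.sum_nonneg fun j _ => abs_nonneg _
  have h4 : 0 < |x i - y i| := lt_of_le_of_ne (abs_nonneg _) hi.symm
  have h5 : ∑ j ∈ Finset.univ.erase i, |x j - y j| = 0 := by omega
  have h6 : |x i - y i| = 1 := by omega
  rw [Finset.sum_eq_zero_iff_of_nonneg fun j _ => abs_nonneg _] at h5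
  have h7 : ∀ j, j ≠ i → y j - x j = 0 := fun j hj => by
    have := h5 j (Finset.mem_erase.2 ⟨hj, Finset.mem_univ j⟩)
    rw [abs_eq_zero] at this
    omega
  refine ⟨(i, decide (y i - x i = 1)), funext fun j => ?_⟩
  by_cases hj : j = i
  · subst hj
    rcases (abs_eq zero_le_one).1 h6 with h | h
    · have : ¬ y j - x j = 1 := by omega
      simp only [unitStep, this, decide_false, Pi.single_eq_same, Pi.sub_apply]
      simp only [Bool.false_eq_true, if_false]
      omega
    · have : y j - x j = 1 := by omega
      simp [unitStep, this]
  · simp [unitStep, hj, h7 j hj]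

/-- The position after `i` steps of the walk from `x` with steps `s`. -/
def walkPos {n : ℕ} (x : Fin d → ℤ) (s : Fin n → Fin d × Bool) (i : ℕ) : Fin d → ℤ :=
  x + ∑ j ∈ Finset.range i, if h : j < n then unitStep (s ⟨j, h⟩) else 0

/-- Encodes paths by their steps, so that at most `(2d)^n` paths of length `n` enter the union
bound. -/
theorem exists_walkPos {n : ℕ} {w : ℕ → Fin d → ℤ}
    (h : ∀ i < n, (lattice d).Adj (w i) (w (i + 1))) :
    ∃ s : Fin n → Fin d × Bool, ∀ i ≤ n, walkPos (w 0) s i = w i := by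
  choose s hs using fun i : Fin n => exists_unitStep (h i i.2)
  refine ⟨s, fun i hi => ?_⟩
  have : ∑ j ∈ Finset.range i, (if h : j < n then unitStep (s ⟨j, h⟩) else 0) =
      ∑ j ∈ Finset.range i, (w (j + 1) - w j) := by
    refine Finset.sum_congr rfl fun j hj => ?_
    have hj' : j < n := (Finset.mem_range.1 hj).trans_le hi
    rw [dif_pos hj']
    exact hs ⟨j, hj'⟩
  rw [walkPos, this, Finset.sum_range_sub]
  abel

/-- A large part of a finite set of box indices belongs to boxes at a large mutual distance. -/
theorem exists_separated (d m : ℕ) (I : Finset (Fin d → ℤ)) (hI : I.card = 4 ^ d * m) :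
    ∃ J ⊆ I, m ≤ J.card ∧ ∀ z ∈ J, ∀ z' ∈ J, ∀ i, (z i : ZMod 4) = z' i := by
  -- Pigeonhole over the `4^d` residue classes of indices modulo 4.
  obtain ⟨y, -, hy⟩ := Finset.exists_le_card_fiber_of_mul_le_card_of_maps_to (s := I)
    (t := (Finset.univ : Finset (Fin d → ZMod 4))) (f := fun z i => (z i : ZMod 4)) (n := m)
    (fun _ _ => Finset.mem_univ _) Finset.univ_nonempty (by simp [hI, ZMod.card])
  refine ⟨_, Finset.filter_subset _ _, hy, fun z hz z' hz' i => ?_⟩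
  have h1 := congrFun (Finset.mem_filter.1 hz).2 i
  have h2 := congrFun (Finset.mem_filter.1 hz').2 i
  rw [h1, h2]

theorem abs_sub_le_walk_length {x y : Fin d → ℤ} {H : SimpleGraph (Fin d → ℤ)}
    (hH : H ≤ lattice d) (p : H.Walk x y) (i : Fin d) : |y i - x i| ≤ p.length := by
  induction p with
  | nil => simp
  | @cons u v w h p ih =>
    have h1 := lattice_adj_coord (hH h).symm i
    have h2 := abs_sub_le (w i) (v i) (u i)
    rw [SimpleGraph.Walk.length_cons]
    push_cast
    linarith

/-- If the cluster of `x` is infinite, then there is a long self-avoiding path of boxes which are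
crossed. -/
theorem exists_path_of_infinite {k : ℕ} (hk : 1 ≤ k) {ω : Config (lattice d)} {x : Fin d → ℤ}
    (h : {y | (internalGraph ω).Reachable x y}.Infinite) (n : ℕ) :
    ∃ s : Fin n → Fin d × Bool, Set.InjOn (walkPos (boxIndex k x) s) (Finset.range n) ∧
      ∀ i < n, ω ∈ crossing (ball (boxCenter k (walkPos (boxIndex k x) s i)) (3 * k))
        (ball (boxCenter k (walkPos (boxIndex k x) s i)) k)
        (sphere (boxCenter k (walkPos (boxIndex k x) s i)) (3 * k)) := by
  set C := {y | (internalGraph ω).Reachable x y} with hC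
  -- An infinite cluster leaves every finite ball, so from any of its vertices `v` it reaches the
  -- sphere of radius `3k` about the box of `v`.
  have hbad : ∀ v ∈ C, ω ∈ crossing (ball (boxCenter k (boxIndex k v)) (3 * k))
        (ball (boxCenter k (boxIndex k v)) k) (sphere (boxCenter k (boxIndex k v)) (3 * k)) := by
    intro v hv
    obtain ⟨y, hy, hyb⟩ := h.exists_notMem_finset (ball (boxCenter k (boxIndex k v)) (3 * k))
    have hvb := mem_ball_boxCenter hk v
    have hvb' : v ∈ ball (boxCenter k (boxIndex k v)) (3 * k) := mem_ball.2 fun i =>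
      (mem_ball.1 hvb i).trans (by push_cast; linarith)
    have hyb' : ∃ i, ((3 * k : ℕ) : ℤ) ≤ |y i - boxCenter k (boxIndex k v) i| := by
      by_contra hcon
      push Not at hcon
      exact hyb (mem_ball.2 fun i => (hcon i).le)
    obtain ⟨z, hz, hvz⟩ := exists_exit (internalGraph_le ω) hvb' hyb'
      ((SimpleGraph.Reachable.symm hv).trans hy)
    exact ⟨v, hvb, z, hz, hvz⟩
  -- The graph of visited indices: a path in it is a lattice path all of whose boxes are crossed.
  let H : SimpleGraph (Fin d → ℤ) :=
    { Adj := fun a b => (lattice d).Adj a b ∧ a ∈ boxIndex k '' C ∧ b ∈ boxIndex k '' C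
      symm := ⟨fun _ _ h => ⟨h.1.symm, h.2.2, h.2.1⟩⟩
      loopless := ⟨fun _ h => h.1.ne rfl⟩ }
  have hHl : H ≤ lattice d := fun _ _ h => h.1
  have hreach : ∀ v, ∀ p : (internalGraph ω).Walk x v, H.Reachable (boxIndex k x) (boxIndex k v) := by
    have key : ∀ u v, ∀ p : (internalGraph ω).Walk u v, u ∈ C →
        H.Reachable (boxIndex k u) (boxIndex k v) := by
      intro u v p
      induction p with
      | nil => exact fun _ => SimpleGraph.Reachable.refl _
      | @cons a b c hab p ih =>
        intro ha
        have hb : b ∈ C := SimpleGraph.Reachable.trans ha hab.reachable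
        refine SimpleGraph.Reachable.trans ?_ (ih hb)
        rcases boxIndex_adj hk (internalGraph_le ω hab) with h | h
        · rw [h]
        · have : H.Adj (boxIndex k a) (boxIndex k b) :=
            ⟨h, Set.mem_image_of_mem _ ha, Set.mem_image_of_mem _ hb⟩
          exact this.reachable
    exact fun v p => key x v p (SimpleGraph.Reachable.refl _)
  -- Some vertex of the cluster has index at distance more than `n`, which forces a path of visited
  -- indices of length at least `n`.
  obtain ⟨v, hv, hfar⟩ := h.exists_notMem_finset
    ((ball (boxIndex k x) n).biUnion fun z => ball (boxCenter k z) k)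
  have hzv : boxIndex k v ∉ ball (boxIndex k x) n := fun hz =>
    hfar (Finset.mem_biUnion.2 ⟨_, hz, mem_ball_boxCenter hk v⟩)
  obtain ⟨p⟩ := hv
  obtain ⟨w, hw⟩ := (hreach v p).exists_isPath
  have hlen : n ≤ w.length := by
    by_contra hcon
    refine hzv (mem_ball.2 fun i => (abs_sub_le_walk_length hHl w i).trans ?_)
    exact_mod_cast (not_le.1 hcon).le
  have hadj : ∀ i < n, H.Adj (w.getVert i) (w.getVert (i + 1)) := fun i hi =>
    w.adj_getVert_succ (hi.trans_le hlen)
  obtain ⟨s, hs⟩ := exists_walkPos (w := w.getVert) (n := n) fun i hi => (hadj i hi).1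
  rw [w.getVert_zero] at hs
  refine ⟨s, fun i hi j hj hij => ?_, fun i hi => ?_⟩
  · have hi' := Finset.mem_range.1 (Finset.mem_coe.1 hi)
    have hj' := Finset.mem_range.1 (Finset.mem_coe.1 hj)
    rw [hs i hi'.le, hs j hj'.le] at hij
    exact hw.getVert_injOn (hi'.le.trans hlen) (hj'.le.trans hlen) hij
  · rw [hs i hi.le]
    obtain ⟨u, hu, hui⟩ := (hadj i hi).2.1
    rw [← hui]
    exact hbad u hu

theorem delta_pos (hd : 1 ≤ d) : 0 < delta d := by
  have : (0 : ℝ) < 2 * d := by positivity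
  unfold delta animalConst
  positivity

/-- Paths are counted instead of lattice animals, so the only property of `μ` needed is `μ ≥ 2d`. -/
theorem two_mul_pow_mul_delta_le_one (hd : 1 ≤ d) : (2 * d : ℝ) ^ 4 ^ d * delta d ≤ 1 := by
  have h0 : (0 : ℝ) < 2 * d := by positivity
  have h1 : (2 * d : ℝ) ≤ animalConst d := by
    rw [animalConst, le_div_iff₀ (by positivity), ← pow_succ']
    exact pow_le_pow_left₀ h0.le (by linarith) _
  have h2 : (0 : ℝ) < animalConst d := h0.trans_le h1
  rw [delta, ← div_eq_mul_inv, div_le_one (by positivity)]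
  exact pow_le_pow_left₀ h0.le h1 _

/-- If the crossing probability of an annulus is below the threshold, then there is no
percolation. -/
theorem noPercolation_of_crossing_lt (hd : 1 ≤ d) {p q h : ℝ} (hp : p ∈ Set.Icc (0 : ℝ) 1)
    (hq : 1 < q) (hh : 0 ≤ h) {k : ℕ} (hk : 1 ≤ k)
    (hlt : boxMean d p q (extParam q h) (3 * k)
      (eventInd (crossing (box d (3 * k)) (box d k) (boxBoundary d (3 * k)))) < delta d) :
    NoPercolation d p q h := by
  have hr := extParam_mem_Icc hq hh
  obtain ⟨μ, hμ⟩ := exists_isInfiniteVolume (d := d) hp hq hh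
  refine ⟨μ, hμ, ?_⟩
  have hμp := hμ.isProbabilityMeasure
  set a := boxMean d p q (extParam q h) (3 * k)
    (eventInd (crossing (box d (3 * k)) (box d k) (boxBoundary d (3 * k)))) with ha
  have ha0 : 0 ≤ a := fkMean_nonneg (edgeParam_mem_Icc hp hr) hq.le fun ω _ => eventInd_nonneg _ _
  have ha1 : a ≤ 1 := fkMean_le_one (edgeParam_mem_Icc hp hr) hq.le fun ω _ => eventInd_le_one _ _
  have hperc : percolationEvent d =
      ⋃ x, {ω : Config (lattice d) | {y | (internalGraph ω).Reachable x y}.Infinite} := by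
    ext ω; simp [percolationEvent]
  rw [hperc, measure_iUnion_null_iff]
  intro x
  let bad : (Fin d → ℤ) → Set (Config (lattice d)) := fun c =>
    crossing (ball c (3 * k)) (ball c k) (sphere c (3 * k))
  have hinter : ∀ (m : ℕ) (J : Finset (Fin d → ℤ)), m ≤ J.card →
      (∀ z ∈ J, ∀ z' ∈ J, ∀ i, (z i : ZMod 4) = z' i) →
      μ (⋂ z ∈ J, bad (boxCenter k z)) ≤ ENNReal.ofReal (a ^ m) := by
    intro m J hJ hsep
    have hinj : Function.Injective (boxCenter k : (Fin d → ℤ) → _) := by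
      intro z z' hzz
      funext i
      have h1 := congrFun hzz i
      simp only [boxCenter] at h1
      exact mul_left_cancel₀ (by positivity) h1
    have himg : ⋂ z ∈ J, bad (boxCenter k z) = ⋂ c ∈ J.image (boxCenter k), bad c := by
      rw [Finset.set_biInter_finset_image]
    rw [himg]
    have hloc : IsLocal (⋂ c ∈ J.image (boxCenter k), bad c) :=
      isLocal_biInter _ fun c => isLocal_crossing _ _ _
    -- The intersection is local, so it suffices to bound it in all boxes large enough to contain
    -- the finitely many balls.
    refine le_of_tendsto (hμ.tendsto _ hloc) ?_
    have hN : ∃ N : ℕ, ∀ c ∈ J.image (boxCenter k), ∀ i, |c i| + (3 * k : ℕ) ≤ N := by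
      refine ⟨∑ c ∈ J.image (boxCenter k), ∑ i, (c i).natAbs + 3 * k, fun c hc i => ?_⟩
      have h1 : (c i).natAbs ≤ ∑ i, (c i).natAbs :=
        Finset.single_le_sum (f := fun i => (c i).natAbs) (fun _ _ => Nat.zero_le _)
          (Finset.mem_univ i)
      have h2 : ∑ i, (c i).natAbs ≤ ∑ c ∈ J.image (boxCenter k), ∑ i, (c i).natAbs :=
        Finset.single_le_sum (f := fun c : Fin d → ℤ => ∑ i, (c i).natAbs)
          (fun _ _ => Nat.zero_le _) hc
      have h3 : |c i| = ((c i).natAbs : ℤ) := Int.abs_eq_natAbs _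
      rw [h3]
      exact_mod_cast Nat.add_le_add_right (h1.trans h2) _
    obtain ⟨N, hN⟩ := hN
    filter_upwards [eventually_ge_atTop N] with n hn
    rw [wiredMeasure_apply hp hq hh]
    refine ENNReal.ofReal_le_ofReal ?_
    refine (boxMean_biInter_crossing_le hp hr hq.le (J.image (boxCenter k))
      (fun c hc i => (hN c hc i).trans (by exact_mod_cast hn)) ?_).trans ?_
    · intro c hc c' hc' hne
      obtain ⟨z, hz, rfl⟩ := Finset.mem_image.1 hc
      obtain ⟨z', hz', rfl⟩ := Finset.mem_image.1 hc'
      exact disjoint_ball_boxCenter hk (fun h => hne (h ▸ rfl)) (hsep z hz z' hz')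
    · rw [Finset.card_image_of_injective _ hinj]
      exact pow_le_pow_of_le_one ha0 ha1 hJ
  have hbound : ∀ m : ℕ, μ {ω | {y | (internalGraph ω).Reachable x y}.Infinite} ≤
      ENNReal.ofReal (((2 * d : ℝ) ^ 4 ^ d * a) ^ m) := by
    intro m
    -- The separated subset is chosen as a function of the path alone, before the configuration. For
    -- step sequences that are not self-avoiding it is a dummy.
    have hJ : ∀ s : Fin (4 ^ d * m) → Fin d × Bool, ∃ J : Finset (Fin d → ℤ),
        Set.InjOn (walkPos (boxIndex k x) s) (Finset.range (4 ^ d * m)) →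
        J ⊆ (Finset.range (4 ^ d * m)).image (walkPos (boxIndex k x) s) ∧ m ≤ J.card ∧
          ∀ z ∈ J, ∀ z' ∈ J, ∀ i, (z i : ZMod 4) = z' i := by
      intro s
      by_cases hs : Set.InjOn (walkPos (boxIndex k x) s) (Finset.range (4 ^ d * m))
      · obtain ⟨J, hJ⟩ := exists_separated d m
          ((Finset.range (4 ^ d * m)).image (walkPos (boxIndex k x) s))
          (by rw [Finset.card_image_of_injOn hs, Finset.card_range])
        exact ⟨J, fun _ => hJ⟩
      · exact ⟨∅, fun h => absurd h hs⟩
    choose J hJ using hJ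
    classical
    have hsub : {ω : Config (lattice d) | {y | (internalGraph ω).Reachable x y}.Infinite} ⊆
        ⋃ s ∈ Finset.univ.filter fun s : Fin (4 ^ d * m) → Fin d × Bool =>
          Set.InjOn (walkPos (boxIndex k x) s) (Finset.range (4 ^ d * m)),
          ⋂ z ∈ J s, bad (boxCenter k z) := by
      intro ω hω
      obtain ⟨s, hs, hbad⟩ := exists_path_of_infinite hk hω (4 ^ d * m)
      refine Set.mem_biUnion (x := s) (by simpa using hs) ?_
      rw [Set.mem_iInter₂]
      intro z hz
      obtain ⟨i, hi, rfl⟩ := Finset.mem_image.1 ((hJ s hs).1 hz)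
      exact hbad i (Finset.mem_range.1 hi)
    refine (measure_mono hsub).trans ((measure_biUnion_finset_le _ _).trans ?_)
    have hterm : ∀ s ∈ Finset.univ.filter fun s : Fin (4 ^ d * m) → Fin d × Bool =>
          Set.InjOn (walkPos (boxIndex k x) s) (Finset.range (4 ^ d * m)),
        μ (⋂ z ∈ J s, bad (boxCenter k z)) ≤ ENNReal.ofReal (a ^ m) := fun s hs =>
      hinter m (J s) (hJ s (Finset.mem_filter.1 hs).2).2.1 (hJ s (Finset.mem_filter.1 hs).2).2.2
    refine (Finset.sum_le_card_nsmul _ _ _ hterm).trans ?_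
    rw [nsmul_eq_mul, mul_pow, ← pow_mul, ENNReal.ofReal_mul (by positivity)]
    gcongr
    rw [← ENNReal.ofReal_natCast]
    refine ENNReal.ofReal_le_ofReal ?_
    calc _ ≤ ((Finset.univ : Finset (Fin (4 ^ d * m) → Fin d × Bool)).card : ℝ) := by
          exact_mod_cast Finset.card_le_card (Finset.filter_subset _ _)
      _ = _ := by simp [mul_comm]
  have hlim : Tendsto (fun m : ℕ => ENNReal.ofReal (((2 * d : ℝ) ^ 4 ^ d * a) ^ m)) atTop
      (𝓝 0) := by
    rw [← ENNReal.ofReal_zero]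
    refine ENNReal.tendsto_ofReal (tendsto_pow_atTop_nhds_zero_of_lt_one (by positivity) ?_)
    have h0 : (0 : ℝ) < (2 * d : ℝ) ^ 4 ^ d := by positivity
    exact (mul_lt_mul_of_pos_left hlt h0).trans_le (two_mul_pow_mul_delta_le_one hd)
  exact le_antisymm (ge_of_tendsto' hlim hbound) zero_le

end Renormalization

/-! ### Decay from differential inequalities -/

section Analysis

theorem sub_le_of_deriv_ge {f f' : ℝ → ℝ} {a b m : ℝ} (hab : a ≤ b)
    (hf : ∀ s ∈ Set.Icc a b, HasDerivAt f (f' s) s) (hm : ∀ s ∈ Set.Icc a b, m ≤ f' s) :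
    m * (b - a) ≤ f b - f a := by
  refine (convex_Icc a b).mul_sub_le_image_sub_of_le_deriv
    (fun s hs => (hf s hs).continuousAt.continuousWithinAt)
    (fun s hs => ((hf s (interior_subset hs)).differentiableAt).differentiableWithinAt)
    (fun s hs => ?_) a (Set.left_mem_Icc.2 hab) b (Set.right_mem_Icc.2 hab) hab
  rw [(hf s (interior_subset hs)).deriv]
  exact hm s (interior_subset hs)

/-- Grönwall: the hypothesis makes `f s * exp (-(c * s))` nondecreasing. -/
theorem le_mul_exp_of_deriv_ge {f f' : ℝ → ℝ} {a b c : ℝ} (hab : a ≤ b)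
    (hf : ∀ s ∈ Set.Icc a b, HasDerivAt f (f' s) s) (hm : ∀ s ∈ Set.Icc a b, c * f s ≤ f' s) :
    f a ≤ f b * Real.exp (-(c * (b - a))) := by
  have hd : ∀ s ∈ Set.Icc a b, HasDerivAt (fun s => f s * Real.exp (-(c * s)))
      (f' s * Real.exp (-(c * s)) + f s * (Real.exp (-(c * s)) * -(c * 1))) s := fun s hs =>
    (hf s hs).mul (((hasDerivAt_id s).const_mul c).neg.exp)
  have h := sub_le_of_deriv_ge (m := 0) hab hd fun s hs => by
    have h1 := hm s hs
    have h2 := Real.exp_pos (-(c * s))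
    nlinarith
  have h3 : f a * Real.exp (-(c * a)) ≤ f b * Real.exp (-(c * b)) := by linarith
  have h4 := mul_le_mul_of_nonneg_right h3 (Real.exp_pos (c * a)).le
  rw [mul_assoc, mul_assoc, ← Real.exp_add, ← Real.exp_add] at h4
  have e1 : -(c * a) + c * a = 0 := by ring
  have e2 : -(c * b) + c * a = -(c * (b - a)) := by ring
  rwa [e1, e2, Real.exp_zero, mul_one] at h4

theorem sum_Ico_inv_le (a N : ℕ) (ha : 1 ≤ a) :
    ∑ i ∈ Finset.Ico a N, (i : ℝ)⁻¹ ≤ 1 + Real.log N := by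
  have h := harmonic_le_one_add_log N
  rw [harmonic_eq_sum_Icc] at h
  push_cast at h
  refine le_trans (Finset.sum_le_sum_of_subset_of_nonneg ?_ fun i _ _ => by positivity) h
  intro i hi
  rw [Finset.mem_Ico] at hi
  exact Finset.mem_Icc.2 ⟨ha.trans hi.1, hi.2.le⟩

theorem tendsto_pow_mul_exp_neg_sqrt (d : ℕ) {c : ℝ} (hc : 0 < c) :
    Tendsto (fun n : ℕ => (2 * n + 1 : ℝ) ^ d * Real.exp (-(c * √n))) atTop (𝓝 0) := by
  -- Substitute `x = c √n`: for `n ≥ 1`, `(2n+1)^d ≤ (3n)^d = (3/c²)^d x^(2d)`.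
  have h1 : Tendsto (fun n : ℕ => c * √(n : ℝ)) atTop atTop :=
    (Real.tendsto_sqrt_atTop.comp tendsto_natCast_atTop_atTop).const_mul_atTop hc
  have h2 := ((Real.tendsto_pow_mul_exp_neg_atTop_nhds_zero (2 * d)).comp h1).const_mul
    ((3 / c ^ 2) ^ d)
  rw [mul_zero] at h2
  refine squeeze_zero' (Eventually.of_forall fun n => by positivity) ?_ h2
  filter_upwards [eventually_ge_atTop 1] with n hn
  have hn' : (1 : ℝ) ≤ n := by exact_mod_cast hn
  simp only [Function.comp_apply]
  rw [← mul_assoc]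
  refine mul_le_mul_of_nonneg_right ?_ (Real.exp_pos _).le
  rw [pow_mul, ← mul_pow, mul_pow c, Real.sq_sqrt (by positivity)]
  refine pow_le_pow_left₀ (by positivity) ?_ d
  have : 3 / c ^ 2 * (c ^ 2 * n) = 3 * n := by field_simp
  rw [this]
  linarith

variable {θ θ' : ℕ → ℝ → ℝ} {a b : ℝ}

/-- A family of functions with `n * θ n * (1 - θ n) ≤ 2 * (∑ i < n, θ i) * (θ n)'` which tends to
zero at some point decays fast at all smaller points. -/
theorem decay_of_differential_inequality (hab : a < b)
    (h0 : ∀ s ∈ Set.Icc a b, θ 0 s = 1)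
    (h01 : ∀ n, ∀ s ∈ Set.Icc a b, θ n s ∈ Set.Icc (0 : ℝ) 1)
    (hd : ∀ n, ∀ s ∈ Set.Icc a b, HasDerivAt (θ n) (θ' n s) s)
    (hpos : ∀ n, ∀ s ∈ Set.Icc a b, 0 ≤ θ' n s)
    (hineq : ∀ n, 1 ≤ n → ∀ s ∈ Set.Icc a b,
      n * (θ n s * (1 - θ n s)) ≤ 2 * (∑ i ∈ Finset.range n, θ i s) * θ' n s)
    (hlim : Tendsto (fun n => θ n b) atTop (𝓝 0)) (d : ℕ) :
    Tendsto (fun n : ℕ => (2 * n + 1 : ℝ) ^ d * θ n a) atTop (𝓝 0) := by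
  -- The interval is used in two halves: on `[β, b]` the inequality yields `S n β ≤ C √n`, and on
  -- `[a, β]` this bound turns it into exponential decay.
  set β := (a + b) / 2 with hβ
  have haβ : a < β := by linarith
  have hβb : β < b := by linarith
  set S : ℕ → ℝ → ℝ := fun n s => ∑ i ∈ Finset.range n, θ i s with hS
  have hmono : ∀ n, ∀ s ∈ Set.Icc a b, ∀ t ∈ Set.Icc a b, s ≤ t → θ n s ≤ θ n t := by
    intro n s hs t ht hst
    have h := sub_le_of_deriv_ge (m := 0) hst (fun u hu => hd n u ⟨hs.1.trans hu.1, hu.2.trans ht.2⟩)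
      fun u hu => hpos n u ⟨hs.1.trans hu.1, hu.2.trans ht.2⟩
    linarith
  have hSmono : ∀ n, ∀ s ∈ Set.Icc a b, ∀ t ∈ Set.Icc a b, s ≤ t → S n s ≤ S n t :=
    fun n s hs t ht hst => Finset.sum_le_sum fun i _ => hmono i s hs t ht hst
  have hSone : ∀ n, 1 ≤ n → ∀ s ∈ Set.Icc a b, 1 ≤ S n s := fun n hn s hs => by
    rw [← h0 s hs]
    exact Finset.single_le_sum (f := fun i => θ i s) (fun i _ => (h01 i s hs).1)
      (Finset.mem_range.2 hn)
  have hSle : ∀ n, ∀ s ∈ Set.Icc a b, S n s ≤ n := fun n s hs => by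
    refine (Finset.sum_le_card_nsmul _ _ 1 fun i _ => (h01 i s hs).2).trans ?_
    simp
  have hb : b ∈ Set.Icc a b := ⟨hab.le, le_rfl⟩
  have hβm : β ∈ Set.Icc a b := ⟨haβ.le, hβb.le⟩
  -- The bound `1/2` allows `1 - θ` to be replaced by `1/2`; the bound `(b - β) / 8` produces the
  -- exponent `1/2` of `N` in `hlog`.
  have hε : 0 < min (1 / 2) ((b - β) / 8) := lt_min (by norm_num) (by linarith)
  obtain ⟨n₁, hn₁⟩ := eventually_atTop.1 (hlim.eventually (gt_mem_nhds hε))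
  set n₀ := max n₁ 1 with hn₀
  have hn₀1 : 1 ≤ n₀ := le_max_right _ _
  have hsmall : ∀ n, n₀ ≤ n → θ n b ≤ 1 / 2 ∧ θ n b ≤ (b - β) / 8 := fun n hn => by
    have := hn₁ n ((le_max_left _ _).trans hn)
    exact ⟨this.le.trans (min_le_left _ _), this.le.trans (min_le_right _ _)⟩
  have hder : ∀ n, n₀ ≤ n → ∀ s ∈ Set.Icc a b, n * θ n s ≤ 4 * S n s * θ' n s := by
    intro n hn s hs
    have h1 := hineq n (hn₀1.trans hn) s hs
    have h2 := (hmono n s hs b hb hs.2).trans (hsmall n hn).1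
    have h3 := (h01 n s hs).1
    have h4 : (n : ℝ) * (θ n s * (1 / 2)) ≤ n * (θ n s * (1 - θ n s)) := by gcongr; linarith
    change (n : ℝ) * (θ n s * (1 - θ n s)) ≤ 2 * S n s * θ' n s at h1
    linarith
  -- Consider the sum of `θ i / i` over `n₀ ≤ i < N`. Its derivative is at least a quarter of the
  -- sum of `θ i / S i`, which dominates the telescoping sum of `log S (i+1) - log S i`. Its value
  -- at `b` is at most `(1 + log N) (b - β) / 8`.
  have hlog : ∀ N, n₀ ≤ N → Real.log (S N β) ≤ Real.log n₀ + 1 / 2 * (1 + Real.log N) := by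
    intro N hN
    have hN1 : 1 ≤ N := hn₀1.trans hN
    have hT : ∀ s ∈ Set.Icc β b, HasDerivAt (fun s => ∑ i ∈ Finset.Ico n₀ N, (i : ℝ)⁻¹ * θ i s)
        (∑ i ∈ Finset.Ico n₀ N, (i : ℝ)⁻¹ * θ' i s) s := fun s hs =>
      HasDerivAt.fun_sum fun i _ => (hd i s ⟨haβ.le.trans hs.1, hs.2⟩).const_mul _
    have hT' : ∀ s ∈ Set.Icc β b, 1 / 4 * (Real.log (S N β) - Real.log n₀) ≤
        ∑ i ∈ Finset.Ico n₀ N, (i : ℝ)⁻¹ * θ' i s := by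
      intro s hs
      have hs' : s ∈ Set.Icc a b := ⟨haβ.le.trans hs.1, hs.2⟩
      have hstep : ∀ i ∈ Finset.Ico n₀ N,
          1 / 4 * (Real.log (S (i + 1) s) - Real.log (S i s)) ≤ (i : ℝ)⁻¹ * θ' i s := by
        intro i hi
        have hi0 := (Finset.mem_Ico.1 hi).1
        have hi1 : 1 ≤ i := hn₀1.trans hi0
        have p1 : 0 < S i s := zero_lt_one.trans_le (hSone i hi1 s hs')
        have p2 : 0 < S (i + 1) s := zero_lt_one.trans_le (hSone (i + 1) (by omega) s hs')
        have hi' : (0 : ℝ) < i := by exact_mod_cast hi1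
        have h1 : S (i + 1) s = S i s + θ i s := Finset.sum_range_succ _ _
        have h2 := Real.log_le_sub_one_of_pos (div_pos p2 p1)
        rw [Real.log_div p2.ne' p1.ne', h1, add_div, div_self p1.ne', add_sub_cancel_left,
          ← h1] at h2
        have h3 : θ i s / S i s ≤ 4 * ((i : ℝ)⁻¹ * θ' i s) := by
          rw [div_le_iff₀ p1]
          have := hder i hi0 s hs'
          have h4 : θ i s = (i : ℝ)⁻¹ * (i * θ i s) := by field_simp
          rw [h4]
          calc (i : ℝ)⁻¹ * (i * θ i s) ≤ (i : ℝ)⁻¹ * (4 * S i s * θ' i s) := by gcongr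
            _ = _ := by ring
        linarith
      have hsum := Finset.sum_le_sum hstep
      rw [← Finset.mul_sum, Finset.sum_Ico_sub (fun i => Real.log (S i s)) hN] at hsum
      have h5 : Real.log (S N β) ≤ Real.log (S N s) :=
        Real.log_le_log (zero_lt_one.trans_le (hSone N hN1 β hβm)) (hSmono N β hβm s hs' hs.1)
      have h6 : Real.log (S n₀ s) ≤ Real.log n₀ :=
        Real.log_le_log (zero_lt_one.trans_le (hSone n₀ hn₀1 s hs')) (hSle n₀ s hs')
      linarith
    have h1 := sub_le_of_deriv_ge hβb.le hT hT'
    have h2 : 0 ≤ ∑ i ∈ Finset.Ico n₀ N, (i : ℝ)⁻¹ * θ i β :=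
      Finset.sum_nonneg fun i _ => mul_nonneg (by positivity) (h01 i β hβm).1
    have h3 : ∑ i ∈ Finset.Ico n₀ N, (i : ℝ)⁻¹ * θ i b ≤ (1 + Real.log N) * ((b - β) / 8) := by
      calc _ ≤ ∑ i ∈ Finset.Ico n₀ N, (i : ℝ)⁻¹ * ((b - β) / 8) :=
            Finset.sum_le_sum fun i hi => mul_le_mul_of_nonneg_left
              (hsmall i (Finset.mem_Ico.1 hi).1).2 (by positivity)
        _ ≤ _ := by
          rw [← Finset.sum_mul]
          exact mul_le_mul_of_nonneg_right (sum_Ico_inv_le _ _ hn₀1) (by linarith)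
    have h4 : (Real.log (S N β) - Real.log n₀) * (b - β) ≤ 1 / 2 * (1 + Real.log N) * (b - β) := by
      linarith
    have h5 := le_of_mul_le_mul_right h4 (by linarith)
    linarith
  set C : ℝ := n₀ * Real.exp (1 / 2) with hC
  have hn₀pos : (0 : ℝ) < n₀ := by exact_mod_cast hn₀1
  have hCpos : 0 < C := by positivity
  have hSsqrt : ∀ N, n₀ ≤ N → S N β ≤ C * √N := by
    intro N hN
    have hN' : (0 : ℝ) < N := by exact_mod_cast hn₀1.trans hN
    rw [← Real.log_le_log_iff (zero_lt_one.trans_le (hSone N (hn₀1.trans hN) β hβm))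
      (by positivity), Real.log_mul hCpos.ne' (by positivity), hC,
      Real.log_mul hn₀pos.ne' (Real.exp_pos _).ne', Real.log_exp, Real.log_sqrt hN'.le]
    have := hlog N hN
    linarith
  have hdecay : ∀ n, n₀ ≤ n → θ n a ≤ Real.exp (-(1 / (4 * C) * (β - a) * √n)) := by
    intro n hn
    have hn' : (0 : ℝ) < n := by exact_mod_cast hn₀1.trans hn
    -- The rate comes from `n θ ≤ 4 S θ'` and `S ≤ C √n`, hence `θ' ≥ (√n / (4C)) θ`.
    have h := le_mul_exp_of_deriv_ge (c := 1 / (4 * C) * √n) haβ.le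
      (fun s hs => hd n s ⟨hs.1, hs.2.trans hβb.le⟩) fun s hs => by
        have hs' : s ∈ Set.Icc a b := ⟨hs.1, hs.2.trans hβb.le⟩
        have h1 := hder n hn s hs'
        have h2 := (hSmono n s hs' β hβm hs.2).trans (hSsqrt n hn)
        have h3 : (n : ℝ) * θ n s ≤ 4 * (C * √n) * θ' n s := by
          refine h1.trans (mul_le_mul_of_nonneg_right ?_ (hpos n s hs'))
          linarith
        have h4 : (n : ℝ) = √n * √n := (Real.mul_self_sqrt hn'.le).symm
        have h5 : 0 < √(n : ℝ) := Real.sqrt_pos.2 hn'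
        have h6 : √(n : ℝ) * (√n * θ n s) ≤ √n * (4 * C * θ' n s) := by
          calc √(n : ℝ) * (√n * θ n s) = n * θ n s := by rw [← mul_assoc, ← h4]
            _ ≤ _ := h3.trans (le_of_eq (by ring))
        have h7 := le_of_mul_le_mul_left h6 h5
        rw [div_mul_eq_mul_div, one_mul, div_mul_eq_mul_div, div_le_iff₀ (by positivity)]
        linarith
    refine h.trans ((mul_le_of_le_one_left (Real.exp_pos _).le (h01 n β hβm).2).trans ?_)
    refine le_of_eq (congrArg Real.exp ?_)
    ring
  have hc : 0 < 1 / (4 * C) * (β - a) := mul_pos (by positivity) (by linarith)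
  refine squeeze_zero' (Eventually.of_forall fun n => mul_nonneg (by positivity)
    (h01 n a ⟨le_rfl, hab.le⟩).1) ?_ (tendsto_pow_mul_exp_neg_sqrt d hc)
  filter_upwards [eventually_ge_atTop n₀] with n hn
  exact mul_le_mul_of_nonneg_left (hdecay n hn) (by positivity)

end Analysis

/-! ### Russo's formula and monotonicity in the edge parameter -/

section Russo

variable {V : Type*} [DecidableEq V] {q p : ℝ} {D : Finset V} {E : Finset (Sym2 (Option V))}

theorem bernWeight_const {ε : Type*} [DecidableEq ε] {E ω : Finset ε} (hω : ω ⊆ E) (p : ℝ) :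
    bernWeight (fun _ => p) E ω = p ^ ω.card * (1 - p) ^ (E \ ω).card := by
  rw [bernWeight, Finset.prod_ite, Finset.prod_const, Finset.prod_const]
  congr 3
  · ext e
    simp only [Finset.mem_filter]
    exact ⟨fun h => h.2, fun h => ⟨hω h, h⟩⟩
  · ext e
    simp

/-- The logarithmic derivative of `p^o (1-p)^c` is `o/p - c/(1-p)`, with `o + c = |E|`. -/
theorem hasDerivAt_bernWeight {ε : Type*} [DecidableEq ε] {E ω : Finset ε} (hω : ω ⊆ E)
    (h0 : 0 < p) (h1 : p < 1) :
    HasDerivAt (fun p => bernWeight (fun _ => p) E ω)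
      (bernWeight (fun _ => p) E ω * ((ω.card - p * E.card) / (p * (1 - p)))) p := by
  have hcard : (E.card : ℝ) = ω.card + (E \ ω).card := by
    rw [← Finset.card_sdiff_add_card_eq_card hω]
    push_cast
    ring
  simp only [bernWeight_const hω]
  rw [hcard]
  have hp' : 1 - p ≠ 0 := by linarith
  have key : ∀ (a : ℕ) (x : ℝ), x ≠ 0 → (a : ℝ) * x ^ (a - 1) = x ^ a * (a / x) := by
    intro a x hx
    cases a with
    | zero => simp
    | succ a => rw [Nat.add_sub_cancel, pow_succ]; field_simp
  have h := (hasDerivAt_pow ω.card p).fun_mul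
    (((hasDerivAt_id p).const_sub 1).fun_pow (E \ ω).card)
  refine h.congr_deriv ?_
  simp only [id]
  rw [key _ p h0.ne', key _ (1 - p) hp']
  field_simp
  ring

theorem cylMean_fkWeight (P : Sym2 (Option V) → ℝ) (F : Finset (Sym2 (Option V)) → ℝ) :
    cylMean E (fkWeight P q D E) ∅ ∅ F = fkMean P q D E F := by
  rw [cylMean, cylSum_empty, cylSum_empty, fkMean, fkZ]
  simp

/-- **Russo's formula** for random cluster measures. -/
theorem hasDerivAt_fkMean (hq : 1 ≤ q) (h0 : 0 < p) (h1 : p < 1)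
    (F : Finset (Sym2 (Option V)) → ℝ) :
    HasDerivAt (fun p => fkMean (fun _ => p) q D E F)
      ((∑ e ∈ E, wCov E (fkWeight (fun _ => p) q D E) F (openInd e)) / (p * (1 - p))) p := by
  have hZ : 0 < fkZ (fun _ => p) q D E := fkZ_pos (fun _ => ⟨h0.le, h1.le⟩) hq
  have hderiv : ∀ G : Finset (Sym2 (Option V)) → ℝ,
      HasDerivAt (fun p => ∑ ω ∈ E.powerset, fkWeight (fun _ => p) q D E ω * G ω)
        ((∑ ω ∈ E.powerset, fkWeight (fun _ => p) q D E ω * (G ω * ω.card) -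
          p * E.card * ∑ ω ∈ E.powerset, fkWeight (fun _ => p) q D E ω * G ω) /
            (p * (1 - p))) p := by
    intro G
    refine (HasDerivAt.fun_sum fun ω hω => ((hasDerivAt_bernWeight (Finset.mem_powerset.1 hω)
      h0 h1).mul_const (q ^ clusters D ω)).mul_const (G ω)).congr_deriv ?_
    rw [Finset.mul_sum, ← Finset.sum_sub_distrib, Finset.sum_div]
    refine Finset.sum_congr rfl fun ω _ => ?_
    rw [fkWeight]
    ring
  have hZd := hderiv fun _ => 1
  simp only [mul_one, one_mul] at hZd
  -- The number of open edges is the sum of the indicators `openInd e`, which turns its covariance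
  -- with `F` into a sum over edges.
  have hcard : ∀ G : Finset (Sym2 (Option V)) → ℝ,
      ∑ ω ∈ E.powerset, fkWeight (fun _ => p) q D E ω * (G ω * ω.card) =
      ∑ e ∈ E, ∑ ω ∈ E.powerset, fkWeight (fun _ => p) q D E ω * (G ω * openInd e ω) := by
    intro G
    rw [Finset.sum_comm]
    refine Finset.sum_congr rfl fun ω hω => ?_
    rw [← Finset.mul_sum, ← Finset.mul_sum]
    congr 2
    simp only [openInd]
    rw [Finset.sum_ite_mem, Finset.inter_eq_right.2 (Finset.mem_powerset.1 hω)]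
    simp
  have hcov : ∑ e ∈ E, wCov E (fkWeight (fun _ => p) q D E) F (openInd e) =
      (∑ ω ∈ E.powerset, fkWeight (fun _ => p) q D E ω * (F ω * ω.card)) /
          fkZ (fun _ => p) q D E -
        fkMean (fun _ => p) q D E F *
          ((∑ ω ∈ E.powerset, fkWeight (fun _ => p) q D E ω * ω.card) /
            fkZ (fun _ => p) q D E) := by
    have h2 := hcard fun _ => 1
    simp only [one_mul] at h2
    rw [hcard, h2, Finset.sum_div, Finset.sum_div, Finset.mul_sum, ← Finset.sum_sub_distrib]
    refine Finset.sum_congr rfl fun e _ => ?_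
    simp only [wCov, cylMean_fkWeight]
    rfl
  rw [hcov]
  have h := (hderiv F).div hZd hZ.ne'
  refine h.congr_deriv ?_
  rw [fkMean]
  have hp' : 1 - p ≠ 0 := by linarith
  change _ / fkZ (fun _ => p) q D E ^ 2 = _
  have hZ2 : ∑ ω ∈ E.powerset, fkWeight (fun _ => p) q D E ω = fkZ (fun _ => p) q D E := rfl
  rw [hZ2]
  field_simp
  ring

/-- Holley's inequality: for `p ≤ p'` the product weights satisfy the lattice condition edge by
edge, and the cluster factors by supermodularity. -/
theorem fkMean_mono_param (hq : 1 ≤ q) {p' : ℝ} (h0 : 0 ≤ p) (hpp : p ≤ p') (h1 : p' ≤ 1)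
    {f : Finset (Sym2 (Option V)) → ℝ} (hf : ∀ ω, 0 ≤ f ω) (hfm : Monotone f) :
    fkMean (fun _ => p) q D E f ≤ fkMean (fun _ => p') q D E f := by
  have hP : ∀ _ : Sym2 (Option V), p ∈ Set.Icc (0 : ℝ) 1 := fun _ => ⟨h0, hpp.trans h1⟩
  have hP' : ∀ _ : Sym2 (Option V), p' ∈ Set.Icc (0 : ℝ) 1 := fun _ => ⟨h0.trans hpp, h1⟩
  rw [fkMean, fkMean, div_le_div_iff₀ (fkZ_pos hP hq) (fkZ_pos hP' hq)]
  have h := holley_powerset E (w₁ := fkWeight (fun _ => p) q D E)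
    (w₂ := fkWeight (fun _ => p') q D E) (fun s _ => fkWeight_nonneg hP hq s)
    (fun s _ => fkWeight_nonneg hP' hq s) (fun s _ => hf s) (fun s t h _ => hfm h) ?_
  · rw [mul_comm (∑ ω ∈ E.powerset, fkWeight (fun _ => p') q D E ω * f ω)]
    exact h
  · intro s _ t _
    have hb : bernWeight (fun _ => p) E s * bernWeight (fun _ => p') E t ≤
        bernWeight (fun _ => p) E (s ∩ t) * bernWeight (fun _ => p') E (s ∪ t) := by
      simp only [bernWeight, ← Finset.prod_mul_distrib]
      refine Finset.prod_le_prod (fun e _ => ?_) fun e _ => ?_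
      · refine mul_nonneg ?_ ?_ <;> split_ifs <;> linarith
      · by_cases hs : e ∈ s <;> by_cases ht : e ∈ t <;> simp [hs, ht]
        nlinarith
    have hc := clusters_supermodular (Finset.Subset.refl D) (ξ := ∅) (s := s) (t := t) (by simp)
    simp only [Finset.empty_union] at hc
    have hc' := pow_le_pow_right₀ hq hc
    rw [pow_add, pow_add] at hc'
    calc _ = (bernWeight (fun _ => p) E s * bernWeight (fun _ => p') E t) *
          (q ^ clusters D s * q ^ clusters D t) := by unfold fkWeight; ring
      _ ≤ (bernWeight (fun _ => p) E (s ∩ t) * bernWeight (fun _ => p') E (s ∪ t)) *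
          (q ^ clusters D (s ∩ t) * q ^ clusters D (s ∪ t)) :=
        mul_le_mul hb hc' (by positivity)
          (mul_nonneg (bernWeight_nonneg hP _ _) (bernWeight_nonneg hP' _ _))
      _ = _ := by unfold fkWeight; ring

end Russo

/-! ### Sharpness of the phase transition without field -/

section Sharpness

variable {d : ℕ} {p q : ℝ}

/-- Without the external edges all parameters equal `p`, so for `0 < p < 1` all weights are
positive, as OSSS requires, and Russo's formula applies. -/
theorem boxMean_zero (n : ℕ) (F : Finset (Sym2 (Option (Fin d → ℤ))) → ℝ) :
    boxMean d p q 0 n F =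
      fkMean (fun _ => p) q (boxInterior d n) (intEdges (lattice d) (box d n)) F := by
  refine fkMean_of_param_zero (disjoint_extEdges_intEdges _ _ _) (fun e he => ?_) (fun e he => ?_) F
  · obtain ⟨x, -, rfl⟩ := mem_extEdges.1 he
    simp [edgeParam]
  · obtain ⟨x, -, y, -, -, rfl⟩ := mem_intEdges.1 he
    simp [edgeParam]

/-- The event that the origin is connected to the boundary of `Λ_n` in `Λ_n`. -/
def arm (d n : ℕ) : Set (Config (lattice d)) := crossing (box d n) {0} (boxBoundary d n)

/-- The probability of `arm d n` under the wired measure on `Λ_{2n}` without field. -/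
def armProb (d : ℕ) (q : ℝ) (n : ℕ) (p : ℝ) : ℝ := boxMean d p q 0 (2 * n) (eventInd (arm d n))

/-- The supremum norm as a natural number. -/
def supNorm (x : Fin d → ℤ) : ℕ := Finset.univ.sup fun i => (x i).natAbs

theorem natAbs_le_supNorm (x : Fin d → ℤ) (i : Fin d) : (x i).natAbs ≤ supNorm x :=
  Finset.le_sup (f := fun i => (x i).natAbs) (Finset.mem_univ i)

theorem exists_natAbs_eq_supNorm (hd : 1 ≤ d) (x : Fin d → ℤ) :
    ∃ i, (x i).natAbs = supNorm x := by
  have : Nonempty (Fin d) := ⟨⟨0, hd⟩⟩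
  obtain ⟨i, -, hi⟩ := Finset.exists_mem_eq_sup (Finset.univ : Finset (Fin d))
    Finset.univ_nonempty fun i => (x i).natAbs
  exact ⟨i, hi.symm⟩

theorem mem_box_iff_supNorm {n : ℕ} {x : Fin d → ℤ} : x ∈ box d n ↔ supNorm x ≤ n := by
  rw [mem_box, supNorm, Finset.sup_le_iff]
  refine ⟨fun h i _ => ?_, fun h i => ?_⟩
  · have := h i
    rw [Int.abs_eq_natAbs] at this
    omega
  · have := h i (Finset.mem_univ i)
    rw [Int.abs_eq_natAbs]
    omega

/-- The connection probability of `x` to `∂Λ_k` is bounded by an arm probability. -/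
theorem boxMean_crossing_singleton_le (hd : 1 ≤ d) (hp : p ∈ Set.Icc (0 : ℝ) 1) (hq : 1 ≤ q)
    {n k : ℕ} (hk : k ≤ n) {x : Fin d → ℤ} (hx : x ∈ box d n) :
    boxMean d p q 0 (2 * n) (eventInd (crossing (box d n) {x} (boxBoundary d k))) ≤
      armProb d q (Nat.dist k (supNorm x) / 2) p := by
  set t := supNorm x with ht
  -- Halving the distance makes the ball of radius `2j` around `x` fit into `Λ_{2n}`. Comparison
  -- with the wired measure on that ball gives exactly `armProb` at scale `j`.
  set j := Nat.dist k t / 2 with hj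
  have htn : t ≤ n := mem_box_iff_supNorm.1 hx
  have hdist : Nat.dist k t = (k - t) + (t - k) := rfl
  have h0 : (0 : ℝ) ∈ Set.Icc (0 : ℝ) 1 := ⟨le_rfl, zero_le_one⟩
  have h1 : boxMean d p q 0 (2 * n) (eventInd (crossing (box d n) {x} (boxBoundary d k))) ≤
      boxMean d p q 0 (2 * n) (eventInd (crossing (ball x j) {x} (sphere x j))) := by
    refine fkMean_mono (edgeParam_mem_Icc hp h0) hq fun ω _ => eventInd_le ?_
    rintro ⟨x', hx', y, hy, hxy⟩
    rw [Set.mem_singleton_iff.1 hx'] at hxy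
    have hfar : ∃ i, (j : ℤ) ≤ |y i - x i| := by
      have hyk : ∀ i, |y i| ≤ k := mem_box.1 hy.1
      obtain ⟨i, hi⟩ := hy.2
      obtain ⟨i', hi'⟩ := exists_natAbs_eq_supNorm hd x
      rw [← ht] at hi'
      rcases le_total t k with h | h
      · refine ⟨i, ?_⟩
        have h2 := natAbs_le_supNorm x i
        have h3 := abs_sub_abs_le_abs_sub (y i) (x i)
        rw [hi, Int.abs_eq_natAbs (x i)] at h3
        omega
      · refine ⟨i', ?_⟩
        have h2 := hyk i'
        have h3 := abs_sub_abs_le_abs_sub (x i') (y i')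
        rw [abs_sub_comm, Int.abs_eq_natAbs (x i')] at h3
        omega
    obtain ⟨z, hz, hxz⟩ := exists_exit (internalGraph_le _) (mem_ball.2 fun i => by simp) hfar
      (hxy.mono (within_le _ _))
    exact ⟨x, rfl, z, hz, hxz⟩
  refine h1.trans ?_
  have hsub : ball x j ⊆ ball x (2 * j) := fun y hy => mem_ball.2 fun i =>
    (mem_ball.1 hy i).trans (by push_cast; linarith)
  refine (boxMean_le_ball hp h0 hq (c := x) (m := 2 * j) (fun i => ?_) (eventInd_nonneg _)
    (eventInd_crossing_mono _ _ _) (eventInd_crossing_inter ?_)).trans (le_of_eq ?_)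
  · have h2 := natAbs_le_supNorm x i
    rw [← ht] at h2
    rw [Int.abs_eq_natAbs]
    omega
  · intro e he
    obtain ⟨a, ha, b, hb, hab, rfl⟩ := mem_intEdges.1 he
    exact mk_some_some_mem_allEdges.2 ⟨hsub ha, hsub hb, hab⟩
  · rw [armProb, arm]
    congr 1
    funext ω
    rw [eventInd_crossing_map]
    congr 2
    · ext y; simp
    · ext y; simp [sphere]

/-- Each value of the halved distance to `t` is taken by at most four `k`. -/
theorem sum_dist_le {g : ℕ → ℝ} (hg : ∀ i, 0 ≤ g i) {n t : ℕ} (ht : t ≤ n) :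
    ∑ k ∈ Finset.Icc 1 n, g (Nat.dist k t / 2) ≤ 4 * ∑ i ∈ Finset.range n, g i := by
  have hdist : ∀ k, Nat.dist k t = (k - t) + (t - k) := fun k => rfl
  have hmaps : ∀ k ∈ Finset.Icc 1 n, Nat.dist k t / 2 ∈ Finset.range n := fun k hk => by
    rw [Finset.mem_Icc] at hk
    rw [Finset.mem_range, hdist]
    omega
  rw [← Finset.sum_fiberwise_of_maps_to hmaps, Finset.mul_sum]
  refine Finset.sum_le_sum fun i _ => ?_
  rw [Finset.sum_congr rfl fun k hk => by rw [(Finset.mem_filter.1 hk).2], Finset.sum_const,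
    nsmul_eq_mul]
  refine mul_le_mul_of_nonneg_right ?_ (hg i)
  have hsub : (Finset.Icc 1 n).filter (fun k => Nat.dist k t / 2 = i) ⊆
      {t + 2 * i, t + 2 * i + 1, t - 2 * i, t - (2 * i + 1)} := by
    intro k hk
    have := (Finset.mem_filter.1 hk).2
    rw [hdist] at this
    simp only [Finset.mem_insert, Finset.mem_singleton]
    omega
  exact_mod_cast (Finset.card_le_card hsub).trans Finset.card_le_four

/-- The exploration of the clusters of `∂Λ_k` in `Λ_n` proceeds or determines the arm event. -/
theorem arm_exploration {n k : ℕ} (hk : k ≤ n)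
    {E S a : Finset (Sym2 (Option (Fin d → ℤ)))} (hE : intEdges (lattice d) (box d n) ⊆ E) :
    (∀ η ⊆ E \ S, eventInd (arm d n) (a ∪ η) = eventInd (arm d n) a) ∨
      ∃ e ∈ E \ S, ∀ η ⊆ E \ S, ∃ x ∈ box d n, some x ∈ e ∧
        toConfig (lattice d) (a ∪ η) ∈ crossing (box d n) {x} (boxBoundary d k) := by
  by_cases h : ∃ e ∈ intEdges (lattice d) (box d n) \ S, ∃ x ∈ box d n, some x ∈ e ∧
      toConfig (lattice d) a ∈ crossing (box d n) {x} (boxBoundary d k)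
  · right
    obtain ⟨e, he, x, hx, hxe, hcr⟩ := h
    refine ⟨e, Finset.mem_sdiff.2 ⟨hE (Finset.mem_sdiff.1 he).1, (Finset.mem_sdiff.1 he).2⟩,
      fun η _ => ⟨x, hx, hxe, ?_⟩⟩
    obtain ⟨u, hu, v, hv, huv⟩ := hcr
    refine ⟨u, hu, v, hv, huv.mono fun b c hbc => ?_⟩
    rw [within_toConfig_adj] at hbc ⊢
    exact ⟨hbc.1, Finset.mem_union_left _ hbc.2⟩
  · left
    intro η hη
    refine le_antisymm (eventInd_le ?_) (eventInd_crossing_mono _ _ _ Finset.subset_union_left)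
    set Ga := within (internalGraph (toConfig (lattice d) a)) (box d n) with hGa
    set Gη := within (internalGraph (toConfig (lattice d) (a ∪ η))) (box d n) with hGη
    -- No unrevealed edge of `Λ_n` touches a known cluster of `∂Λ_k`, so opening more edges does not
    -- enlarge these clusters. Since `k ≤ n`, any connection from the origin to `∂Λ_n` meets `∂Λ_k`
    -- and is therefore already present in `a`.
    have hstay : ∀ u v, ∀ w : Gη.Walk u v, (∃ z ∈ boxBoundary d k, Ga.Reachable u z) →
        Ga.Reachable u v := by
      intro u v w
      induction w with
      | nil => exact fun _ => SimpleGraph.Reachable.refl _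
      | @cons u v _ huv w ih =>
        rintro ⟨z, hz, huz⟩
        have h1 := within_toConfig_adj.1 huv
        have hub : u ∈ box d n := huv.2.1
        have h2 : s(some u, some v) ∉ η := fun hη' => by
          refine h ⟨s(some u, some v), Finset.mem_sdiff.2 ⟨h1.1, (Finset.mem_sdiff.1 (hη hη')).2⟩,
            u, hub, by simp, u, rfl, z, hz, huz⟩
        have h3 : Ga.Adj u v :=
          within_toConfig_adj.2 ⟨h1.1, (Finset.mem_union.1 h1.2).resolve_right h2⟩
        exact h3.reachable.trans (ih ⟨z, hz, h3.reachable.symm.trans huz⟩)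
    rintro ⟨_, rfl, y, hy, h0y⟩
    have hfar : ∃ i, (k : ℤ) ≤ |y i - (0 : Fin d → ℤ) i| := by
      obtain ⟨i, hi⟩ := hy.2
      exact ⟨i, by simp [hi, hk]⟩
    obtain ⟨z, hz, h0z⟩ := exists_exit (H := Gη) ((within_le _ _).trans (internalGraph_le _))
      (c := 0) (n := k) (mem_ball.2 fun i => by simp) hfar h0y
    rw [sphere_zero] at hz
    have h0z' : Gη.Reachable 0 z := h0z.mono (within_le _ _)
    obtain ⟨w1⟩ := h0z'.symm
    obtain ⟨w2⟩ := h0z'.symm.trans h0y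
    have hzz : ∃ z' ∈ boxBoundary d k, Ga.Reachable z z' := ⟨z, hz, SimpleGraph.Reachable.refl _⟩
    exact ⟨0, rfl, y, hy, (hstay _ _ w1 hzz).symm.trans (hstay _ _ w2 hzz)⟩

theorem fkWeight_pos (h0 : 0 < p) (h1 : p < 1) (hq : 1 ≤ q) {V : Type*} [DecidableEq V]
    (D : Finset V) (E ω : Finset (Sym2 (Option V))) : 0 < fkWeight (fun _ => p) q D E ω := by
  refine mul_pos (Finset.prod_pos fun e _ => ?_) (by positivity)
  split_ifs <;> linarith

/-- The differential inequality for arm probabilities from the OSSS inequality. -/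
theorem armProb_differential_inequality (hd : 1 ≤ d) (hq : 1 ≤ q) (h0 : 0 < p) (h1 : p < 1)
    (n : ℕ) :
    n * (armProb d q n p * (1 - armProb d q n p)) ≤
      8 * (∑ i ∈ Finset.range n, armProb d q i p) *
        ∑ e ∈ intEdges (lattice d) (box d (2 * n)), wCov (intEdges (lattice d) (box d (2 * n)))
          (fkWeight (fun _ => p) q (boxInterior d (2 * n)) (intEdges (lattice d) (box d (2 * n))))
          (eventInd (arm d n)) (openInd e) := by
  classical
  have hp : p ∈ Set.Icc (0 : ℝ) 1 := ⟨h0.le, h1.le⟩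
  have hP : ∀ _ : Sym2 (Option (Fin d → ℤ)), p ∈ Set.Icc (0 : ℝ) 1 := fun _ => hp
  set E := intEdges (lattice d) (box d (2 * n)) with hE
  set w := fkWeight (fun _ => p) q (boxInterior d (2 * n)) E with hw
  have hwpos : ∀ ω ⊆ E, 0 < w ω := fun ω _ => fkWeight_pos h0 h1 hq _ _ _
  have hlat : ∀ s ⊆ E, ∀ t ⊆ E, w s * w t ≤ w (s ∩ t) * w (s ∪ t) := fun s _ t _ =>
    fkWeight_lattice hP hq s t
  have hmean : ∀ F, cylMean E w ∅ ∅ F = boxMean d p q 0 (2 * n) F := fun F => by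
    rw [boxMean_zero, cylMean_fkWeight]
  have hnn : ∀ i, 0 ≤ armProb d q i p := fun i =>
    fkMean_nonneg (edgeParam_mem_Icc hp ⟨le_rfl, zero_le_one⟩) hq fun ω _ => eventInd_nonneg _ _
  have hEn : intEdges (lattice d) (box d n) ⊆ E := by
    intro e he
    obtain ⟨x, hx, y, hy, hxy, rfl⟩ := mem_intEdges.1 he
    have hsub : ∀ z, z ∈ box d n → z ∈ box d (2 * n) := fun z hz => by
      rw [mem_box_iff_supNorm] at hz ⊢; omega
    exact mk_some_some_mem_intEdges.2 ⟨hsub x hx, hsub y hy, hxy⟩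
  let D : ℕ → Sym2 (Option (Fin d → ℤ)) → Finset (Sym2 (Option (Fin d → ℤ))) → Prop :=
    fun k e ω => ∃ x ∈ box d n, some x ∈ e ∧
      toConfig (lattice d) ω ∈ crossing (box d n) {x} (boxBoundary d k)
  -- One OSSS inequality for each `k`. For a single `k` the edges near `∂Λ_k` are revealed almost
  -- surely, but averaged over `k` every edge is rarely revealed.
  have hosss : ∀ k ∈ Finset.Icc 1 n, armProb d q n p * (1 - armProb d q n p) ≤
      ∑ e ∈ E, cylMean E w ∅ ∅ (fun ω => if D k e ω then 1 else 0) *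
        wCov E w (eventInd (arm d n)) (openInd e) := by
    intro k hk
    have h := osss hwpos hlat (f := eventInd (arm d n))
      (fun ω => by unfold eventInd; split_ifs <;> simp) (eventInd_crossing_mono _ _ _)
      (D := D k) fun S _ a _ => arm_exploration (Finset.mem_Icc.1 hk).2 hEn
    rwa [hmean] at h
  -- The constant 8 is 4 from `sum_dist_le` for each of the two endpoints.
  have hreveal : ∀ e ∈ E, ∑ k ∈ Finset.Icc 1 n,
      cylMean E w ∅ ∅ (fun ω => if D k e ω then 1 else 0) ≤
        8 * ∑ i ∈ Finset.range n, armProb d q i p := by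
    intro e he
    obtain ⟨x, -, y, -, -, rfl⟩ := mem_intEdges.1 he
    have hvert : ∀ z : Fin d → ℤ, ∑ k ∈ Finset.Icc 1 n, boxMean d p q 0 (2 * n) (fun ω =>
        if z ∈ box d n then eventInd (crossing (box d n) {z} (boxBoundary d k)) ω else 0) ≤
          4 * ∑ i ∈ Finset.range n, armProb d q i p := by
      intro z
      by_cases hz : z ∈ box d n
      · simp only [hz, if_true]
        refine le_trans (Finset.sum_le_sum fun k hk =>
          boxMean_crossing_singleton_le hd hp hq (Finset.mem_Icc.1 hk).2 hz) ?_
        exact sum_dist_le (g := fun i => armProb d q i p) hnn (mem_box_iff_supNorm.1 hz)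
      · simp only [hz, if_false]
        have : boxMean d p q 0 (2 * n) (fun _ => 0) = 0 :=
          fkMean_const (edgeParam_mem_Icc hp ⟨le_rfl, zero_le_one⟩) hq 0
        rw [this, Finset.sum_const_zero]
        exact mul_nonneg (by norm_num) (Finset.sum_nonneg fun i _ => hnn i)
    have hle : ∀ k, cylMean E w ∅ ∅ (fun ω => if D k s(some x, some y) ω then 1 else 0) ≤
        boxMean d p q 0 (2 * n) (fun ω =>
          if x ∈ box d n then eventInd (crossing (box d n) {x} (boxBoundary d k)) ω else 0) +
        boxMean d p q 0 (2 * n) (fun ω =>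
          if y ∈ box d n then eventInd (crossing (box d n) {y} (boxBoundary d k)) ω else 0) := by
      intro k
      rw [hmean]
      have hadd : ∀ F G : Finset (Sym2 (Option (Fin d → ℤ))) → ℝ,
          boxMean d p q 0 (2 * n) F + boxMean d p q 0 (2 * n) G =
            boxMean d p q 0 (2 * n) (fun ω => F ω + G ω) := fun F G => by
        simp only [boxMean, fkMean, mul_add, Finset.sum_add_distrib, add_div]
      rw [hadd]
      refine fkMean_mono (edgeParam_mem_Icc hp ⟨le_rfl, zero_le_one⟩) hq fun ω _ => ?_
      have hn : ∀ z : Fin d → ℤ, 0 ≤ if z ∈ box d n then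
          eventInd (crossing (box d n) {z} (boxBoundary d k)) ω else 0 := fun z => by
        split_ifs
        · exact eventInd_nonneg _ _
        · exact le_rfl
      by_cases hDk : D k s(some x, some y) ω
      · rw [if_pos hDk]
        obtain ⟨z, hz, hze, hcr⟩ := hDk
        have h1 : (1 : ℝ) = if z ∈ box d n then
            eventInd (crossing (box d n) {z} (boxBoundary d k)) ω else 0 := by
          rw [if_pos hz, eventInd, if_pos hcr]
        rw [h1]
        simp only [Sym2.mem_iff, Option.some.injEq] at hze
        rcases hze with rfl | rfl
        · exact le_add_of_nonneg_right (hn y)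
        · exact le_add_of_nonneg_left (hn x)
      · rw [if_neg hDk]
        exact add_nonneg (hn x) (hn y)
    refine (Finset.sum_le_sum fun k _ => hle k).trans ?_
    rw [Finset.sum_add_distrib]
    linarith [hvert x, hvert y]
  calc (n : ℝ) * (armProb d q n p * (1 - armProb d q n p))
      = ∑ _k ∈ Finset.Icc 1 n, armProb d q n p * (1 - armProb d q n p) := by simp
    _ ≤ ∑ k ∈ Finset.Icc 1 n, ∑ e ∈ E, cylMean E w ∅ ∅ (fun ω => if D k e ω then 1 else 0) *
        wCov E w (eventInd (arm d n)) (openInd e) := Finset.sum_le_sum hosss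
    _ = ∑ e ∈ E, (∑ k ∈ Finset.Icc 1 n, cylMean E w ∅ ∅ (fun ω => if D k e ω then 1 else 0)) *
        wCov E w (eventInd (arm d n)) (openInd e) := by
      rw [Finset.sum_comm]
      exact Finset.sum_congr rfl fun e _ => (Finset.sum_mul _ _ _).symm
    _ ≤ ∑ e ∈ E, (8 * ∑ i ∈ Finset.range n, armProb d q i p) *
        wCov E w (eventInd (arm d n)) (openInd e) :=
      Finset.sum_le_sum fun e he => mul_le_mul_of_nonneg_right (hreveal e he)
        (wCov_openInd_nonneg hwpos hlat (eventInd_nonneg _) (eventInd_crossing_mono _ _ _) he)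
    _ = _ := (Finset.mul_sum _ _ _).symm

end Sharpness

/-! ### Subcritical decay, the crossing estimate and the effect of the field. -/

section Main

variable {d : ℕ} {p q : ℝ}

theorem extParam_zero (q : ℝ) : extParam q 0 = 0 := by simp [extParam]

theorem arm_anti {m n : ℕ} (h : m ≤ n) : arm d n ⊆ arm d m := by
  rintro ω ⟨x, hx, y, hy, hxy⟩
  rw [Set.mem_singleton_iff.1 hx] at hxy
  have hfar : ∃ i, (m : ℤ) ≤ |y i - (0 : Fin d → ℤ) i| := by
    obtain ⟨i, hi⟩ := hy.2
    exact ⟨i, by simp [hi, h]⟩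
  obtain ⟨z, hz, hxz⟩ := exists_exit (internalGraph_le ω) (mem_ball.2 fun i => by simp) hfar
    (hxy.mono (within_le _ _))
  rw [ball_zero] at hxz
  rw [sphere_zero] at hz
  exact ⟨0, rfl, z, hz, hxz⟩

theorem iInter_arm_subset : ⋂ m, arm d m ⊆ percolationEvent d := by
  intro ω hω
  refine ⟨0, fun hfin => ?_⟩
  set m := hfin.toFinset.sup supNorm with hm
  obtain ⟨x, hx, y, hy, hxy⟩ := Set.mem_iInter.1 hω (m + 1)
  rw [Set.mem_singleton_iff.1 hx] at hxy
  have h1 : supNorm y ≤ m :=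
    Finset.le_sup (f := supNorm) (hfin.mem_toFinset.2 (hxy.mono (within_le _ _)))
  obtain ⟨i, hi⟩ := hy.2
  have h2 := natAbs_le_supNorm y i
  push_cast at hi
  rw [Int.abs_eq_natAbs] at hi
  omega

/-- In infinite volume the arm events decrease to a part of the percolation event, so `arm d m` has
small probability for some `m`. For large `n` the wired box `Λ_{2n}` gives `arm d m` nearly the same
probability, and `arm d n` is contained in it. -/
theorem tendsto_armProb_of_noPercolation (hp : p ∈ Set.Icc (0 : ℝ) 1) (hq : 1 < q)
    (h : NoPercolation d p q 0) : Tendsto (fun n => armProb d q n p) atTop (𝓝 0) := by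
  obtain ⟨μ, hμ, hperc⟩ := h
  have hμp := hμ.isProbabilityMeasure
  have hloc : ∀ m, IsLocal (arm d m) := fun m => isLocal_crossing _ _ _
  have hlim : Tendsto (fun m => μ (arm d m)) atTop (𝓝 0) := by
    rw [← measure_mono_null iInter_arm_subset hperc]
    exact tendsto_measure_iInter_atTop
      (fun m => (hloc m).isClopen.isOpen.measurableSet.nullMeasurableSet)
      (fun _ _ h => arm_anti h) ⟨0, measure_ne_top _ _⟩
  have hr : (0 : ℝ) ∈ Set.Icc (0 : ℝ) 1 := ⟨le_rfl, zero_le_one⟩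
  refine tendsto_order.2 ⟨fun a ha => Eventually.of_forall fun n => ha.trans_le
    (fkMean_nonneg (edgeParam_mem_Icc hp hr) hq.le fun ω _ => eventInd_nonneg _ _),
    fun a ha => ?_⟩
  obtain ⟨m, hm⟩ := (hlim.eventually (gt_mem_nhds (ENNReal.ofReal_pos.2 ha))).exists
  have h2 := ((hμ.tendsto _ (hloc m)).comp
    (tendsto_id.const_mul_atTop' (by norm_num : 0 < 2))).eventually (gt_mem_nhds hm)
  filter_upwards [h2, eventually_ge_atTop m] with n hn hmn
  simp only [Function.comp_apply, id] at hn
  rw [wiredMeasure_apply hp hq le_rfl, extParam_zero, ENNReal.ofReal_lt_ofReal_iff ha] at hn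
  exact (fkMean_mono (edgeParam_mem_Icc hp hr) hq.le
    fun ω _ => eventInd_le fun h => arm_anti hmn h).trans_lt hn

/-- Subcritical arm probabilities decay faster than any power. -/
theorem tendsto_pow_mul_armProb (hd : 1 ≤ d) (hq : 1 < q) (hp : 0 < p)
    (hpc : p < criticalP d q 0) :
    Tendsto (fun n : ℕ => (2 * n + 1 : ℝ) ^ d * armProb d q n p) atTop (𝓝 0) := by
  -- If the set were empty, the supremum would be 0 by convention, contradicting `0 < p < p_c`.
  have hne : {p | p ∈ Set.Icc (0 : ℝ) 1 ∧ NoPercolation d p q 0}.Nonempty := by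
    by_contra hcon
    rw [Set.not_nonempty_iff_eq_empty] at hcon
    rw [criticalP, hcon, Real.sSup_empty] at hpc
    linarith
  obtain ⟨p₂, ⟨hp₂, hno⟩, hlt⟩ := exists_lt_of_lt_csSup hne hpc
  -- Choosing `b` strictly below the point `p₂` without percolation ensures `b < 1`, where Russo's
  -- formula is available. Arm probabilities at `b` still vanish in the limit by monotonicity.
  set b := (p + p₂) / 2 with hb
  have hpb : p < b := by linarith
  have hbp₂ : b < p₂ := by linarith
  have hb1 : b < 1 := hbp₂.trans_le hp₂.2
  have h01 : ∀ s ∈ Set.Icc p b, 0 < s ∧ s < 1 := fun s hs =>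
    ⟨hp.trans_le hs.1, hs.2.trans_lt hb1⟩
  have hIcc : ∀ n, ∀ s ∈ Set.Icc (0 : ℝ) 1, armProb d q n s ∈ Set.Icc (0 : ℝ) 1 := fun n s hs =>
    ⟨fkMean_nonneg (edgeParam_mem_Icc hs ⟨le_rfl, zero_le_one⟩) hq.le
      fun ω _ => eventInd_nonneg _ _, fkMean_le_one (edgeParam_mem_Icc hs ⟨le_rfl, zero_le_one⟩)
      hq.le fun ω _ => eventInd_le_one _ _⟩
  have hIcc' : ∀ n, ∀ s ∈ Set.Icc p b, armProb d q n s ∈ Set.Icc (0 : ℝ) 1 := fun n s hs =>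
    hIcc n s ⟨(h01 s hs).1.le, (h01 s hs).2.le⟩
  have hlim : Tendsto (fun n => armProb d q n b) atTop (𝓝 0) := by
    refine squeeze_zero (fun n => (hIcc' n b ⟨hpb.le, le_rfl⟩).1) (fun n => ?_)
      (tendsto_armProb_of_noPercolation hp₂ hq hno)
    rw [armProb, armProb, boxMean_zero, boxMean_zero]
    exact fkMean_mono_param hq.le (hp.trans hpb).le hbp₂.le hp₂.2 (eventInd_nonneg _)
      (eventInd_crossing_mono _ _ _)
  set cov : ℕ → ℝ → ℝ := fun n s =>
    ∑ e ∈ intEdges (lattice d) (box d (2 * n)), wCov (intEdges (lattice d) (box d (2 * n)))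
      (fkWeight (fun _ => s) q (boxInterior d (2 * n)) (intEdges (lattice d) (box d (2 * n))))
      (eventInd (arm d n)) (openInd e) with hcov
  have hcov0 : ∀ n, ∀ s ∈ Set.Icc p b, 0 ≤ cov n s := fun n s hs =>
    Finset.sum_nonneg fun e he => wCov_openInd_nonneg
      (fun ω _ => fkWeight_pos (h01 s hs).1 (h01 s hs).2 hq.le _ _ _)
      (fun a _ c _ => fkWeight_lattice (fun _ => ⟨(h01 s hs).1.le, (h01 s hs).2.le⟩) hq.le a c)
      (eventInd_nonneg _) (eventInd_crossing_mono _ _ _) he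
  refine decay_of_differential_inequality (θ := fun n s => armProb d q n s)
    (θ' := fun n s => cov n s / (s * (1 - s))) hpb ?_ hIcc' ?_ ?_ ?_ hlim d
  · intro s hs
    have : eventInd (arm d 0) = fun _ => (1 : ℝ) := by
      funext ω
      refine if_pos ⟨0, rfl, 0, ⟨mem_box.2 fun i => by simp, ⟨0, hd⟩, by simp⟩,
        SimpleGraph.Reachable.refl _⟩
    simp only [armProb, this]
    exact fkMean_const (edgeParam_mem_Icc ⟨(h01 s hs).1.le, (h01 s hs).2.le⟩
      ⟨le_rfl, zero_le_one⟩) hq.le 1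
  · intro n s hs
    have h := hasDerivAt_fkMean (D := boxInterior d (2 * n))
      (E := intEdges (lattice d) (box d (2 * n))) hq.le (h01 s hs).1 (h01 s hs).2
      (eventInd (arm d n))
    refine h.congr_of_eventuallyEq (Eventually.of_forall fun t => ?_)
    exact boxMean_zero _ _
  · intro n s hs
    exact div_nonneg (hcov0 n s hs)
      (mul_nonneg (h01 s hs).1.le (sub_nonneg.2 (h01 s hs).2.le))
  · intro n _ s hs
    obtain ⟨hs0, hs1⟩ := h01 s hs
    refine (armProb_differential_inequality hd hq.le hs0 hs1 n).trans ?_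
    have hS : 0 ≤ ∑ i ∈ Finset.range n, armProb d q i s :=
      Finset.sum_nonneg fun i _ => (hIcc' i s hs).1
    -- From `s (1 - s) ≤ 1/4`; this turns the constant 8 into the 2 required by the decay lemma.
    have h4 : 4 * cov n s ≤ cov n s / (s * (1 - s)) := by
      rw [le_div_iff₀ (mul_pos hs0 (sub_pos.2 hs1))]
      have : s * (1 - s) ≤ 1 / 4 := by nlinarith [sq_nonneg (s - 1 / 2)]
      nlinarith [hcov0 n s hs]
    change 8 * _ * cov n s ≤ _
    calc 8 * (∑ i ∈ Finset.range n, armProb d q i s) * cov n s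
        = 2 * (∑ i ∈ Finset.range n, armProb d q i s) * (4 * cov n s) := by ring
      _ ≤ _ := mul_le_mul_of_nonneg_left h4 (by positivity)

/-- Union bound over the starting vertex `x ∈ Λ_k`: a crossing yields an arm from `x` to distance
`k`, and the ball of radius `2k` around `x`, on which `armProb` is defined, lies in `Λ_{3k}`. -/
theorem boxMean_crossing_le (hp : p ∈ Set.Icc (0 : ℝ) 1) (hq : 1 ≤ q) (k : ℕ) :
    boxMean d p q 0 (3 * k) (eventInd (crossing (box d (3 * k)) (box d k)
      (boxBoundary d (3 * k)))) ≤ (2 * k + 1 : ℝ) ^ d * armProb d q k p := by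
  have hr : (0 : ℝ) ∈ Set.Icc (0 : ℝ) 1 := ⟨le_rfl, zero_le_one⟩
  have h1 : boxMean d p q 0 (3 * k) (eventInd (crossing (box d (3 * k)) (box d k)
      (boxBoundary d (3 * k)))) ≤ boxMean d p q 0 (3 * k)
        (fun ω => ∑ x ∈ box d k, eventInd (crossing (ball x k) {x} (sphere x k)) ω) := by
    refine fkMean_mono (edgeParam_mem_Icc hp hr) hq fun ω _ => ?_
    by_cases h : toConfig (lattice d) ω ∈ crossing (box d (3 * k)) (box d k)
      (boxBoundary d (3 * k))
    · obtain ⟨x, hx, y, hy, hxy⟩ := id h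
      have hfar : ∃ i, (k : ℤ) ≤ |y i - x i| := by
        obtain ⟨i, hi⟩ := hy.2
        have h2 := mem_box.1 hx i
        have h3 := abs_sub_abs_le_abs_sub (y i) (x i)
        rw [hi] at h3
        push_cast at h3
        exact ⟨i, by linarith⟩
      obtain ⟨z, hz, hxz⟩ := exists_exit (internalGraph_le _) (mem_ball.2 fun i => by simp) hfar
        (hxy.mono (within_le _ _))
      refine le_trans ?_ (Finset.single_le_sum
        (f := fun x => eventInd (crossing (ball x k) {x} (sphere x k)) ω)
        (fun x _ => eventInd_nonneg _ _) hx)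
      exact eventInd_le fun _ => ⟨x, rfl, z, hz, hxz⟩
    · rw [eventInd, if_neg h]
      exact Finset.sum_nonneg fun x _ => eventInd_nonneg _ _
  refine h1.trans ?_
  rw [boxMean, fkMean_sum]
  have hcard : (2 * k + 1 : ℝ) ^ d = (box d k).card := by rw [card_box]; push_cast; ring
  rw [hcard, ← nsmul_eq_mul]
  refine Finset.sum_le_card_nsmul _ _ _ fun x hx => ?_
  have hsub : ball x k ⊆ ball x (2 * k) := fun y hy => mem_ball.2 fun i =>
    (mem_ball.1 hy i).trans (by push_cast; linarith)
  refine (boxMean_le_ball hp hr hq (c := x) (m := 2 * k) (n := 3 * k) (fun i => ?_)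
    (eventInd_nonneg _) (eventInd_crossing_mono _ _ _) (eventInd_crossing_inter ?_)).trans
    (le_of_eq ?_)
  · have := mem_box.1 hx i
    push_cast
    linarith
  · intro e he
    obtain ⟨a, ha, b, hb, hab, rfl⟩ := mem_intEdges.1 he
    exact mk_some_some_mem_allEdges.2 ⟨hsub ha, hsub hb, hab⟩
  · rw [armProb, arm]
    congr 1
    funext ω
    rw [eventInd_crossing_map]
    congr 2
    · ext y; simp
    · ext y; simp [sphere]

/-- A small field changes probabilities at most by the probability that an external edge is open. -/
theorem boxMean_field_le (hp : p ∈ Set.Icc (0 : ℝ) 1) {r : ℝ} (hr : r ∈ Set.Icc (0 : ℝ) 1)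
    (hq : 1 ≤ q) (n : ℕ) (A : Set (Config (lattice d))) :
    boxMean d p q r n (eventInd A) ≤
      boxMean d p q 0 n (eventInd A) + (1 - (1 - r) ^ (box d n).card) := by
  have hprod : ∏ e ∈ extEdges (box d n), (1 - edgeParam p r e) = (1 - r) ^ (box d n).card := by
    rw [extEdges, Finset.prod_image fun u _ v _ h => by simpa using h]
    simp [edgeParam]
  have hint : fkMean (edgeParam p r) q (boxInterior d n) (intEdges (lattice d) (box d n))
      (eventInd A) = boxMean d p q 0 n (eventInd A) := by
    rw [boxMean_zero]
    have h := fkMean_of_param_zero (q := q) (D := boxInterior d n) (X := ∅)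
      (I := intEdges (lattice d) (box d n)) (P := fun _ => p) (P₀ := edgeParam p r)
      (Finset.disjoint_empty_left _) (by simp) (fun e he => ?_) (eventInd A)
    · rwa [Finset.empty_union] at h
    · obtain ⟨x, -, y, -, -, rfl⟩ := mem_intEdges.1 he
      simp [edgeParam]
  rw [← hint, ← hprod]
  exact fkMean_union_le (edgeParam_mem_Icc hp hr) hq (disjoint_extEdges_intEdges _ _ _)
    (eventInd_nonneg _) (eventInd_le_one _)

end Main

end RandomCluster

end

theorem mainTheorem8 (d : ℕ) (hd : 1 ≤ d) (q : ℝ) (hq : 1 < q) (p : ℝ) (hp : 0 < p)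
    (hpc : p < criticalP d q 0) :
    ∃ k : ℕ,
      IsLeast {k : ℕ | (wiredMeasure d p q 0 (3 * k)).real
        (connects d (box d k) (boxBoundary d (3 * k))) < delta d / 2} k ∧
      (∀ h : ℝ, 0 ≤ h →
        extParam q h < 1 - (1 - delta d / 2) ^ (1 / ((box d (3 * k)).card : ℝ)) →
        NoPercolation d p q h) ∧
      ENNReal.ofReal (-((q - 1) / q) * (Real.log (1 - delta d / 2) / ((box d (3 * k)).card : ℝ)))
        ≤ criticalH d p q := by
  have hp1 : p ≤ 1 := hpc.le.trans (Real.sSup_le (fun x hx => hx.1.2) zero_le_one)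
  have hpI : p ∈ Set.Icc (0 : ℝ) 1 := ⟨hp.le, hp1⟩
  have hr0 : (0 : ℝ) ∈ Set.Icc (0 : ℝ) 1 := ⟨le_rfl, zero_le_one⟩
  have hδ := delta_pos hd
  have hδ1 : delta d ≤ 1 := by
    have h1 := two_mul_pow_mul_delta_le_one hd
    have hd' : (1 : ℝ) ≤ d := by exact_mod_cast hd
    have h2 : (1 : ℝ) ≤ (2 * d : ℝ) ^ 4 ^ d := one_le_pow₀ (by linarith)
    nlinarith
  have hreal : ∀ k : ℕ, (wiredMeasure d p q 0 (3 * k)).real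
      (connects d (box d k) (boxBoundary d (3 * k))) = boxMean d p q 0 (3 * k)
        (eventInd (crossing (box d (3 * k)) (box d k) (boxBoundary d (3 * k)))) := by
    intro k
    have hcongr : boxMean d p q 0 (3 * k) (eventInd (connects d (box d k)
        (boxBoundary d (3 * k)))) = boxMean d p q 0 (3 * k)
        (eventInd (crossing (box d (3 * k)) (box d k) (boxBoundary d (3 * k)))) :=
      fkMean_congr fun ω hω => eventInd_connects hω
    rw [measureReal_def, wiredMeasure_apply hpI hq le_rfl, extParam_zero, ENNReal.toReal_ofReal,
      hcongr]
    exact fkMean_nonneg (edgeParam_mem_Icc hpI hr0) hq.le fun ω _ => eventInd_nonneg _ _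
  have hne : {k : ℕ | (wiredMeasure d p q 0 (3 * k)).real
      (connects d (box d k) (boxBoundary d (3 * k))) < delta d / 2}.Nonempty := by
    obtain ⟨k, hk⟩ := ((tendsto_pow_mul_armProb hd hq hp hpc).eventually
      (gt_mem_nhds (half_pos hδ))).exists
    refine ⟨k, (hreal k).trans_lt ?_⟩
    exact (boxMean_crossing_le hpI hq.le k).trans_lt hk
  set k := sInf {k : ℕ | (wiredMeasure d p q 0 (3 * k)).real
      (connects d (box d k) (boxBoundary d (3 * k))) < delta d / 2} with hkdef
  have hkmem := Nat.sInf_mem hne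
  rw [← hkdef] at hkmem
  have hk : boxMean d p q 0 (3 * k) (eventInd (crossing (box d (3 * k)) (box d k)
      (boxBoundary d (3 * k)))) < delta d / 2 := by
    rw [← hreal]; exact hkmem
  -- For `k = 0` the origin belongs to both sets, as `d ≥ 1`, and the crossing is certain.
  have hk1 : 1 ≤ k := by
    by_contra hcon
    have hk0 : k = 0 := by omega
    rw [hk0] at hk
    have : eventInd (crossing (box d (3 * 0)) (box d 0) (boxBoundary d (3 * 0))) =
        fun _ => (1 : ℝ) := by
      funext ω
      exact if_pos ⟨0, mem_box.2 fun i => by simp, 0, ⟨mem_box.2 fun i => by simp, ⟨0, hd⟩,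
        by simp⟩, SimpleGraph.Reachable.refl _⟩
    rw [this, boxMean, fkMean_const (edgeParam_mem_Icc hpI hr0) hq.le] at hk
    linarith
  have hcard : 0 < (box d (3 * k)).card := by rw [card_box]; positivity
  have hbase : 0 < 1 - delta d / 2 := by linarith
  have hmain : ∀ h : ℝ, 0 ≤ h →
      extParam q h < 1 - (1 - delta d / 2) ^ (1 / ((box d (3 * k)).card : ℝ)) →
      NoPercolation d p q h := by
    intro h hh hlt
    have hr := extParam_mem_Icc hq hh
    refine noPercolation_of_crossing_lt hd hpI hq hh hk1 ?_
    have h1 := boxMean_field_le (q := q) hpI hr hq.le (3 * k)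
      (crossing (box d (3 * k)) (box d k) (boxBoundary d (3 * k)))
    -- The `|Λ_{3k}|`-th power of the hypothesis on `p_h`: the field costs less than `δ/2`, and zero
    -- field crossing costs less than `δ/2`.
    have h2 : 1 - delta d / 2 < (1 - extParam q h) ^ (box d (3 * k)).card := by
      have h3 : (1 - delta d / 2) ^ (1 / ((box d (3 * k)).card : ℝ)) < 1 - extParam q h := by
        linarith
      have h4 := pow_lt_pow_left₀ h3 (Real.rpow_nonneg hbase.le _) hcard.ne'
      rwa [one_div, Real.rpow_inv_natCast_pow hbase.le hcard.ne'] at h4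
    linarith
  refine ⟨k, ⟨hkmem, fun j hj => Nat.sInf_le hj⟩, hmain, ?_⟩
  -- The condition on `p_h` is strict, so the bound itself need not be an admissible field; every
  -- smaller `c` is, which suffices for a supremum.
  refine le_of_forall_lt_imp_le_of_dense fun c hc => ?_
  have hctop : c ≠ ⊤ := (hc.trans_le le_top).ne
  have hc' : c.toReal < -((q - 1) / q) *
      (Real.log (1 - delta d / 2) / ((box d (3 * k)).card : ℝ)) :=
    (ENNReal.lt_ofReal_iff_toReal_lt hctop).1 hc
  have hno : NoPercolation d p q c.toReal := by
    refine hmain _ ENNReal.toReal_nonneg ?_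
    rw [extParam, Real.rpow_def_of_pos hbase, sub_lt_sub_iff_left, Real.exp_lt_exp]
    have hq1 : 0 < q - 1 := by linarith
    have h1 := mul_lt_mul_of_pos_left hc' (div_pos (by linarith : 0 < q) hq1)
    have h2 : q / (q - 1) * (-((q - 1) / q) *
        (Real.log (1 - delta d / 2) / ((box d (3 * k)).card : ℝ))) =
        -(Real.log (1 - delta d / 2) * (1 / ((box d (3 * k)).card : ℝ))) := by
      field_simp
    rw [h2] at h1
    linarith
  rw [← ENNReal.ofReal_toReal hctop]
  exact le_iSup₂_of_le (f := fun (h : ℝ) (_ : 0 ≤ h ∧ NoPercolation d p q h) => ENNReal.ofReal h)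
    c.toReal ⟨ENNReal.toReal_nonneg, hno⟩ le_rfl
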